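/- **Theorem (Liveness of the LDS algorithm).** Let $n_1,n_2,f_1,f_2,k,d$ be natural numbers with $n_1=2f_1+k$, $n_2=2f_2+d$, $f_1<n_1/2$, $f_2<n_2/3$, and let $\mathcal C$ be an exact-repair $\{(n_1+n_2,k,d)(\alpha,\beta)\}$ regenerating code over a finite field $\mathbb F_q$ at the minimum bandwidth (MBR) point, $1\le k\le d<n_1+n_2$, $\beta\geq 1$, $\alpha=d\beta$: a value $v\in\mathcal V=\mathbb F_q^B$, $B=\sum_{i<k}(d-i)\beta$, is encoded into $c_1(v),\dots,c_{n_1+n_2}(v)\in\mathbb F_q^\alpha$, any $k$ of which determine $v$; helper $i$ computes from $c_i$ and $j$ alone helper data $h_{i,j}\in\mathbb F_q^\beta$, and the helper data of any $d$ helpers determine $c_j$. In every well-formed execution of the LDS algorithm described below in which at most $f_1$ servers of $\mathcal L_1$ and at most $f_2$ servers of $\mathcal L_2$ crash (and any number of clients), every read or write operation invoked by a non-faulty client completes. **System.** Writers (with totally ordered ids) $\mathcal W$, readers $\mathcal R$, servers $\mathcal L_1=\{s_1,\dots,s_{n_1}\}$ and $\mathcal L_2=\{s_{n_1+1},\dots,s_{n_1+n_2}\}$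 communicate by asynchronous, not necessarily FIFO, channels: every message in a channel whose destination never crashes is eventually received. Processes may crash at any time, also in the middle of a local action when only some of its messages have been sent; a crashed process takes no further steps. Executions start in the initial state. Well-formed: a client invokes an operation only when its previous one, if any, is complete. Tags are pairs $(z,w)\in\mathbb N\times\mathcal W$, ordered lexicographically; $t_0=(0,w_0)$ is the initial tag and $v_0$ the initial value. Query requests and their answers, and all messages that belong to a read, carry the identity of the operation (client and sequence number), and clients ignore answers to other operations or phases; an ACK to a writer carries the tag. **Broadcast** of a message to $\mathcal L_1$: the initiator sends it to a fixed set $S$ of $f_1+1$ servers of $\mathcal L_1$; each of these, on its first copy, sends it to all of $\mathcal L_1$ (first to $S$, then to the others) before consuming it; the other servers consume it on their first copy. Further copies are ignored. **Writer $w$, write$(v)$.** Send QUERY-TAG to $\mathcal L_1$; await $f_1+k$ responses; let $t$ be the largest tag received and $t_w=(t.z+1,w)$. Send (PUT-DATA, $(t_w,v)$) to $\mathcal L_1$; terminate after ACKs for $t_w$ from $f_1+k$ servers. **Reader $r$, read.** (1) Send QUERY-COMM-TAG to $\mathcal L_1$; let $t_{req}$ be the largest of the first $f_1+k$ tags received.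 (2) Send (QUERY-DATA, $t_{req}$) to $\mathcal L_1$; wait until at least $f_1+k$ servers have responded and the responses contain a (tag, value) pair, or (tag, coded-element) pairs with a common tag from at least $k$ servers (decoded with $\mathcal C$ into a (tag, value) pair); select the available pair $(t_r,v_r)$ of highest tag. (3) Send (PUT-TAG, $t_r$) to $\mathcal L_1$; after ACKs from $f_1+k$ servers return $v_r$. **Server $s_j\in\mathcal L_1$.** State: a list $L$ of pairs $(t,x)$, $x\in\mathcal V\cup\{\bot\}$, initially $\{(t_0,\bot)\}$; a set $\Gamma$ of outstanding (read, requested tag) pairs, initially empty; a committed tag $t_c$, initially $t_0$; counters $commitCounter[t]$, $writeCounter[t]$ for each tag and $readCounter[\rho]$ for each read $\rho$, initially $0$; for each read $\rho$ a set $K[\rho]$ of helper data, initially empty. Below, $(t,v)\in L$ means that the entry has a value $v\ne\bot$, $(t,*)$ is an arbitrary entry; "serve $(t,v)$" means: for each $(\rho,t_{req})\in\Gamma$ with $t_{req}\le t$, send $(t,v)$ to the reader of $\rho$ and remove $(\rho,t_{req})$ from $\Gamma$; "collect" means: replace each $(t,*)\in L$ with $t<t_c$ by $(t,\bot)$; "write-to-L2$(t,v)$"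 means: send (WRITE-CODE-ELEM, $t$, $c_{n_1+i}(v)$) to $s_{n_1+i}$ for $1\le i\le n_2$. - QUERY-TAG: answer $\max\{t:(t,*)\in L\}$. QUERY-COMM-TAG: answer $t_c$. - (PUT-DATA, $(t,v)$): broadcast (COMMIT-TAG, $t$); then, if $t>t_c$, add $(t,v)$ to $L$, else send ACK for $t$ to its writer. - (COMMIT-TAG, $t$) consumed: increment $commitCounter[t]$. If $(t,*)\in L$ and $commitCounter[t]\ge f_1+k$: send ACK for $t$ to its writer; if moreover $t>t_c$, set $t_c:=t$, serve $(t,v)$ where $(t,v)\in L$, collect, and write-to-L2$(t,v)$. - (ACK-CODE-ELEM, $t$): increment $writeCounter[t]$; if it equals $n_2-f_2$, replace $(t,*)$ in $L$ by $(t,\bot)$. - (QUERY-DATA, $t_{req}$) of read $\rho$: if $(t_{req},v)\in L$, send this pair to the reader; else if $t_c>t_{req}$ and $(t_c,v_c)\in L$, send $(t_c,v_c)$; else add $(\rho,t_{req})$ to $\Gamma$ and send (QUERY-CODE-ELEM, $\rho$) to all of $\mathcal L_2$. - (SEND-HELPER-ELEM, $\rho,t,h$) from $s_{n_1+i}$: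 increment $readCounter[\rho]$ and add $(i,t,h)$ to $K[\rho]$. If $readCounter[\rho]=n_2-f_2$: let $\hat t$ be the highest tag for which $K[\rho]$ has helper data from at least $d$ servers, if any, and $\hat c_j$ the coded element repaired from them; clear $K[\rho]$; if $\rho$ still has an entry $(\rho,t_{req})\in\Gamma$, send $(\hat t,\hat c_j)$ to the reader if $\hat t$ exists and $\hat t\ge t_{req}$, and $(\bot,\bot)$ otherwise. - (PUT-TAG, $t$) of read $\rho$: remove the entry of $\rho$ from $\Gamma$. If $t>t_c$: set $t_c:=t$; if $(t,v)\in L$, serve $(t,v)$ and write-to-L2$(t,v)$; else add $(t,\bot)$ to $L$ and serve $(\bar t,\bar v)$, the pair of $L$ with a value $\bar v\neq\bot$ and the largest $\bar t<t$, if one exists; then collect. In all cases send ACK to the reader. **Server $s_{n_1+i}\in\mathcal L_2$.** State: one pair $(t,c)$, initially $(t_0,c_{n_1+i}(v_0))$. (WRITE-CODE-ELEM, $t',c'$) from $s_j$: if $t'>t$, set $(t,c):=(t',c')$; send (ACK-CODE-ELEM, $t'$) to $s_j$. (QUERY-CODE-ELEM, $\rho$) from $s_j$: send (SEND-HELPER-ELEM,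 $\rho,t,h_{n_1+i,j}$) to $s_j$, where the helper data are computed from $c$. -/

import Mathlib

/-! # The layered data storage (LDS) algorithm as an asynchronous message-passing system -/

namespace LDS

/-! ## Tags and codes -/

/-- A tag `(z, w)`: an integer and a writer id, ordered lexicographically. -/
abbrev Tag (W : Type*) := ℕ ×ₗ W

/-- The file size `B = ∑_{i < k} (d - i) β` of an MBR code. -/
def mbrFileSize (k d β : ℕ) : ℕ := ∑ i ∈ Finset.range k, (d - i) * β

/-- An exact-repair `{(n, k, d)(α, β)}` regenerating code over `F` at the MBR point (`α = d β`,
`B = mbrFileSize k d β`). A file is encoded into `n` symbols of `F ^ α`; the file can be decoded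
from any `k` of them. Helper `i` computes its `β` symbols for the repair of symbol `j` from its own
content and `j` alone (not from the identity of the other helpers), and any `d` helpers suffice to
repair symbol `j` exactly. -/
structure MBRCode (F : Type*) (n k d β : ℕ) where
  one_le_k : 1 ≤ k
  k_le_d : k ≤ d
  d_lt_n : d < n
  beta_pos : 0 < β
  encode : (Fin (mbrFileSize k d β) → F) → Fin n → (Fin (d * β) → F)
  decode : Finset (Fin n) → (Fin n → (Fin (d * β) → F)) → (Fin (mbrFileSize k d β) → F)
  helper : (i j : Fin n) → (Fin (d * β) → F) → (Fin β → F)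
  repair : (j : Fin n) → Finset (Fin n) → (Fin n → (Fin β → F)) → (Fin (d * β) → F)
  decode_encode : ∀ (v : Fin (mbrFileSize k d β) → F) (S : Finset (Fin n))
    (y : Fin n → (Fin (d * β) → F)), k ≤ S.card → (∀ i ∈ S, y i = encode v i) → decode S y = v
  repair_helper : ∀ (v : Fin (mbrFileSize k d β) → F) (j : Fin n) (S : Finset (Fin n))
    (h : Fin n → (Fin β → F)), d ≤ S.card → j ∉ S → (∀ i ∈ S, h i = helper i j (encode v i)) →
      repair j S h = encode v j

/-- The static data of the system: the numbers of servers of the two layers, the numbers of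
tolerated crashes, the code, the fixed set of `f₁ + 1` edge servers used by the broadcast primitive,
the initial object value, and a writer id that fixes the initial tag `t₀ = (0, w₀)`. -/
structure Params (F W : Type*) where
  n₁ : ℕ
  n₂ : ℕ
  f₁ : ℕ
  f₂ : ℕ
  k : ℕ
  d : ℕ
  β : ℕ
  n₁_eq : n₁ = 2 * f₁ + k
  n₂_eq : n₂ = 2 * f₂ + d
  code : MBRCode F (n₁ + n₂) k d β
  relays : Finset (Fin n₁)
  relays_card : relays.card = f₁ + 1
  v₀ : Fin (mbrFileSize k d β) → F
  w₀ : W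

namespace Params

variable {F W : Type*} (P : Params F W)

/-- Object values. -/
abbrev Val := Fin (mbrFileSize P.k P.d P.β) → F

/-- Coded elements, i.e. code symbols in `F ^ α`. -/
abbrev Coded := Fin (P.d * P.β) → F

/-- Helper data in `F ^ β`. -/
abbrev Helper := Fin P.β → F

/-- The initial tag. -/
def t₀ : Tag W := toLex (0, P.w₀)

/-- The position in the code of the symbol associated with an `L1` server. -/
def edgeIdx (s : Fin P.n₁) : Fin (P.n₁ + P.n₂) := Fin.castAdd P.n₂ s

/-- The position in the code of the symbol associated with an `L2` server. -/
def backIdx (i : Fin P.n₂) : Fin (P.n₁ + P.n₂) := Fin.natAdd P.n₁ i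

end Params

/-! ## Processes and messages -/

/-- Processes: writers, readers, servers of layer `L1` (`edge`) and of layer `L2` (`back`). -/
inductive Proc (n₁ n₂ : ℕ) (W R : Type*)
  | writer (w : W)
  | reader (r : R)
  | edge (s : Fin n₁)
  | back (i : Fin n₂)
deriving DecidableEq

/-- A read operation: the reader and the sequence number of the operation at this reader. -/
abbrev ReadOp (R : Type*) := R × ℕ

/-- What an `L1` server answers in the get-data phase: a (tag, value) pair, a regenerated
(tag, coded-element) pair, or `(⊥, ⊥)`. -/
inductive DataResp (T V C : Type*)
  | value (t : T) (v : V)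
  | coded (t : T) (c : C)
  | failed
deriving DecidableEq

/-- Messages, with their end points. The requests of the two query phases of an operation, and the
answers to them, carry the identity of the operation; write acknowledgments carry the tag. -/
inductive Msg (n₁ n₂ : ℕ) (W R T V C H : Type*)
  /-- QUERY-TAG, writer to `L1` -/
  | queryTag (w : W) (op : ℕ) (s : Fin n₁)
  | tagResp (s : Fin n₁) (w : W) (op : ℕ) (t : T)
  /-- PUT-DATA, writer to `L1` -/
  | putData (w : W) (s : Fin n₁) (t : T) (v : V)
  /-- ACK of the tag `t`, to its writer `w` -/
  | ackWrite (s : Fin n₁) (w : W) (t : T)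
  /-- QUERY-COMM-TAG, reader to `L1` -/
  | queryCommTag (o : R × ℕ) (s : Fin n₁)
  | commTagResp (s : Fin n₁) (o : R × ℕ) (t : T)
  /-- QUERY-DATA with the requested tag, reader to `L1` -/
  | queryData (o : R × ℕ) (s : Fin n₁) (treq : T)
  | dataResp (s : Fin n₁) (o : R × ℕ) (a : DataResp T V C)
  /-- PUT-TAG, reader to `L1` -/
  | putTag (o : R × ℕ) (s : Fin n₁) (t : T)
  | ackRead (s : Fin n₁) (o : R × ℕ)
  /-- COMMIT-TAG for `t`, broadcast initiated by `src`; this copy is addressed to `s` -/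
  | commitTag (src : Fin n₁) (t : T) (s : Fin n₁)
  /-- WRITE-CODE-ELEM, `L1` to `L2` -/
  | writeCodeElem (s : Fin n₁) (i : Fin n₂) (t : T) (c : C)
  | ackCodeElem (i : Fin n₂) (s : Fin n₁) (t : T)
  /-- QUERY-CODE-ELEM, `L1` to `L2` -/
  | queryCodeElem (s : Fin n₁) (i : Fin n₂) (o : R × ℕ)
  /-- SEND-HELPER-ELEM, `L2` to `L1` -/
  | helperElem (i : Fin n₂) (s : Fin n₁) (o : R × ℕ) (t : T) (h : H)
deriving DecidableEq

/-- The destination of a message. -/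
def Msg.dest {n₁ n₂ : ℕ} {W R T V C H : Type*} : Msg n₁ n₂ W R T V C H → Proc n₁ n₂ W R
  | .queryTag _ _ s => .edge s
  | .tagResp _ w _ _ => .writer w
  | .putData _ s _ _ => .edge s
  | .ackWrite _ w _ => .writer w
  | .queryCommTag _ s => .edge s
  | .commTagResp _ o _ => .reader o.1
  | .queryData _ s _ => .edge s
  | .dataResp _ o _ => .reader o.1
  | .putTag _ s _ => .edge s
  | .ackRead _ o => .reader o.1
  | .commitTag _ _ s => .edge s
  | .writeCodeElem _ i _ _ => .back i
  | .ackCodeElem _ s _ => .edge s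
  | .queryCodeElem _ i _ => .back i
  | .helperElem _ s _ _ _ => .edge s

section Algorithm

variable {F W R : Type*} [DecidableEq F] [LinearOrder W] [DecidableEq R]
variable (P : Params F W)

/-- The messages of the system with parameters `P` and set of readers `R`. -/
abbrev Message (R : Type*) :=
  Msg P.n₁ P.n₂ W R (Tag W) P.Val P.Coded P.Helper

/-- The processes of the system with parameters `P` and set of readers `R`. -/
abbrev Node (R : Type*) := Proc P.n₁ P.n₂ W R

/-- The effect of a local action on the acting process: its new state and the messages it sends.
All messages in `first` are sent before any message in `rest` and before the state changes;
this matters only if the process crashes in the middle of the action. -/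
structure Result (R : Type*) (σ : Type*) where
  state : σ
  first : Multiset (Message P R) := 0
  rest : Multiset (Message P R) := 0

/-- One message for each `L1` server. -/
def toEdge (f : Fin P.n₁ → Message P R) : Multiset (Message P R) :=
  (Finset.univ : Finset (Fin P.n₁)).val.map f

/-- One message for each `L2` server. -/
def toBack (f : Fin P.n₂ → Message P R) : Multiset (Message P R) :=
  (Finset.univ : Finset (Fin P.n₂)).val.map f

/-- The number of distinct `L1` servers from which an answer is recorded. -/
def numServers {n : ℕ} {A : Type*} (resp : List (Fin n × A)) : ℕ :=
  (resp.map Prod.fst).toFinset.card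

/-- The largest tag recorded (no tag that occurs in the system is below `t₀`). -/
def maxTag {n : ℕ} (resp : List (Fin n × Tag W)) : Tag W :=
  (resp.map Prod.snd).foldr max P.t₀

/-! ## Writers -/

/-- The phase of a writer: no operation so far, one of the two phases with the responses received
in it, or last operation completed. -/
inductive WriterPhase
  | idle
  | getTag (v : P.Val) (resp : List (Fin P.n₁ × Tag W))
  | putData (t : Tag W) (acks : Finset (Fin P.n₁))
  | returned

/-- A writer with the number of write operations that it has invoked. -/
structure WriterState where
  op : ℕ := 0
  phase : WriterPhase P := .idle

/-- The writer has no incomplete operation. -/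
def WriterPhase.Free : WriterPhase P → Prop
  | .idle => True
  | .returned => True
  | _ => False

/-- Invocation of `write(v)`; the get-tag phase starts. -/
def invokeWrite (w : W) (σ : WriterState P) (v : P.Val) : Result P R (WriterState P) where
  state := { op := σ.op + 1, phase := .getTag v [] }
  rest := toEdge P fun s => .queryTag w (σ.op + 1) s

/-- A response to QUERY-TAG arrives; after `f₁ + k` of them the put-data phase starts with the tag
`(t.z + 1, w)`, where `t` is the largest tag received. -/
def onTagResp (w : W) (σ : WriterState P) (s : Fin P.n₁) (op : ℕ) (t : Tag W) :
    Result P R (WriterState P) :=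
  match σ.phase with
  | .getTag v resp =>
    if op = σ.op then
      let resp' := (s, t) :: resp
      if P.f₁ + P.k ≤ numServers resp' then
        let tw : Tag W := toLex ((ofLex (maxTag P resp')).1 + 1, w)
        { state := { σ with phase := .putData tw ∅ }
          rest := toEdge P fun s' => .putData w s' tw v }
      else { state := { σ with phase := .getTag v resp' } }
    else { state := σ }
  | _ => { state := σ }

/-- An ACK for the tag `t` arrives; after `f₁ + k` of them the write terminates. -/
def onAckWrite (σ : WriterState P) (s : Fin P.n₁) (t : Tag W) : Result P R (WriterState P) :=
  match σ.phase with
  | .putData tw acks =>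
    if t = tw then
      if P.f₁ + P.k ≤ (insert s acks).card then { state := { σ with phase := .returned } }
      else { state := { σ with phase := .putData tw (insert s acks) } }
    else { state := σ }
  | _ => { state := σ }

/-! ## Readers -/

/-- The answers recorded in the get-data phase. -/
abbrev Answers := List (Fin P.n₁ × DataResp (Tag W) P.Val P.Coded)

/-- The phase of a reader: no operation so far, one of the three phases with the responses received
in it, or last operation completed, with the value returned by it. -/
inductive ReaderPhase
  | idle
  | getCommTag (resp : List (Fin P.n₁ × Tag W))
  | getData (treq : Tag W) (resp : Answers P)
  | putTag (t : Tag W) (v : P.Val) (acks : Finset (Fin P.n₁))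
  | returned (v : P.Val)

/-- A reader with the number of read operations that it has invoked. -/
structure ReaderState where
  op : ℕ := 0
  phase : ReaderPhase P := .idle

/-- The reader has no incomplete operation. -/
def ReaderPhase.Free : ReaderPhase P → Prop
  | .idle => True
  | .returned _ => True
  | _ => False

/-- The coded elements with tag `t` among the answers, with their senders. -/
def codedWith (resp : Answers P) (t : Tag W) : List (Fin P.n₁ × P.Coded) :=
  resp.filterMap fun a =>
    match a.2 with
    | .coded t' c => if t' = t then some (a.1, c) else none
    | _ => none

/-- Decoding with the code `C₁`, i.e. the first `n₁` symbols of the code. -/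
def decodeFrom [Zero F] (l : List (Fin P.n₁ × P.Coded)) : P.Val :=
  P.code.decode ((l.map Prod.fst).toFinset.image P.edgeIdx) fun i =>
    ((l.find? fun a => P.edgeIdx a.1 = i).map Prod.snd).getD 0

/-- The (tag, value) pairs available to the reader: those received, and those decoded from at least
`k` coded elements with a common tag. -/
def candidates [Zero F] (resp : Answers P) : List (Tag W × P.Val) :=
  (resp.filterMap fun a =>
    match a.2 with
    | .value t v => some (t, v)
    | _ => none) ++
  (resp.filterMap fun a =>
    match a.2 with
    | .coded t _ =>
      if P.k ≤ numServers (codedWith P resp t) then some (t, decodeFrom P (codedWith P resp t))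
      else none
    | _ => none)

/-- Invocation of `read`; the get-committed-tag phase starts. -/
def invokeRead (r : R) (σ : ReaderState P) : Result P R (ReaderState P) where
  state := { op := σ.op + 1, phase := .getCommTag [] }
  rest := toEdge P fun s => .queryCommTag (r, σ.op + 1) s

/-- A response to QUERY-COMM-TAG arrives; after `f₁ + k` of them the get-data phase starts with the
largest tag received as requested tag. -/
def onCommTagResp (r : R) (σ : ReaderState P) (s : Fin P.n₁) (op : ℕ) (t : Tag W) :
    Result P R (ReaderState P) :=
  match σ.phase with
  | .getCommTag resp =>
    if op = σ.op then
      let resp' := (s, t) :: resp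
      if P.f₁ + P.k ≤ numServers resp' then
        { state := { σ with phase := .getData (maxTag P resp') [] }
          rest := toEdge P fun s' => .queryData (r, op) s' (maxTag P resp') }
      else { state := { σ with phase := .getCommTag resp' } }
    else { state := σ }
  | _ => { state := σ }

/-- A response to QUERY-DATA arrives. Once `f₁ + k` servers have responded, and there is a
(tag, value) pair, or `k` servers sent coded elements with a common tag, the available pair with the
highest tag is selected and the put-tag phase starts. -/
def onDataResp [Zero F] (r : R) (σ : ReaderState P) (s : Fin P.n₁) (op : ℕ)
    (a : DataResp (Tag W) P.Val P.Coded) : Result P R (ReaderState P) :=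
  match σ.phase with
  | .getData treq resp =>
    if op = σ.op then
      let resp' := (s, a) :: resp
      if P.f₁ + P.k ≤ numServers resp' then
        match (candidates P resp').argmax Prod.fst with
        | some (t, v) =>
          { state := { σ with phase := .putTag t v ∅ }
            rest := toEdge P fun s' => .putTag (r, op) s' t }
        | none => { state := { σ with phase := .getData treq resp' } }
      else { state := { σ with phase := .getData treq resp' } }
    else { state := σ }
  | _ => { state := σ }

/-- An ACK in the put-tag phase arrives; after `f₁ + k` of them the read returns. -/
def onAckRead (σ : ReaderState P) (s : Fin P.n₁) (op : ℕ) : Result P R (ReaderState P) :=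
  match σ.phase with
  | .putTag t v acks =>
    if op = σ.op then
      if P.f₁ + P.k ≤ (insert s acks).card then { state := { σ with phase := .returned v } }
      else { state := { σ with phase := .putTag t v (insert s acks) } }
    else { state := σ }
  | _ => { state := σ }

/-! ## Servers of layer `L1` -/

/-- The list `L` of an `L1` server: `(t, *) ∈ L` iff `t ∈ tags`; the entry of such a tag is `(t, v)`
if `val t = some v`, and `(t, ⊥)` if `val t = none`. -/
structure TagList (T V : Type*) where
  tags : Finset T
  val : T → Option V

namespace TagList

variable {T V : Type*} [LinearOrder T]

/-- `L ∪ {(t, v)}` -/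
def insertVal (L : TagList T V) (t : T) (v : V) : TagList T V where
  tags := insert t L.tags
  val := Function.update L.val t (some v)

/-- `L \ {(t, *)} ∪ {(t, ⊥)}` -/
def insertBot (L : TagList T V) (t : T) : TagList T V where
  tags := insert t L.tags
  val := Function.update L.val t none

/-- Replace each `(t', *)` with `t' < t` by `(t', ⊥)`. -/
def collect (L : TagList T V) (t : T) : TagList T V where
  tags := L.tags
  val := fun t' => if t' < t then none else L.val t'

/-- The pair `(t', v') ∈ L` with `v' ≠ ⊥` and the largest `t' < t`, if there is one. -/
def lastBelow (L : TagList T V) (t : T) : Option (T × V) :=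
  let A := L.tags.filter fun t' => t' < t ∧ (L.val t').isSome
  if h : A.Nonempty then (L.val (A.max' h)).map fun v => (A.max' h, v) else none

end TagList

/-- The state of an `L1` server. `gamma` is the set `Γ` of outstanding reads with their requested
tags; `helpers` is the key-value set `K`. The variables that belong to a read are indexed by the
read operation. `seen` is the set of broadcasts, given by their initiator and tag, of which a copy
has been received. -/
structure EdgeState (R : Type*) where
  L : TagList (Tag W) P.Val
  gamma : Finset (ReadOp R × Tag W)
  tc : Tag W
  commitCounter : Tag W → ℕ
  readCounter : ReadOp R → ℕ
  writeCounter : Tag W → ℕ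
  helpers : ReadOp R → List (Fin P.n₂ × Tag W × P.Helper)
  seen : Finset (Fin P.n₁ × Tag W)

/-- The initial state of an `L1` server. -/
def EdgeState.init : EdgeState P R where
  L := { tags := {P.t₀}, val := fun _ => none }
  gamma := ∅
  tc := P.t₀
  commitCounter := fun _ => 0
  readCounter := fun _ => 0
  writeCounter := fun _ => 0
  helpers := fun _ => []
  seen := ∅

/-- get-tag-resp: the largest tag in the list. -/
def onQueryTag (s : Fin P.n₁) (σ : EdgeState P R) (w : W) (op : ℕ) :
    Result P R (EdgeState P R) where
  state := σ
  rest := {.tagResp s w op (σ.L.tags.max.unbotD P.t₀)}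

/-- put-data-resp. The broadcast of COMMIT-TAG is initiated by sending it to the relays. -/
def onPutData (s : Fin P.n₁) (σ : EdgeState P R) (w : W) (t : Tag W) (v : P.Val) :
    Result P R (EdgeState P R) :=
  let bc : Multiset (Message P R) := P.relays.val.map fun s' => .commitTag s t s'
  if σ.tc < t then { state := { σ with L := σ.L.insertVal t v }, first := bc }
  else { state := σ, first := bc, rest := {.ackWrite s w t} }

/-- The messages of write-to-L2`(t, v)`. -/
def writeToL2 (s : Fin P.n₁) (t : Tag W) (v : P.Val) : Multiset (Message P R) :=
  toBack P fun i => .writeCodeElem s i t (P.code.encode v (P.backIdx i))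

/-- Outstanding reads whose requested tag is at most `t` are removed from `Γ`. -/
def unregister (σ : EdgeState P R) (t : Tag W) : EdgeState P R :=
  { σ with gamma := σ.gamma.filter fun γ => ¬ γ.2 ≤ t }

/-- The messages that serve `(t, v)` to the outstanding reads whose requested tag is at most `t`. -/
def serve (s : Fin P.n₁) (σ : EdgeState P R) (t : Tag W) (v : P.Val) : Multiset (Message P R) :=
  (σ.gamma.filter fun γ => γ.2 ≤ t).val.map fun γ => .dataResp s γ.1 (.value t v)

/-- broadcast-resp: a COMMIT-TAG message for the tag `t` is consumed. -/
def broadcastResp (s : Fin P.n₁) (σ : EdgeState P R) (t : Tag W) :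
    EdgeState P R × Multiset (Message P R) :=
  let σ₁ : EdgeState P R :=
    { σ with commitCounter := Function.update σ.commitCounter t (σ.commitCounter t + 1) }
  let ack : Multiset (Message P R) := {.ackWrite s (ofLex t).2 t}
  if t ∈ σ₁.L.tags ∧ P.f₁ + P.k ≤ σ₁.commitCounter t then
    if σ₁.tc < t then
      match σ₁.L.val t with
      | some v =>
        ({ unregister P σ₁ t with tc := t, L := σ₁.L.collect t },
          ack + serve P s σ₁ t v + writeToL2 P s t v)
      -- A tag of the list above the committed tag always has its value, so this case is void.
      | none => ({ σ₁ with tc := t, L := σ₁.L.collect t }, ack)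
    else (σ₁, ack)
  else (σ₁, 0)

/-- A copy of a broadcast COMMIT-TAG message arrives. At the first copy, a relay sends the message
to all `L1` servers, the relays first, and then each server consumes the message. Further
copies are ignored. -/
def onCommitTag (s : Fin P.n₁) (σ : EdgeState P R) (src : Fin P.n₁) (t : Tag W) :
    Result P R (EdgeState P R) :=
  if (src, t) ∈ σ.seen then { state := σ }
  else
    let res := broadcastResp P s { σ with seen := insert (src, t) σ.seen } t
    if s ∈ P.relays then
      { state := res.1
        first := P.relays.val.map fun s' => .commitTag src t s'
        rest := (P.relaysᶜ.val.map fun s' => .commitTag src t s') + res.2 }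
    else { state := res.1, rest := res.2 }

/-- write-to-L2-complete. -/
def onAckCodeElem (σ : EdgeState P R) (t : Tag W) : Result P R (EdgeState P R) :=
  let σ₁ : EdgeState P R :=
    { σ with writeCounter := Function.update σ.writeCounter t (σ.writeCounter t + 1) }
  if σ₁.writeCounter t = P.n₂ - P.f₂ then { state := { σ₁ with L := σ₁.L.insertBot t } }
  else { state := σ₁ }

/-- get-committed-tag-resp. -/
def onQueryCommTag (s : Fin P.n₁) (σ : EdgeState P R) (o : ReadOp R) :
    Result P R (EdgeState P R) where
  state := σ
  rest := {.commTagResp s o σ.tc}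

/-- get-data-resp. In the last case regenerate-from-L2 is initiated. -/
def onQueryData (s : Fin P.n₁) (σ : EdgeState P R) (o : ReadOp R) (treq : Tag W) :
    Result P R (EdgeState P R) :=
  let regenerate : Result P R (EdgeState P R) :=
    { state := { σ with gamma := insert (o, treq) σ.gamma }
      rest := toBack P fun i => .queryCodeElem s i o }
  match σ.L.val treq with
  | some v => { state := σ, rest := {.dataResp s o (.value treq v)} }
  | none =>
    if treq < σ.tc then
      match σ.L.val σ.tc with
      | some v => { state := σ, rest := {.dataResp s o (.value σ.tc v)} }
      | none => regenerate
    else regenerate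

/-- The helper data with tag `t`. -/
def helpersWith (K : List (Fin P.n₂ × Tag W × P.Helper)) (t : Tag W) :
    List (Fin P.n₂ × P.Helper) :=
  K.filterMap fun a => if a.2.1 = t then some (a.1, a.2.2) else none

/-- Regenerate the highest possible tag, i.e. the highest one for which helper data from at least
`d` servers is present, and the coded element of the server `s` for it. -/
def regenerateFrom [Zero F] (s : Fin P.n₁) (K : List (Fin P.n₂ × Tag W × P.Helper)) :
    Option (Tag W × P.Coded) :=
  (((K.map fun a => a.2.1).filter fun t => P.d ≤ numServers (helpersWith P K t)).argmax id).map
    fun t =>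
      (t, P.code.repair (P.edgeIdx s)
        (((helpersWith P K t).map Prod.fst).toFinset.image P.backIdx) fun i =>
          (((helpersWith P K t).find? fun a => P.backIdx a.1 = i).map Prod.snd).getD 0)

/-- regenerate-from-L2-complete. When `n₂ - f₂` responses have arrived, the server answers the
reader, unless the read has been served and unregistered in the meantime. -/
def onHelperElem [Zero F] (s : Fin P.n₁) (σ : EdgeState P R) (i : Fin P.n₂) (o : ReadOp R)
    (t : Tag W) (h : P.Helper) : Result P R (EdgeState P R) :=
  let K := (i, t, h) :: σ.helpers o
  let σ₁ : EdgeState P R :=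
    { σ with
      readCounter := Function.update σ.readCounter o (σ.readCounter o + 1)
      helpers := Function.update σ.helpers o K }
  if σ₁.readCounter o = P.n₂ - P.f₂ then
    let σ₂ : EdgeState P R := { σ₁ with helpers := Function.update σ₁.helpers o [] }
    if ∃ γ ∈ σ.gamma, γ.1 = o then
      match regenerateFrom P s K with
      | some (t', c) =>
        if ∀ γ ∈ σ.gamma, γ.1 = o → γ.2 ≤ t' then
          { state := σ₂, rest := {.dataResp s o (.coded t' c)} }
        else { state := σ₂, rest := {.dataResp s o .failed} }
      | none => { state := σ₂, rest := {.dataResp s o .failed} }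
    else { state := σ₂ }
  else { state := σ₁ }

/-- put-tag-resp. -/
def onPutTag (s : Fin P.n₁) (σ : EdgeState P R) (o : ReadOp R) (t : Tag W) :
    Result P R (EdgeState P R) :=
  let σ₁ : EdgeState P R := { σ with gamma := σ.gamma.filter fun γ => γ.1 ≠ o }
  let ack : Multiset (Message P R) := {.ackRead s o}
  if σ₁.tc < t then
    match σ₁.L.val t with
    | some v =>
      { state := { unregister P σ₁ t with tc := t, L := σ₁.L.collect t }
        rest := serve P s σ₁ t v + writeToL2 P s t v + ack }
    | none =>
      let L' := (σ₁.L.insertBot t).collect t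
      match (σ₁.L.insertBot t).lastBelow t with
      | some (t', v') =>
        { state := { unregister P σ₁ t' with tc := t, L := L' }
          rest := serve P s σ₁ t' v' + ack }
      | none => { state := { σ₁ with tc := t, L := L' }, rest := ack }
  else { state := σ₁, rest := ack }

/-! ## Servers of layer `L2` -/

/-- The state of an `L2` server: one (tag, coded-element) pair. -/
structure BackState where
  tag : Tag W
  elem : P.Coded

/-- The initial state of an `L2` server. -/
def BackState.init (i : Fin P.n₂) : BackState P where
  tag := P.t₀
  elem := P.code.encode P.v₀ (P.backIdx i)

/-- write-to-L2-resp. -/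
def onWriteCodeElem (i : Fin P.n₂) (σ : BackState P) (s : Fin P.n₁) (t : Tag W) (c : P.Coded) :
    Result P R (BackState P) where
  state := if σ.tag < t then { tag := t, elem := c } else σ
  rest := {.ackCodeElem i s t}

/-- regenerate-from-L2-resp. -/
def onQueryCodeElem (i : Fin P.n₂) (σ : BackState P) (s : Fin P.n₁) (o : ReadOp R) :
    Result P R (BackState P) where
  state := σ
  rest := {.helperElem i s o σ.tag (P.code.helper (P.backIdx i) (P.edgeIdx s) σ.elem)}

/-! ## The global system -/

/-- A global state: the local states, the messages in the channels, and the processes that have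
crashed. -/
structure Config (R : Type*) where
  writers : W → WriterState P
  readers : R → ReaderState P
  edges : Fin P.n₁ → EdgeState P R
  backs : Fin P.n₂ → BackState P
  net : Multiset (Message P R)
  crashed : Finset (Node P R)

/-- The initial global state. -/
def Config.init : Config P R where
  writers := fun _ => {}
  readers := fun _ => {}
  edges := fun _ => EdgeState.init P
  backs := BackState.init P
  net := 0
  crashed := ∅

/-- What triggers a local action: the invocation of an operation, or the receipt of a message. -/
inductive Event (R : Type*)
  | invokeWrite (w : W) (v : P.Val)
  | invokeRead (r : R)
  | receive (m : Message P R)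

/-- The process at which the event occurs. -/
def Event.proc : Event P R → Node P R
  | .invokeWrite w _ => .writer w
  | .invokeRead r => .reader r
  | .receive m => m.dest

/-- An invocation can occur at any time, a message can be received if it is in its channel. -/
def Event.Enabled (c : Config P R) : Event P R → Prop
  | .receive m => m ∈ c.net
  | _ => True

/-- The channels after the event, before anything is sent. -/
def Event.channels (c : Config P R) : Event P R → Multiset (Message P R)
  | .receive m => c.net.erase m
  | _ => c.net

/-- Put the new local state of the writer `w` into the global state. -/
def Config.setWriter (c : Config P R) (w : W) (res : Result P R (WriterState P)) :
    Result P R (Config P R) :=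
  ⟨{ c with writers := Function.update c.writers w res.state }, res.first, res.rest⟩

/-- Put the new local state of the reader `r` into the global state. -/
def Config.setReader (c : Config P R) (r : R) (res : Result P R (ReaderState P)) :
    Result P R (Config P R) :=
  ⟨{ c with readers := Function.update c.readers r res.state }, res.first, res.rest⟩

/-- Put the new local state of the `L1` server `s` into the global state. -/
def Config.setEdge (c : Config P R) (s : Fin P.n₁) (res : Result P R (EdgeState P R)) :
    Result P R (Config P R) :=
  ⟨{ c with edges := Function.update c.edges s res.state }, res.first, res.rest⟩

/-- Put the new local state of the `L2` server `i` into the global state. -/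
def Config.setBack (c : Config P R) (i : Fin P.n₂) (res : Result P R (BackState P)) :
    Result P R (Config P R) :=
  ⟨{ c with backs := Function.update c.backs i res.state }, res.first, res.rest⟩

/-- The local action that the event triggers: new local states, and the messages to be sent. -/
def perform [Zero F] (c : Config P R) : Event P R → Result P R (Config P R)
  | .invokeWrite w v => c.setWriter P w (invokeWrite P w (c.writers w) v)
  | .invokeRead r => c.setReader P r (invokeRead P r (c.readers r))
  | .receive m =>
    match m with
    | .queryTag w op s => c.setEdge P s (onQueryTag P s (c.edges s) w op)
    | .tagResp s w op t => c.setWriter P w (onTagResp P w (c.writers w) s op t)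
    | .putData w s t v => c.setEdge P s (onPutData P s (c.edges s) w t v)
    | .ackWrite s w t => c.setWriter P w (onAckWrite P (c.writers w) s t)
    | .queryCommTag o s => c.setEdge P s (onQueryCommTag P s (c.edges s) o)
    | .commTagResp s o t => c.setReader P o.1 (onCommTagResp P o.1 (c.readers o.1) s o.2 t)
    | .queryData o s treq => c.setEdge P s (onQueryData P s (c.edges s) o treq)
    | .dataResp s o a => c.setReader P o.1 (onDataResp P o.1 (c.readers o.1) s o.2 a)
    | .putTag o s t => c.setEdge P s (onPutTag P s (c.edges s) o t)
    | .ackRead s o => c.setReader P o.1 (onAckRead P (c.readers o.1) s o.2)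
    | .commitTag src t s => c.setEdge P s (onCommitTag P s (c.edges s) src t)
    | .writeCodeElem s i t e => c.setBack P i (onWriteCodeElem P i (c.backs i) s t e)
    | .ackCodeElem _ s t => c.setEdge P s (onAckCodeElem P (c.edges s) t)
    | .queryCodeElem s i o => c.setBack P i (onQueryCodeElem P i (c.backs i) s o)
    | .helperElem i s o t h => c.setEdge P s (onHelperElem P s (c.edges s) i o t h)

/-- Actions of the system: a local action carried out completely, a local action in the middle of
which the process crashes, a crash between two local actions, or nothing at all (so
that finite executions are executions that are idle from some point on). -/
inductive Action (R : Type*)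
  | run (e : Event P R)
  | runCrash (e : Event P R)
  | crash (p : Node P R)
  | skip

/-- The transition relation. A process that crashes in the middle of a local action has sent only
an arbitrary part of the messages that it was sending at that point. -/
def Step [Zero F] (c : Config P R) : Action P R → Config P R → Prop
  | .run e, c' =>
    e.proc P ∉ c.crashed ∧ e.Enabled P c ∧
      c' = { (perform P c e).state with
        net := e.channels P c + (perform P c e).first + (perform P c e).rest }
  | .runCrash e, c' =>
    e.proc P ∉ c.crashed ∧ e.Enabled P c ∧
      ((∃ sent ≤ (perform P c e).first,
        c' = { c with
          net := e.channels P c + sent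
          crashed := insert (e.proc P) c.crashed }) ∨
      (∃ sent ≤ (perform P c e).rest,
        c' = { (perform P c e).state with
          net := e.channels P c + (perform P c e).first + sent
          crashed := insert (e.proc P) c.crashed }))
  | .crash p, c' => c' = { c with crashed := insert p c.crashed }
  | .skip, c' => c' = c

/-- Executions: alternating sequences of global states and actions. -/
structure Execution (R : Type*) [DecidableEq R] [Zero F] where
  conf : ℕ → Config P R
  act : ℕ → Action P R
  conf_zero : conf 0 = Config.init P
  step : ∀ n, Step P (conf n) (act n) (conf (n + 1))

variable {P} [Zero F]

namespace Execution

/-- The process crashes at some point of the execution. -/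
def Faulty (E : Execution P R) (p : Node P R) : Prop := ∃ n, p ∈ (E.conf n).crashed

/-- Reliable channels: every message whose destination is non-faulty is eventually received. -/
def Reliable (E : Execution P R) : Prop :=
  ∀ n, ∀ m ∈ (E.conf n).net, ¬ E.Faulty m.dest → ∃ n' ≥ n, E.act n' = .run (.receive m)

/-- A client invokes an operation only after the completion of its previous one, if any. -/
def WellFormed (E : Execution P R) : Prop :=
  (∀ n w v, E.act n = .run (.invokeWrite w v) ∨ E.act n = .runCrash (.invokeWrite w v) →
    ((E.conf n).writers w).phase.Free) ∧
  (∀ n r, E.act n = .run (.invokeRead r) ∨ E.act n = .runCrash (.invokeRead r) →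
    ((E.conf n).readers r).phase.Free)

/-- The write operation that is invoked by `w` in step `n` completes. -/
def WriteCompletes (E : Execution P R) (w : W) (n : ℕ) : Prop :=
  ∃ m > n, ((E.conf m).writers w).op = ((E.conf (n + 1)).writers w).op ∧
    ((E.conf m).writers w).phase = .returned

/-- The read operation that is invoked by `r` in step `n` completes and returns a value. -/
def ReadCompletes (E : Execution P R) (r : R) (n : ℕ) : Prop :=
  ∃ m > n, ((E.conf m).readers r).op = ((E.conf (n + 1)).readers r).op ∧
    ∃ v, ((E.conf m).readers r).phase = .returned v

end Execution

end Algorithm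

end LDS

set_option linter.unusedSectionVars false
set_option linter.unusedTactic false
set_option linter.unreachableTactic false

namespace LDS

/-! Every phase waits for `f₁ + k = n₁ - f₁` servers, exactly the number that is sure to survive in
`L1`. A phase that only counts answers therefore ends once all non-faulty servers have answered: a
pending phase always has fewer than `f₁ + k` servers on record (`card_writer_servers_lt`,
`reader_waiting`), whereas the record of a phase that never ended would grow to a quorum
(`exists_quorum`). This settles get-tag, get-committed-tag and put-tag. Two phases need more.

Put-data. A server whose committed tag is below the tag `t` of the write acknowledges `t` only when
it consumes a COMMIT-TAG with `t` in its list and the counter at `f₁ + k`. Two facts make this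
happen. First, the broadcast is reliable: a consumed copy, or a copy sent to a server that is not a
relay, presupposes copies sent to all `f₁ + 1` relays, one of which is non-faulty and forwards to
everybody (`forwarded_aux`, `Forwarded.exists_seen`). Second, the broadcast of the server itself
starts when it enters `t` into its list, so the last of the awaited broadcasts is consumed
afterwards (`exists_commit`). The second fact fails if the server has broadcast `t` before, so tags
must be fresh (`not_put`): each earlier tag of the same writer, or a larger one, is in the lists of
a quorum, which meets the quorum that answers the next QUERY-TAG (`used_of_put`).

Get-data. Suppose that the reader waits forever (`Stuck`). All non-faulty servers answer, so a
single value would end the phase; hence no value is ever sent, and each non-faulty server `s`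
registers the read at a time `T s`, keeps it registered, and completes its helper data at a time `C
s`. Let `t` be the largest committed tag in `L1` when all these data are complete. Up to then, all
tags in `L2` and in messages of reads are at most `t` (`tagsIn`).

If `t` is the initial tag, all helper data carry it. Otherwise the first server that committed `t`
did so by counting broadcasts, since no PUT-TAG could carry `t` yet (`exists_first_commit`). Of the
`f₁ + k` initiators at least `k` are non-faulty, and each of these once held the value of `t`
(`exists_put`). If the committed tag of such a server `s` is below `t` at time `T s`, it must pass
`t` while the read is registered, and then the read is served with a value (`tc_lt`), which was
excluded. If it equals `t`, the value has already disappeared, so the write of `t` to `L2` is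
complete and `n₂ - f₂` servers of `L2` have tags at least `t` (`le_card_tag`). They meet the `n₂ -
f₂` helpers in at least `n₂ - 2 f₂ = d` servers, whose tags are exactly `t`, so `s` regenerates its
coded element for `t` (`exists_regenerateFrom_eq`). In either case `k` coded elements with tag `t`
reach the reader, which is a contradiction (`Stuck.false`).

The counting of distinct senders rests on two invariants: each `L2` server acknowledges a tag to a
given server at most once (`WriteQuorum`) and contributes at most once to the helper data of a read
(`ReadOnce`). -/

theorem TagList.lastBelow_eq_some {T V : Type*} [LinearOrder T] {L : TagList T V} {t t' : T} {v : V}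
    (h : L.lastBelow t = some (t', v)) : t' < t ∧ t' ∈ L.tags ∧ L.val t' = some v := by
  unfold TagList.lastBelow at h
  simp only at h
  split at h
  · rename_i hA
    obtain ⟨v', hv, h⟩ := Option.map_eq_some_iff.1 h
    cases h
    have := Finset.max'_mem _ hA
    simp only [Finset.mem_filter] at this
    exact ⟨this.2.1, this.1, hv⟩
  · cases h

/-- Needed when a PUT-TAG commits a tag whose value is missing: the value served instead is at least
as recent as any valued entry below that tag, hence recent enough for a read that requested no more
than `t₁`. -/
theorem TagList.exists_lastBelow {T V : Type*} [LinearOrder T] {L : TagList T V} {t t₁ : T}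
    (h₁ : t₁ ∈ L.tags) (h₂ : t₁ < t) (h₃ : (L.val t₁).isSome) :
    ∃ t' v, L.lastBelow t = some (t', v) ∧ t₁ ≤ t' := by
  have h₄ : t₁ ∈ L.tags.filter fun t' => t' < t ∧ (L.val t').isSome := by simp [*]
  have hA : (L.tags.filter fun t' => t' < t ∧ (L.val t').isSome).Nonempty := ⟨t₁, h₄⟩
  have := Finset.max'_mem _ hA
  simp only [Finset.mem_filter] at this
  obtain ⟨v, hv⟩ := Option.isSome_iff_exists.1 this.2.2
  refine ⟨_, v, ?_, Finset.le_max' _ _ h₄⟩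
  unfold TagList.lastBelow
  simp only
  rw [dif_pos hA, hv]
  rfl

section Liveness

variable {F W R : Type*} [DecidableEq F] [LinearOrder W] [DecidableEq R] [Zero F]
variable {P : Params F W}

/-! ## Local actions and global transitions -/

/-- What can become of a local action with intended result `res` that is started in the local
state `σ`: the new local state is `σ'` and the messages `sent` are sent. -/
def Outcome {α : Type*} (σ : α) (res : Result P R α) (σ' : α) (sent : Multiset (Message P R)) :
    Prop :=
  (σ' = σ ∧ sent ≤ res.first) ∨ (σ' = res.state ∧ ∃ u ≤ res.rest, sent = res.first + u)

theorem Outcome.sent_le {α : Type*} {σ σ' : α} {res : Result P R α}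
    {sent : Multiset (Message P R)} (h : Outcome σ res σ' sent) :
    sent ≤ res.first + res.rest := by
  rcases h with ⟨-, h⟩ | ⟨-, u, hu, rfl⟩
  · exact h.trans (Multiset.le_add_right _ _)
  · exact add_le_add_right hu _

theorem Outcome.state_eq {α : Type*} {σ σ' : α} {res : Result P R α}
    {sent : Multiset (Message P R)} (h : Outcome σ res σ' sent) : σ' = σ ∨ σ' = res.state :=
  h.imp And.left And.left

theorem Outcome.mem_sent {α : Type*} {σ σ' : α} {res : Result P R α}
    {sent : Multiset (Message P R)} (h : Outcome σ res σ' sent) {m : Message P R} (hm : m ∈ sent) :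
    m ∈ res.first ∨ (m ∈ res.rest ∧ σ' = res.state) := by
  rcases h with ⟨-, h⟩ | ⟨h, u, hu, rfl⟩
  · exact .inl (Multiset.mem_of_le h hm)
  · rcases Multiset.mem_add.1 hm with hm | hm
    · exact .inl hm
    · exact .inr ⟨Multiset.mem_of_le hu hm, h⟩

/-- The reaction of the server `s` of layer `L1` to a message. -/
def edgeReact (s : Fin P.n₁) (σ : EdgeState P R) (m : Message P R) : Result P R (EdgeState P R) :=
  match m with
  | .queryTag w op _ => onQueryTag P s σ w op
  | .putData w _ t v => onPutData P s σ w t v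
  | .queryCommTag o _ => onQueryCommTag P s σ o
  | .queryData o _ treq => onQueryData P s σ o treq
  | .putTag o _ t => onPutTag P s σ o t
  | .commitTag src t _ => onCommitTag P s σ src t
  | .ackCodeElem _ _ t => onAckCodeElem P σ t
  | .helperElem i _ o t h => onHelperElem P s σ i o t h
  | _ => { state := σ }

/-- The reaction of the server `i` of layer `L2` to a message. -/
def backReact (i : Fin P.n₂) (σ : BackState P) (m : Message P R) : Result P R (BackState P) :=
  match m with
  | .writeCodeElem s _ t e => onWriteCodeElem P i σ s t e
  | .queryCodeElem s _ o => onQueryCodeElem P i σ s o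
  | _ => { state := σ }

/-- The reaction of the writer `w` to an event. -/
def writerReact (w : W) (σ : WriterState P) (e : Event P R) : Result P R (WriterState P) :=
  match e with
  | .invokeWrite _ v => invokeWrite P w σ v
  | .receive (.tagResp s _ op t) => onTagResp P w σ s op t
  | .receive (.ackWrite s _ t) => onAckWrite P σ s t
  | _ => { state := σ }

/-- The reaction of the reader `r` to an event. -/
def readerReact (r : R) (σ : ReaderState P) (e : Event P R) : Result P R (ReaderState P) :=
  match e with
  | .invokeRead _ => invokeRead P r σ
  | .receive (.commTagResp s o t) => onCommTagResp P r σ s o.2 t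
  | .receive (.dataResp s o a) => onDataResp P r σ s o.2 a
  | .receive (.ackRead s o) => onAckRead P σ s o.2
  | _ => { state := σ }

theorem perform_edge (c : Config P R) {e : Event P R} {s : Fin P.n₁} (h : e.proc P = .edge s) :
    ∃ m : Message P R, e = .receive m ∧ m.dest = .edge s ∧
      perform P c e = c.setEdge P s (edgeReact s (c.edges s) m) := by
  rcases e with _ | _ | m
  · cases h
  · cases h
  · refine ⟨m, rfl, h, ?_⟩
    cases m <;> cases h <;> rfl

theorem perform_back (c : Config P R) {e : Event P R} {i : Fin P.n₂} (h : e.proc P = .back i) :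
    ∃ m : Message P R, e = .receive m ∧ m.dest = .back i ∧
      perform P c e = c.setBack P i (backReact i (c.backs i) m) := by
  rcases e with _ | _ | m
  · cases h
  · cases h
  · refine ⟨m, rfl, h, ?_⟩
    cases m <;> cases h <;> rfl

theorem perform_writer (c : Config P R) {e : Event P R} {w : W} (h : e.proc P = .writer w) :
    perform P c e = c.setWriter P w (writerReact w (c.writers w) e) := by
  rcases e with _ | _ | m
  · cases h; rfl
  · cases h
  · cases m <;> cases h <;> rfl

theorem perform_reader (c : Config P R) {e : Event P R} {r : R} (h : e.proc P = .reader r) :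
    perform P c e = c.setReader P r (readerReact r (c.readers r) e) := by
  rcases e with _ | _ | m
  · cases h
  · cases h; rfl
  · cases m <;> cases h <;> rfl

/-- The possible transitions between global states, according to the acting process. -/
inductive Transition (c : Config P R) (a : Action P R) : Config P R → Prop
  | idle (x : Finset (Node P R)) : Transition c a { c with crashed := x }
  | edge (s : Fin P.n₁) (m : Message P R) (σ' : EdgeState P R) (sent : Multiset (Message P R))
      (x : Finset (Node P R)) (ha : a = .run (.receive m) ∨ a = .runCrash (.receive m))
      (hm : m ∈ c.net) (hd : m.dest = .edge s)
      (h : Outcome (c.edges s) (edgeReact s (c.edges s) m) σ' sent) :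
      Transition c a { c with
        edges := Function.update c.edges s σ', net := c.net.erase m + sent, crashed := x }
  | back (i : Fin P.n₂) (m : Message P R) (σ' : BackState P) (sent : Multiset (Message P R))
      (x : Finset (Node P R)) (ha : a = .run (.receive m) ∨ a = .runCrash (.receive m))
      (hm : m ∈ c.net) (hd : m.dest = .back i)
      (h : Outcome (c.backs i) (backReact i (c.backs i) m) σ' sent) :
      Transition c a { c with
        backs := Function.update c.backs i σ', net := c.net.erase m + sent, crashed := x }
  | writer (w : W) (e : Event P R) (σ' : WriterState P) (sent : Multiset (Message P R))
      (x : Finset (Node P R)) (ha : a = .run e ∨ a = .runCrash e)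
      (he : e.Enabled P c) (hd : e.proc P = .writer w)
      (h : Outcome (c.writers w) (writerReact w (c.writers w) e) σ' sent) :
      Transition c a { c with
        writers := Function.update c.writers w σ', net := e.channels P c + sent, crashed := x }
  | reader (r : R) (e : Event P R) (σ' : ReaderState P) (sent : Multiset (Message P R))
      (x : Finset (Node P R)) (ha : a = .run e ∨ a = .runCrash e)
      (he : e.Enabled P c) (hd : e.proc P = .reader r)
      (h : Outcome (c.readers r) (readerReact r (c.readers r) e) σ' sent) :
      Transition c a { c with
        readers := Function.update c.readers r σ', net := e.channels P c + sent, crashed := x }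

/-- Here `f` inserts a local state into the configuration, so an outcome of the global action is an
outcome of the action of the one process involved. -/
theorem Outcome.lift {α : Type*} {σ : α} {res : Result P R α} {c c₁ : Config P R}
    {ρ : Result P R (Config P R)} {sent : Multiset (Message P R)} (f : α → Config P R)
    (hc : f σ = c) (hρ : ρ = ⟨f res.state, res.first, res.rest⟩) (h : Outcome c ρ c₁ sent) :
    ∃ σ', Outcome σ res σ' sent ∧ c₁ = f σ' := by
  subst hρ
  rcases h with ⟨h1, h2⟩ | ⟨h1, h2⟩
  · exact ⟨σ, .inl ⟨rfl, h2⟩, h1.trans hc.symm⟩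
  · exact ⟨_, .inr ⟨rfl, h2⟩, h1⟩

theorem Transition.of_outcome {c : Config P R} {a : Action P R} {e : Event P R}
    (x : Finset (Node P R)) (ha : a = .run e ∨ a = .runCrash e)
    (he : e.Enabled P c) {c₁ : Config P R} {sent : Multiset (Message P R)}
    (h : Outcome c (perform P c e) c₁ sent) :
    Transition c a { c₁ with net := e.channels P c + sent, crashed := x } := by
  rcases hp : e.proc P with w | r | s | i
  · rw [perform_writer c hp] at h
    obtain ⟨σ', ho, rfl⟩ := Outcome.lift (σ := c.writers w) (res := writerReact w (c.writers w) e)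
      (fun σ => { c with writers := Function.update c.writers w σ }) (by simp) rfl h
    exact .writer w e σ' sent x ha he hp ho
  · rw [perform_reader c hp] at h
    obtain ⟨σ', ho, rfl⟩ := Outcome.lift (σ := c.readers r) (res := readerReact r (c.readers r) e)
      (fun σ => { c with readers := Function.update c.readers r σ }) (by simp) rfl h
    exact .reader r e σ' sent x ha he hp ho
  · obtain ⟨m, rfl, hd, hm⟩ := perform_edge c hp
    rw [hm] at h
    obtain ⟨σ', ho, rfl⟩ := Outcome.lift (σ := c.edges s) (res := edgeReact s (c.edges s) m)
      (fun σ => { c with edges := Function.update c.edges s σ }) (by simp) rfl h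
    exact .edge s m σ' sent x ha he hd ho
  · obtain ⟨m, rfl, hd, hm⟩ := perform_back c hp
    rw [hm] at h
    obtain ⟨σ', ho, rfl⟩ := Outcome.lift (σ := c.backs i) (res := backReact i (c.backs i) m)
      (fun σ => { c with backs := Function.update c.backs i σ }) (by simp) rfl h
    exact .back i m σ' sent x ha he hd ho

/-- A complete action is the outcome in which everything is sent; the two ways of crashing in the
middle are the two alternatives of `Outcome`. Invariants proved for `Transition` thus hold without
separate treatment of crashes. -/
theorem Step.transition {c c' : Config P R} {a : Action P R} (h : Step P c a c') :
    Transition c a c' := by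
  rcases a with e | e | p | _
  · obtain ⟨-, he, rfl⟩ := h
    have := Transition.of_outcome (c₁ := (perform P c e).state) (perform P c e).state.crashed
      (.inl rfl) he
      (sent := (perform P c e).first + (perform P c e).rest) (.inr ⟨rfl, _, le_rfl, rfl⟩)
    rwa [← add_assoc] at this
  · obtain ⟨-, he, ⟨u, hu, rfl⟩ | ⟨u, hu, rfl⟩⟩ := h
    · exact .of_outcome _ (.inr rfl) he (.inl ⟨rfl, hu⟩)
    · have := Transition.of_outcome (c₁ := (perform P c e).state)
        (insert (e.proc P) c.crashed) (.inr rfl) he (.inr ⟨rfl, u, hu, rfl⟩)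
      rwa [← add_assoc] at this
  · subst h; exact .idle _
  · subst h; exact .idle _

/-! ### Executions: induction, complete actions, and local steps of one process -/

namespace Execution

variable (E : Execution P R)

theorem transition (n : ℕ) : Transition (E.conf n) (E.act n) (E.conf (n + 1)) :=
  (E.step n).transition

/-- Induction along an execution. -/
theorem invariant {I : Config P R → Prop} (h₀ : I (Config.init P))
    (h : ∀ c a c', Transition c a c' → I c → I c') (n : ℕ) : I (E.conf n) := by
  induction n with
  | zero => rw [E.conf_zero]; exact h₀
  | succ n ih => exact h _ _ _ (E.transition n) ih

theorem crashed_mono {p : Node P R} {n : ℕ} (h : p ∈ (E.conf n).crashed) {n' : ℕ} (hn : n ≤ n') :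
    p ∈ (E.conf n').crashed := by
  induction n', hn using Nat.le_induction with
  | base => exact h
  | succ n' hn ih =>
    have hp : ∀ e, (perform P (E.conf n') e).state.crashed = (E.conf n').crashed := by
      intro e
      rcases e with _ | _ | m
      · rfl
      · rfl
      · cases m <;> rfl
    have := E.step n'
    rcases ha : E.act n' with e | e | q | _ <;> rw [ha] at this
    · obtain ⟨-, -, h'⟩ := this
      rw [h']; simpa [hp] using ih
    · obtain ⟨-, -, ⟨_, -, h'⟩ | ⟨_, -, h'⟩⟩ := this <;> rw [h'] <;>
        exact Finset.mem_insert_of_mem ih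
    · rw [show E.conf (n' + 1) = _ from this]; exact Finset.mem_insert_of_mem ih
    · rw [show E.conf (n' + 1) = _ from this]; exact ih

/-- A complete local action of an `L1` server. -/
theorem run_edge {n : ℕ} {m : Message P R} {s : Fin P.n₁} (h : E.act n = .run (.receive m))
    (hd : m.dest = .edge s) :
    (E.conf (n + 1)).edges s = (edgeReact s ((E.conf n).edges s) m).state ∧
    ∀ m' ∈ (edgeReact s ((E.conf n).edges s) m).first + (edgeReact s ((E.conf n).edges s) m).rest,
      m' ∈ (E.conf (n + 1)).net := by
  have := E.step n
  rw [h] at this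
  obtain ⟨-, -, h'⟩ := this
  obtain ⟨m', h1, -, h2⟩ := perform_edge (E.conf n) (e := .receive m) hd
  cases h1
  rw [h', h2]
  refine ⟨by simp [Config.setEdge], fun m' hm' => ?_⟩
  simp only [Config.setEdge, Multiset.mem_add] at hm' ⊢
  tauto

theorem run_back {n : ℕ} {m : Message P R} {i : Fin P.n₂} (h : E.act n = .run (.receive m))
    (hd : m.dest = .back i) :
    (E.conf (n + 1)).backs i = (backReact i ((E.conf n).backs i) m).state ∧
    ∀ m' ∈ (backReact i ((E.conf n).backs i) m).first + (backReact i ((E.conf n).backs i) m).rest,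
      m' ∈ (E.conf (n + 1)).net := by
  have := E.step n
  rw [h] at this
  obtain ⟨-, -, h'⟩ := this
  obtain ⟨m', h1, -, h2⟩ := perform_back (E.conf n) (e := .receive m) hd
  cases h1
  rw [h', h2]
  refine ⟨by simp [Config.setBack], fun m' hm' => ?_⟩
  simp only [Config.setBack, Multiset.mem_add] at hm' ⊢
  tauto

theorem run_writer {n : ℕ} {e : Event P R} {w : W} (h : E.act n = .run e)
    (hd : e.proc P = .writer w) :
    (E.conf (n + 1)).writers w = (writerReact w ((E.conf n).writers w) e).state ∧
    ∀ m' ∈ (writerReact w ((E.conf n).writers w) e).first +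
        (writerReact w ((E.conf n).writers w) e).rest, m' ∈ (E.conf (n + 1)).net := by
  have := E.step n
  rw [h] at this
  obtain ⟨-, -, h'⟩ := this
  have h2 := perform_writer (E.conf n) hd
  rw [h', h2]
  refine ⟨by simp [Config.setWriter], fun m' hm' => ?_⟩
  simp only [Config.setWriter, Multiset.mem_add] at hm' ⊢
  tauto

theorem run_reader {n : ℕ} {e : Event P R} {r : R} (h : E.act n = .run e)
    (hd : e.proc P = .reader r) :
    (E.conf (n + 1)).readers r = (readerReact r ((E.conf n).readers r) e).state ∧
    ∀ m' ∈ (readerReact r ((E.conf n).readers r) e).first +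
        (readerReact r ((E.conf n).readers r) e).rest, m' ∈ (E.conf (n + 1)).net := by
  have := E.step n
  rw [h] at this
  obtain ⟨-, -, h'⟩ := this
  have h2 := perform_reader (E.conf n) hd
  rw [h', h2]
  refine ⟨by simp [Config.setReader], fun m' hm' => ?_⟩
  simp only [Config.setReader, Multiset.mem_add] at hm' ⊢
  tauto

/-- The local state of a process changes only by an action of this process. -/
theorem local_step (n : ℕ) (p : Node P R) :
    (∃ e, (E.act n = .run e ∨ E.act n = .runCrash e) ∧ e.proc P = p ∧ e.Enabled P (E.conf n)) ∨
    ((∀ w, p = .writer w → (E.conf (n + 1)).writers w = (E.conf n).writers w) ∧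
     (∀ r, p = .reader r → (E.conf (n + 1)).readers r = (E.conf n).readers r) ∧
     (∀ s, p = .edge s → (E.conf (n + 1)).edges s = (E.conf n).edges s) ∧
     (∀ i, p = .back i → (E.conf (n + 1)).backs i = (E.conf n).backs i)) := by
  have hstep := E.step n
  -- The alternative `c₁ = E.conf n` covers a crash before the state changes, the other one all
  -- remaining cases.
  have main : ∀ e : Event P R, e.proc P ≠ p → ∀ c₁ : Config P R,
      c₁ = E.conf n ∨ c₁ = (perform P (E.conf n) e).state →
      (∀ w, p = .writer w → c₁.writers w = (E.conf n).writers w) ∧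
      (∀ r, p = .reader r → c₁.readers r = (E.conf n).readers r) ∧
      (∀ s, p = .edge s → c₁.edges s = (E.conf n).edges s) ∧
      (∀ i, p = .back i → c₁.backs i = (E.conf n).backs i) := by
    rintro e hne c₁ (rfl | rfl)
    · simp
    rcases hp : e.proc P with w | r | s | i
    · rw [perform_writer _ hp]
      refine ⟨?_, by simp [Config.setWriter], by simp [Config.setWriter],
        by simp [Config.setWriter]⟩
      rintro w' rfl
      exact Function.update_of_ne (by rintro rfl; exact hne hp) _ _
    · rw [perform_reader _ hp]
      refine ⟨by simp [Config.setReader], ?_, by simp [Config.setReader],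
        by simp [Config.setReader]⟩
      rintro w' rfl
      exact Function.update_of_ne (by rintro rfl; exact hne hp) _ _
    · obtain ⟨m, -, -, h⟩ := perform_edge (E.conf n) hp
      rw [h]
      refine ⟨by simp [Config.setEdge], by simp [Config.setEdge], ?_, by simp [Config.setEdge]⟩
      rintro w' rfl
      exact Function.update_of_ne (by rintro rfl; exact hne hp) _ _
    · obtain ⟨m, -, -, h⟩ := perform_back (E.conf n) hp
      rw [h]
      refine ⟨by simp [Config.setBack], by simp [Config.setBack], by simp [Config.setBack], ?_⟩
      rintro w' rfl
      exact Function.update_of_ne (by rintro rfl; exact hne hp) _ _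
  rcases ha : E.act n with e | e | q | _ <;> rw [ha] at hstep
  · obtain ⟨-, he, h⟩ := hstep
    by_cases hp : e.proc P = p
    · exact .inl ⟨e, .inl rfl, hp, he⟩
    · rw [h]; exact .inr (main e hp (perform P (E.conf n) e).state (.inr rfl))
  · obtain ⟨-, he, h⟩ := hstep
    by_cases hp : e.proc P = p
    · exact .inl ⟨e, .inr rfl, hp, he⟩
    · rcases h with ⟨_, -, h⟩ | ⟨_, -, h⟩ <;> rw [h]
      · exact .inr (main e hp (E.conf n) (.inl rfl))
      · exact .inr (main e hp (perform P (E.conf n) e).state (.inr rfl))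
  · rw [show E.conf (n + 1) = _ from hstep]; simp
  · rw [show E.conf (n + 1) = _ from hstep]; simp

/-- A non-faulty process carries out its local actions completely. -/
theorem run_of_not_faulty {n : ℕ} {p : Node P R} (hp : ¬ E.Faulty p) {e : Event P R}
    (he : E.act n = .run e ∨ E.act n = .runCrash e) (hd : e.proc P = p) : E.act n = .run e := by
  rcases he with he | he
  · exact he
  · exfalso
    have hstep := E.step n
    rw [he] at hstep
    obtain ⟨-, -, ⟨_, -, h⟩ | ⟨_, -, h⟩⟩ := hstep
    · exact hp ⟨n + 1, by rw [h, ← hd]; exact Finset.mem_insert_self _ _⟩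
    · exact hp ⟨n + 1, by rw [h, ← hd]; exact Finset.mem_insert_self _ _⟩

theorem mem_net_of_run {n : ℕ} {m : Message P R} (h : E.act n = .run (.receive m)) :
    m ∈ (E.conf n).net := by
  have hstep := E.step n
  rw [h] at hstep
  exact hstep.2.1

theorem edge_local_step (n : ℕ) {s : Fin P.n₁} (hs : ¬ E.Faulty (.edge s)) :
    (E.conf (n + 1)).edges s = (E.conf n).edges s ∨
    ∃ m, E.act n = .run (.receive m) ∧ m ∈ (E.conf n).net ∧ m.dest = .edge s ∧
      (E.conf (n + 1)).edges s = (edgeReact s ((E.conf n).edges s) m).state := by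
  rcases E.local_step n (.edge s) with ⟨e, ha, hp, he⟩ | h
  · have ha := E.run_of_not_faulty hs ha hp
    obtain ⟨m, rfl, hd, -⟩ := perform_edge (E.conf n) hp
    exact .inr ⟨m, ha, he, hd, (E.run_edge ha hd).1⟩
  · exact .inl (h.2.2.1 s rfl)

theorem writer_local_step (n : ℕ) {w : W} (hw : ¬ E.Faulty (.writer w)) :
    (E.conf (n + 1)).writers w = (E.conf n).writers w ∨
    ∃ e, E.act n = .run e ∧ e.Enabled P (E.conf n) ∧ e.proc P = .writer w ∧
      (E.conf (n + 1)).writers w = (writerReact w ((E.conf n).writers w) e).state := by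
  rcases E.local_step n (.writer w) with ⟨e, ha, hp, he⟩ | h
  · have ha := E.run_of_not_faulty hw ha hp
    exact .inr ⟨e, ha, he, hp, (E.run_writer ha hp).1⟩
  · exact .inl (h.1 w rfl)

theorem reader_local_step (n : ℕ) {r : R} (hr : ¬ E.Faulty (.reader r)) :
    (E.conf (n + 1)).readers r = (E.conf n).readers r ∨
    ∃ e, E.act n = .run e ∧ e.Enabled P (E.conf n) ∧ e.proc P = .reader r ∧
      (E.conf (n + 1)).readers r = (readerReact r ((E.conf n).readers r) e).state := by
  rcases E.local_step n (.reader r) with ⟨e, ha, hp, he⟩ | h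
  · have ha := E.run_of_not_faulty hr ha hp
    exact .inr ⟨e, ha, he, hp, (E.run_reader ha hp).1⟩
  · exact .inl (h.2.1 r rfl)

end Execution

/-! ## Local actions of the servers of layer `L1` -/

/-- Both assignments to the committed tag, at a commit and at a PUT-TAG, are guarded by `tc < t`. -/
theorem tc_le_edgeReact (s : Fin P.n₁) (σ : EdgeState P R) (m : Message P R) :
    σ.tc ≤ (edgeReact s σ m).state.tc := by
  cases m <;> simp only [edgeReact, onQueryTag, onPutData, onQueryCommTag, onQueryData, onPutTag,
    onCommitTag, onAckCodeElem, onHelperElem, broadcastResp, unregister] <;> (repeat' split) <;>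
    simp_all [le_of_lt]

theorem tags_subset_edgeReact (s : Fin P.n₁) (σ : EdgeState P R) (m : Message P R) :
    σ.L.tags ⊆ (edgeReact s σ m).state.L.tags := by
  cases m <;> simp only [edgeReact, onQueryTag, onPutData, onQueryCommTag, onQueryData, onPutTag,
    onCommitTag, onAckCodeElem, onHelperElem, broadcastResp, unregister, TagList.insertVal,
    TagList.insertBot, TagList.collect] <;> (repeat' split) <;> simp_all [Finset.subset_insert]

theorem tc_mem_edgeReact {s : Fin P.n₁} {σ : EdgeState P R} (m : Message P R) (h : σ.tc ∈ σ.L.tags)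
    (h2 : ∀ t, (σ.L.val t).isSome → t ∈ σ.L.tags) :
    (edgeReact s σ m).state.tc ∈ (edgeReact s σ m).state.L.tags := by
  cases m <;> simp only [edgeReact, onQueryTag, onPutData, onQueryCommTag, onQueryData, onPutTag,
    onCommitTag, onAckCodeElem, onHelperElem, broadcastResp, unregister, TagList.insertVal,
    TagList.insertBot, TagList.collect] <;> (repeat' split) <;> grind

theorem mem_tags_edgeReact {s : Fin P.n₁} {σ : EdgeState P R} (m : Message P R)
    (h2 : ∀ t, (σ.L.val t).isSome → t ∈ σ.L.tags) :
    ∀ t, ((edgeReact s σ m).state.L.val t).isSome → t ∈ (edgeReact s σ m).state.L.tags := by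
  intro t'
  have := h2 t'
  cases m <;> simp only [edgeReact, onQueryTag, onPutData, onQueryCommTag, onQueryData, onPutTag,
    onCommitTag, onAckCodeElem, onHelperElem, broadcastResp, unregister, TagList.insertVal,
    TagList.insertBot, TagList.collect] <;> (repeat' split) <;>
    (try simp only [Function.update_apply]) <;> grind

/-- Values are erased by the collection, which stays below the new committed tag, by a PUT-TAG at
the very tag that becomes committed, and by ACK-CODE-ELEM; `hm` keeps the last case at or below the
committed tag. -/
theorem isSome_edgeReact {s : Fin P.n₁} {σ : EdgeState P R} (m : Message P R)
    (h3 : ∀ t ∈ σ.L.tags, σ.tc < t → (σ.L.val t).isSome)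
   (hm : ∀ i s' t, m = .ackCodeElem i s' t → t ≤ σ.tc) :
    ∀ t ∈ (edgeReact s σ m).state.L.tags, (edgeReact s σ m).state.tc < t →
      ((edgeReact s σ m).state.L.val t).isSome := by
  intro t'
  have := h3 t'
  have := tc_le_edgeReact s σ m
  revert this
  cases m <;> simp only [edgeReact, onQueryTag, onPutData, onQueryCommTag, onQueryData, onPutTag,
    onCommitTag, onAckCodeElem, onHelperElem, broadcastResp, unregister, TagList.insertVal,
    TagList.insertBot, TagList.collect] <;> (repeat' split) <;>
    (try simp only [Function.update_apply]) <;> grind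

/-- The counter grows exactly when a new pair enters `seen`, so it counts distinct initiators of
broadcasts of the tag. -/
theorem card_edgeReact {s : Fin P.n₁} {σ : EdgeState P R} (m : Message P R)
    (h3 : ∀ t, σ.commitCounter t = (σ.seen.filter fun a => a.2 = t).card) :
    ∀ t, (edgeReact s σ m).state.commitCounter t =
      ((edgeReact s σ m).state.seen.filter fun a => a.2 = t).card := by
  intro t'
  have := h3 t'
  cases m <;> simp only [edgeReact, onQueryTag, onPutData, onQueryCommTag, onQueryData, onPutTag,
    onCommitTag, onAckCodeElem, onHelperElem, broadcastResp, unregister] <;> (repeat' split) <;>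
    (try simp only [Function.update_apply, Finset.filter_insert]) <;> grind

theorem seen_edgeReact (s : Fin P.n₁) (σ : EdgeState P R) (m : Message P R) :
    (edgeReact s σ m).state.seen =
      match m with | .commitTag src t _ => insert (src, t) σ.seen | _ => σ.seen := by
  cases m <;> simp only [edgeReact, onQueryTag, onPutData, onQueryCommTag, onQueryData, onPutTag,
    onCommitTag, onAckCodeElem, onHelperElem, broadcastResp, unregister, TagList.insertVal,
    TagList.insertBot, TagList.collect] <;> (repeat' split) <;> simp_all

theorem gamma_edgeReact {s : Fin P.n₁} {σ : EdgeState P R} (m : Message P R)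
    {γ : ReadOp R × Tag W} (h : γ ∈ (edgeReact s σ m).state.gamma) :
    γ ∈ σ.gamma ∨ match m with | .queryData o _ treq => γ = (o, treq) | _ => False := by
  revert h
  cases m <;> simp only [edgeReact, onQueryTag, onPutData, onQueryCommTag, onQueryData, onPutTag,
    onCommitTag, onAckCodeElem, onHelperElem, broadcastResp, unregister, TagList.insertVal,
    TagList.insertBot, TagList.collect] <;> (repeat' split) <;> grind

/-- The value of a tag that is not below the new committed tag persists unless a write to the layer
`L2` completes. -/
theorem val_edgeReact {s : Fin P.n₁} {σ : EdgeState P R} (m : Message P R) {t : Tag W}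
    (h : (σ.L.val t).isSome) (ht : ¬ t < (edgeReact s σ m).state.tc) :
    ((edgeReact s σ m).state.L.val t).isSome ∨
      (edgeReact s σ m).state.writeCounter t = P.n₂ - P.f₂ := by
  have h' := tc_le_edgeReact s σ m
  revert ht h'
  cases m <;> simp only [edgeReact, onQueryTag, onPutData, onQueryCommTag, onQueryData, onPutTag,
    onCommitTag, onAckCodeElem, onHelperElem, broadcastResp, unregister, TagList.insertVal,
    TagList.insertBot, TagList.collect] <;> (repeat' split) <;>
    (try simp only [Function.update_apply] at *) <;> grind

theorem writeCounter_edgeReact (s : Fin P.n₁) (σ : EdgeState P R) (m : Message P R) (t : Tag W) :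
    (edgeReact s σ m).state.writeCounter t =
      σ.writeCounter t +
        (match m with | .ackCodeElem _ _ t' => if t' = t then 1 else 0 | _ => 0) := by
  cases m <;> simp only [edgeReact, onQueryTag, onPutData, onQueryCommTag, onQueryData, onPutTag,
    onCommitTag, onAckCodeElem, onHelperElem, broadcastResp, unregister, TagList.insertVal,
    TagList.insertBot, TagList.collect] <;> (repeat' split) <;>
    (try simp only [Function.update_apply] at *) <;> grind

theorem readCounter_edgeReact (s : Fin P.n₁) (σ : EdgeState P R) (m : Message P R) (o : ReadOp R) :
    (edgeReact s σ m).state.readCounter o = σ.readCounter o +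
      (match m with | .helperElem _ _ o' _ _ => if o' = o then 1 else 0 | _ => 0) := by
  cases m <;> simp only [edgeReact, onQueryTag, onPutData, onQueryCommTag, onQueryData, onPutTag,
    onCommitTag, onAckCodeElem, onHelperElem, broadcastResp, unregister, TagList.insertVal,
    TagList.insertBot, TagList.collect] <;> (repeat' split) <;>
    (try simp only [Function.update_apply] at *) <;> grind

/-- The helper data of a read. -/
theorem helpers_edgeReact (s : Fin P.n₁) (σ : EdgeState P R) (m : Message P R) (o : ReadOp R) :
    match m with
    | .helperElem i _ o' t h => if o' = o then (edgeReact s σ m).state.helpers o =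
        if σ.readCounter o + 1 = P.n₂ - P.f₂ then [] else (i, t, h) :: σ.helpers o
      else (edgeReact s σ m).state.helpers o = σ.helpers o
    | _ => (edgeReact s σ m).state.helpers o = σ.helpers o := by
  cases m <;> simp only [edgeReact, onQueryTag, onPutData, onQueryCommTag, onQueryData, onPutTag,
    onCommitTag, onAckCodeElem, onHelperElem, broadcastResp, unregister, TagList.insertVal,
    TagList.insertBot, TagList.collect] <;> (repeat' split) <;>
    (try simp only [Function.update_apply] at *) <;> grind

/-- A change of the committed tag is caused by a commit or by a PUT-TAG message. -/
theorem tc_edgeReact (s : Fin P.n₁) (σ : EdgeState P R) (m : Message P R) :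
    (edgeReact s σ m).state.tc = σ.tc ∨ match m with
    | .putTag _ _ t => (edgeReact s σ m).state.tc = t
    | .commitTag _ t _ => (edgeReact s σ m).state.tc = t ∧
      P.f₁ + P.k ≤ (edgeReact s σ m).state.commitCounter t
    | _ => False := by
  cases m <;> simp only [edgeReact, onQueryTag, onPutData, onQueryCommTag, onQueryData, onPutTag,
    onCommitTag, onAckCodeElem, onHelperElem, broadcastResp, unregister, TagList.insertVal,
    TagList.insertBot, TagList.collect] <;> (repeat' split) <;> simp_all

/-! ### Which messages a reaction can send -/

theorem mem_toEdge {f : Fin P.n₁ → Message P R} {m : Message P R} :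
    m ∈ toEdge P f ↔ ∃ s, f s = m := by simp [toEdge]

theorem mem_toBack {f : Fin P.n₂ → Message P R} {m : Message P R} :
    m ∈ toBack P f ↔ ∃ s, f s = m := by simp [toBack]

theorem mem_serve {s : Fin P.n₁} {σ : EdgeState P R} {t : Tag W} {v : P.Val} {m : Message P R} :
    m ∈ serve P s σ t v ↔ ∃ γ ∈ σ.gamma, γ.2 ≤ t ∧ m = .dataResp s γ.1 (.value t v) := by
  simp only [serve, Multiset.mem_map, Finset.mem_val, Finset.mem_filter]
  grind

theorem regenerateFrom_eq_some {s : Fin P.n₁} {K : List (Fin P.n₂ × Tag W × P.Helper)}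
    {t : Tag W} {c : P.Coded} (h : regenerateFrom P s K = some (t, c)) :
    ∃ a ∈ K, a.2.1 = t := by
  obtain ⟨t', h1, h2⟩ := Option.map_eq_some_iff.1 h
  cases h2
  have := List.argmax_mem h1
  simp only [List.mem_filter, List.mem_map] at this
  exact this.1

/-- What the server `s` may send in reaction to `m`. -/
def EdgeSends (s : Fin P.n₁) (σ : EdgeState P R) (m : Message P R) (σ' : EdgeState P R) :
    Message P R → Prop
  | .tagResp s' w op t => s' = s ∧ t = σ.L.tags.max.unbotD P.t₀ ∧
      match m with | .queryTag w' op' _ => w' = w ∧ op' = op | _ => False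
  | .ackWrite s' _ t => s' = s ∧ (t ∈ σ.L.tags ∨ t ≤ σ.tc)
  | .commTagResp s' _ t => s' = s ∧ t = σ.tc
  | .dataResp s' o (.value t _) => s' = s ∧ (t ≤ σ'.tc ∨
      match m with | .queryData o' _ treq => o' = o ∧ t = treq | _ => False)
  | .dataResp s' _ (.coded t _) => s' = s ∧
      match m with
      | .helperElem _ _ o t₁ _ => t = t₁ ∨ ∃ a ∈ σ.helpers o, a.2.1 = t
      | _ => False
  | .dataResp s' _ .failed => s' = s
  | .ackRead s' _ => s' = s
  | .commitTag src t s' => match m with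
      | .putData _ _ t' _ => src = s ∧ t' = t ∧ s' ∈ P.relays
      | .commitTag src' t' _ => src' = src ∧ t' = t ∧ s ∈ P.relays ∧ (src, t) ∉ σ.seen
      | _ => False
  | .writeCodeElem s' _ t _ => s' = s ∧ σ.tc < t ∧ σ'.tc = t
  | .queryCodeElem s' _ o => s' = s ∧ match m with | .queryData o' _ _ => o' = o | _ => False
  | _ => False

/-- All later provenance arguments for messages from `L1` go through this single inspection of the
reactions. -/
theorem edgeSends_of_mem {s : Fin P.n₁} {σ : EdgeState P R} {m m' : Message P R}
    (h : m' ∈ (edgeReact s σ m).first ∨ m' ∈ (edgeReact s σ m).rest) :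
    EdgeSends s σ m (edgeReact s σ m).state m' := by
  revert h
  cases m
  case queryTag => simp +contextual [edgeReact, onQueryTag, EdgeSends]
  case queryCommTag => simp +contextual [edgeReact, onQueryCommTag, EdgeSends]
  case ackCodeElem =>
    simp only [edgeReact, onAckCodeElem]
    split <;> simp
  case putData =>
    simp only [edgeReact, onPutData]
    split <;> simp only [Multiset.mem_map, Finset.mem_val, Multiset.notMem_zero, or_false,
      Multiset.mem_singleton]
    · rintro ⟨a, ha, rfl⟩; simp [EdgeSends, ha]
    · rintro (⟨a, ha, rfl⟩ | rfl) <;> simp_all [EdgeSends]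
  case queryData =>
    simp only [edgeReact, onQueryData]
    (repeat' split) <;>
      simp only [Multiset.notMem_zero, false_or, Multiset.mem_singleton, mem_toBack]
    all_goals (rintro ⟨a, rfl⟩; simp_all [EdgeSends])
  case putTag =>
    simp only [edgeReact, onPutTag]
    (repeat' split) <;>
      simp only [Multiset.notMem_zero, false_or, Multiset.mem_singleton, mem_serve,
      writeToL2, mem_toBack, Multiset.mem_add]
    · rintro ((⟨γ, _, _, rfl⟩ | ⟨i, rfl⟩) | rfl) <;> simp_all [EdgeSends]
    · rename_i h
      have := TagList.lastBelow_eq_some h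
      rintro (⟨γ, _, _, rfl⟩ | rfl) <;> simp_all [EdgeSends, le_of_lt]
    · rintro rfl; simp [EdgeSends]
    · rintro rfl; simp [EdgeSends]
  case commitTag =>
    simp only [edgeReact, onCommitTag, broadcastResp]
    (repeat' split) <;>
      simp only [Multiset.notMem_zero, false_or, Multiset.mem_singleton, mem_serve,
      writeToL2, mem_toBack, Multiset.mem_add, Multiset.mem_map, Finset.mem_val, Finset.mem_compl,
        or_false]
    all_goals try simp_all only
    all_goals first
      | (simp; done)
      | (rintro rfl; simp_all [EdgeSends]; done)
      | (rintro (⟨a, _, rfl⟩ | ⟨a, _, rfl⟩) <;> simp_all [EdgeSends]; done)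
      | (rintro (⟨a, _, rfl⟩ | ⟨a, _, rfl⟩ | rfl) <;> simp_all [EdgeSends]; done)
      | (rintro ((rfl | ⟨a, _, _, rfl⟩) | ⟨a, rfl⟩) <;> simp_all [EdgeSends]; done)
      | (rintro (⟨a, _, rfl⟩ | ⟨a, _, rfl⟩ | (rfl | ⟨a, _, _, rfl⟩) | ⟨a, rfl⟩) <;>
          simp_all [EdgeSends])
  case helperElem =>
    simp only [edgeReact, onHelperElem]
    (repeat' split) <;> simp only [Multiset.notMem_zero, false_or, Multiset.mem_singleton]
    all_goals try simp
    · rename_i h _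
      have := regenerateFrom_eq_some h
      rintro rfl
      simp only [List.mem_cons] at this
      obtain ⟨a, rfl | ha, rfl⟩ := this
      · simp [EdgeSends]
      · simp only [EdgeSends, true_and]; exact .inr ⟨a, ha, rfl⟩
    · rintro rfl; simp [EdgeSends]
    · rintro rfl; simp [EdgeSends]
  all_goals simp [edgeReact]

/-- What the server `i` of layer `L2` may send in reaction to `m`. -/
def BackSends (i : Fin P.n₂) (σ : BackState P) (m : Message P R) : Message P R → Prop
  | .ackCodeElem i' s t => i' = i ∧
      match m with | .writeCodeElem s' _ t' _ => s' = s ∧ t' = t | _ => False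
  | .helperElem i' s o t _ => i' = i ∧ t = σ.tag ∧
      match m with | .queryCodeElem s' _ o' => s' = s ∧ o' = o | _ => False
  | _ => False

theorem backSends_of_mem {i : Fin P.n₂} {σ : BackState P} {m m' : Message P R}
    (h : m' ∈ (backReact i σ m).rest) : BackSends i σ m m' := by
  revert h
  cases m <;> simp +contextual [backReact, onWriteCodeElem, onQueryCodeElem, BackSends]

theorem first_backReact (i : Fin P.n₂) (σ : BackState P) (m : Message P R) :
    (backReact i σ m).first = 0 := by cases m <;> rfl

theorem tag_backReact (i : Fin P.n₂) (σ : BackState P) (m : Message P R) :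
    (backReact i σ m).state.tag =
      match m with | .writeCodeElem _ _ t _ => max σ.tag t | _ => σ.tag := by
  cases m <;> simp only [backReact, onWriteCodeElem, onQueryCodeElem]
  split <;> simp_all [le_of_lt]

/-- What the writer `w` may send. -/
def WriterSends (w : W) (σ : WriterState P) (σ' : WriterState P) : Message P R → Prop
  | .queryTag w' op _ => w' = w ∧ op = σ'.op
  | .putData w' _ t _ => w' = w ∧ (∃ u resp, σ.phase = .getTag u resp) ∧ σ'.phase = .putData t ∅ ∧
      (ofLex t).2 = w ∧ σ'.op = σ.op
  | _ => False

theorem writerSends_of_mem {w : W} {σ : WriterState P} {e : Event P R} {m' : Message P R}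
    (h : m' ∈ (writerReact w σ e).rest) : WriterSends w σ (writerReact w σ e).state m' := by
  revert h
  rcases e with _ | _ | m
  · simp only [writerReact, invokeWrite, mem_toEdge]
    rintro ⟨s, rfl⟩; simp [WriterSends]
  · simp [writerReact]
  · cases m
    case tagResp =>
      simp only [writerReact, onTagResp]
      (repeat' split) <;> simp only [Multiset.notMem_zero, false_imp_iff, mem_toEdge]
      rintro ⟨s, rfl⟩; simp_all [WriterSends]
    case ackWrite =>
      simp only [writerReact, onAckWrite]
      (repeat' split) <;> simp only [Multiset.notMem_zero, false_imp_iff]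
    all_goals simp [writerReact]

theorem first_writerReact (w : W) (σ : WriterState P) (e : Event P R) :
    (writerReact w σ e).first = 0 := by
  rcases e with _ | _ | m
  · rfl
  · rfl
  · cases m
    case tagResp => simp only [writerReact, onTagResp]; (repeat' split) <;> rfl
    case ackWrite => simp only [writerReact, onAckWrite]; (repeat' split) <;> rfl
    all_goals rfl

/-- What the reader `r` may send. -/
def ReaderSends (r : R) (σ : ReaderState P) (σ' : ReaderState P) : Message P R → Prop
  | .queryCommTag _ _ => True
  | .queryData o _ t => o = (r, σ.op) ∧ σ'.op = σ.op ∧ (∃ resp, σ.phase = .getCommTag resp) ∧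
      σ'.phase = .getData t []
  | .putTag o _ t => o = (r, σ.op) ∧ σ'.op = σ.op ∧ ∃ v, σ'.phase = .putTag t v ∅
  | _ => False

theorem readerSends_of_mem {r : R} {σ : ReaderState P} {e : Event P R} {m' : Message P R}
    (h : m' ∈ (readerReact r σ e).rest) : ReaderSends r σ (readerReact r σ e).state m' := by
  revert h
  rcases e with _ | _ | m
  · simp [readerReact]
  · simp only [readerReact, invokeRead, mem_toEdge]
    rintro ⟨s, rfl⟩; simp [ReaderSends]
  · cases m
    case commTagResp =>
      simp only [readerReact, onCommTagResp]
      (repeat' split) <;> simp only [Multiset.notMem_zero, false_imp_iff, mem_toEdge]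
      rintro ⟨s, rfl⟩; simp_all [ReaderSends]
    case dataResp =>
      simp only [readerReact, onDataResp]
      (repeat' split) <;> simp only [Multiset.notMem_zero, false_imp_iff, mem_toEdge]
      rintro ⟨s, rfl⟩; simp_all [ReaderSends]
    case ackRead =>
      simp only [readerReact, onAckRead]
      (repeat' split) <;> simp only [Multiset.notMem_zero, false_imp_iff]
    all_goals simp [readerReact]

theorem first_readerReact (r : R) (σ : ReaderState P) (e : Event P R) :
    (readerReact r σ e).first = 0 := by
  rcases e with _ | _ | m
  · rfl
  · rfl
  · cases m
    case commTagResp => simp only [readerReact, onCommTagResp]; (repeat' split) <;> rfl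
    case dataResp => simp only [readerReact, onDataResp]; (repeat' split) <;> rfl
    case ackRead => simp only [readerReact, onAckRead]; (repeat' split) <;> rfl
    all_goals rfl

/-- Only copies of a broadcast to the relays precede the change of state; every other message of an
`L1` server witnesses that the state has been updated. -/
theorem first_edgeReact {s : Fin P.n₁} {σ : EdgeState P R} {m m' : Message P R}
    (h : m' ∈ (edgeReact s σ m).first) :
    ∃ src t, ∃ s' ∈ P.relays, m' = .commitTag src t s' := by
  revert h
  cases m <;> simp only [edgeReact, onQueryTag, onPutData, onQueryCommTag, onQueryData, onPutTag,
    onCommitTag, onAckCodeElem, onHelperElem] <;> (repeat' split) <;>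
    simp only [Multiset.notMem_zero, false_imp_iff, Multiset.mem_map, Finset.mem_val] <;>
    (rintro ⟨s', hs, rfl⟩; exact ⟨_, _, _, hs, rfl⟩)

/-! ### Provenance of messages and monotone quantities -/

namespace Transition

variable {c c' : Config P R} {a : Action P R}

/-- The messages in `first` are sent before the state changes, so a changed state certifies that all
of them are in the channels, even if the server crashes in the same action. -/
theorem edge_eq' (h : Transition c a c') (s : Fin P.n₁) :
    c'.edges s = c.edges s ∨ ∃ m ∈ c.net, m.dest = .edge s ∧
      c'.edges s = (edgeReact s (c.edges s) m).state ∧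
      ∀ m₁ ∈ (edgeReact s (c.edges s) m).first, m₁ ∈ c'.net := by
  rcases h with _ | ⟨s₁, m, σ', sent, x, ha, hm, hd, ho⟩ | _ | _ | _
  case edge =>
    by_cases hs : s = s₁
    · subst hs
      simp only [Function.update_self]
      rcases ho with ⟨h, -⟩ | ⟨h, u, -, rfl⟩
      · exact .inl h
      · exact .inr ⟨m, hm, hd, h, fun m₁ hm₁ => by simp [hm₁]⟩
    · exact .inl (Function.update_of_ne hs _ _)
  all_goals exact .inl rfl

theorem edge_eq (h : Transition c a c') (s : Fin P.n₁) :
    c'.edges s = c.edges s ∨ ∃ m ∈ c.net, m.dest = .edge s ∧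
      c'.edges s = (edgeReact s (c.edges s) m).state :=
  (h.edge_eq' s).imp id fun ⟨m, h1, h2, h3, _⟩ => ⟨m, h1, h2, h3⟩

theorem back_eq (h : Transition c a c') (i : Fin P.n₂) :
    c'.backs i = c.backs i ∨ ∃ m ∈ c.net, m.dest = .back i ∧
      c'.backs i = (backReact i (c.backs i) m).state := by
  rcases h with _ | _ | ⟨s₁, m, σ', sent, x, ha, hm, hd, ho⟩ | _ | _
  case back =>
    by_cases hs : i = s₁
    · subst hs
      simp only [Function.update_self]
      exact ho.state_eq.imp id fun h => ⟨m, hm, hd, h⟩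
    · exact .inl (Function.update_of_ne hs _ _)
  all_goals exact .inl rfl

theorem writer_eq (h : Transition c a c') (w : W) :
    c'.writers w = c.writers w ∨ ∃ e : Event P R, (a = .run e ∨ a = .runCrash e) ∧
      e.Enabled P c ∧ e.proc P = .writer w ∧
      c'.writers w = (writerReact w (c.writers w) e).state := by
  rcases h with _ | _ | _ | ⟨s₁, m, σ', sent, x, ha, hm, hd, ho⟩ | _
  case writer =>
    by_cases hs : w = s₁
    · subst hs
      simp only [Function.update_self]
      exact ho.state_eq.imp id fun h => ⟨m, ha, hm, hd, h⟩
    · exact .inl (Function.update_of_ne hs _ _)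
  all_goals exact .inl rfl

theorem reader_eq (h : Transition c a c') (r : R) :
    c'.readers r = c.readers r ∨ ∃ e : Event P R, (a = .run e ∨ a = .runCrash e) ∧
      e.Enabled P c ∧ e.proc P = .reader r ∧
      c'.readers r = (readerReact r (c.readers r) e).state := by
  rcases h with _ | _ | _ | _ | ⟨s₁, m, σ', sent, x, ha, hm, hd, ho⟩
  case reader =>
    by_cases hs : r = s₁
    · subst hs
      simp only [Function.update_self]
      exact ho.state_eq.imp id fun h => ⟨m, ha, hm, hd, h⟩
    · exact .inl (Function.update_of_ne hs _ _)
  all_goals exact .inl rfl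

/-- The tool for invariants about channels: a message was there before, or is explained by the
reaction of one process. For `L1` the last clause adds that anything but a copy to a relay was sent
after the whole batch `first` and together with the new state; `forwarded_aux` depends on this. -/
theorem origin (h : Transition c a c') {m' : Message P R} (hm' : m' ∈ c'.net) :
    m' ∈ c.net ∨
    (∃ s, ∃ m ∈ c.net, m.dest = .edge s ∧
      (a = .run (.receive m) ∨ a = .runCrash (.receive m)) ∧
      EdgeSends s (c.edges s) m (c'.edges s) m' ∧
      ((∃ src t, ∃ s' ∈ P.relays, m' = .commitTag src t s') ∨
        (c'.edges s = (edgeReact s (c.edges s) m).state ∧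
          ∀ m₁ ∈ (edgeReact s (c.edges s) m).first, m₁ ∈ c'.net))) ∨
    (∃ i, ∃ m ∈ c.net, m.dest = .back i ∧ BackSends i (c.backs i) m m') ∨
    (∃ w, ∃ e : Event P R, (a = .run e ∨ a = .runCrash e) ∧
      e.Enabled P c ∧ e.proc P = .writer w ∧
      WriterSends w (c.writers w) (c'.writers w) m' ∧
      c'.writers w = (writerReact w (c.writers w) e).state) ∨
    (∃ r, ∃ e : Event P R, (a = .run e ∨ a = .runCrash e) ∧
      e.Enabled P c ∧ e.proc P = .reader r ∧
      ReaderSends r (c.readers r) (c'.readers r) m' ∧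
      c'.readers r = (readerReact r (c.readers r) e).state) := by
  rcases h with x | ⟨s, m, σ', sent, x, ha, hm, hd, ho⟩ | ⟨s, m, σ', sent, x, ha, hm, hd, ho⟩ |
    ⟨s, m, σ', sent, x, ha, hm, hd, ho⟩ | ⟨s, m, σ', sent, x, ha, hm, hd, ho⟩
  · exact .inl hm'
  · simp only [Multiset.mem_add] at hm'
    rcases hm' with hm' | hm'
    · exact .inl (Multiset.mem_of_mem_erase hm')
    · refine .inr (.inl ⟨s, m, hm, hd, ha, ?_⟩)
      simp only [Function.update_self]
      rcases ho.mem_sent hm' with h1 | ⟨h1, h2⟩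
      · obtain ⟨src, t, s', hs', rfl⟩ := first_edgeReact h1
        exact ⟨edgeSends_of_mem (.inl h1), .inl ⟨_, _, _, hs', rfl⟩⟩
      -- A message that is not a copy to a relay cannot come from an interrupted batch `first`, so
      -- the action got past that batch.
      · refine ⟨h2 ▸ edgeSends_of_mem (.inr h1), Classical.or_iff_not_imp_left.2 ?_⟩
        intro hne
        rcases ho with ⟨-, h3⟩ | ⟨-, u, -, rfl⟩
        · exact absurd (first_edgeReact (Multiset.mem_of_le h3 hm')) hne
        · exact ⟨h2, fun m₁ hm₁ => by simp [hm₁]⟩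
  · simp only [Multiset.mem_add] at hm'
    rcases hm' with hm' | hm'
    · exact .inl (Multiset.mem_of_mem_erase hm')
    · rcases ho.mem_sent hm' with h1 | ⟨h1, h2⟩
      · simp [first_backReact] at h1
      · exact .inr (.inr (.inl ⟨s, m, hm, hd, backSends_of_mem h1⟩))
  · simp only [Multiset.mem_add] at hm'
    rcases hm' with hm' | hm'
    · left
      cases m
      case receive m => exact Multiset.mem_of_mem_erase hm'
      all_goals exact hm'
    · rcases ho.mem_sent hm' with h1 | ⟨h1, h2⟩
      · simp [first_writerReact] at h1
      · refine .inr (.inr (.inr (.inl ⟨s, m, ha, hm, hd, ?_⟩)))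
        simp only [Function.update_self]
        exact ⟨h2 ▸ writerSends_of_mem h1, h2⟩
  · simp only [Multiset.mem_add] at hm'
    rcases hm' with hm' | hm'
    · left
      cases m
      case receive m => exact Multiset.mem_of_mem_erase hm'
      all_goals exact hm'
    · rcases ho.mem_sent hm' with h1 | ⟨h1, h2⟩
      · simp [first_readerReact] at h1
      · refine .inr (.inr (.inr (.inr ⟨s, m, ha, hm, hd, ?_⟩)))
        simp only [Function.update_self]
        exact ⟨h2 ▸ readerSends_of_mem h1, h2⟩

theorem tc_le (h : Transition c a c') (s : Fin P.n₁) : (c.edges s).tc ≤ (c'.edges s).tc := by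
  rcases h.edge_eq s with h | ⟨m, -, -, h⟩ <;> rw [h]
  exact tc_le_edgeReact _ _ _

theorem tags_subset (h : Transition c a c') (s : Fin P.n₁) :
    (c.edges s).L.tags ⊆ (c'.edges s).L.tags := by
  rcases h.edge_eq s with h | ⟨m, -, -, h⟩ <;> rw [h]
  exact tags_subset_edgeReact _ _ _

theorem seen_subset (h : Transition c a c') (s : Fin P.n₁) :
    (c.edges s).seen ⊆ (c'.edges s).seen := by
  rcases h.edge_eq s with h | ⟨m, -, -, h⟩ <;> rw [h]
  rw [seen_edgeReact]
  split <;> simp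

theorem readCounter_le (h : Transition c a c') (s : Fin P.n₁) (o : ReadOp R) :
    (c.edges s).readCounter o ≤ (c'.edges s).readCounter o := by
  rcases h.edge_eq s with h | ⟨m, -, -, h⟩ <;> rw [h]
  rw [readCounter_edgeReact]
  omega

theorem tag_le (h : Transition c a c') (i : Fin P.n₂) : (c.backs i).tag ≤ (c'.backs i).tag := by
  rcases h.back_eq i with h | ⟨m, -, -, h⟩ <;> rw [h]
  rw [tag_backReact]
  split <;> simp

end Transition

/-- WRITE-CODE-ELEM messages and their acknowledgments belong to tags that were committed. -/
def WritesCommitted (c : Config P R) : Prop :=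
  (∀ s i t e, .writeCodeElem s i t e ∈ c.net → t ≤ (c.edges s).tc) ∧
  (∀ i s t, .ackCodeElem i s t ∈ c.net → t ≤ (c.edges s).tc)

/-- A write to `L2` is sent in the action that commits its tag, and committed tags only grow; an
acknowledgment inherits the bound from the write that it answers. -/
theorem WritesCommitted.transition {c c' : Config P R} {a : Action P R} (h : Transition c a c')
    (hc : WritesCommitted c) : WritesCommitted c' := by
  refine ⟨fun s i t e hm => ?_, fun i s t hm => ?_⟩
  · rcases h.origin hm with h1 | ⟨s, m, -, -, -, h1, -⟩ | ⟨i, m, -, -, h1⟩ |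
      ⟨w, e, -, -, -, h1, -⟩ |
      ⟨r, e, -, -, -, h1, -⟩
    · exact (hc.1 s i t e h1).trans (h.tc_le s)
    · obtain ⟨rfl, -, h1⟩ := h1; exact h1.ge
    all_goals exact h1.elim
  · rcases h.origin hm with h1 | ⟨s, m, -, -, -, h1, -⟩ | ⟨i, m, hm', -, h1⟩ |
      ⟨w, e, -, -, -, h1, -⟩ | ⟨r, e, -, -, -, h1, -⟩
    · exact (hc.2 i s t h1).trans (h.tc_le s)
    · exact h1.elim
    · obtain ⟨rfl, h1⟩ := h1
      cases m <;> simp only at h1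
      obtain ⟨rfl, rfl⟩ := h1
      exact (hc.1 _ _ _ _ hm').trans (h.tc_le _)
    all_goals exact h1.elim

/-- The list, the committed tag and the commit counters of an `L1` server are consistent. -/
structure EdgeState.Consistent (σ : EdgeState P R) : Prop where
  tc_mem : σ.tc ∈ σ.L.tags
  mem_of_isSome : ∀ t, (σ.L.val t).isSome → t ∈ σ.L.tags
  isSome_of_lt : ∀ t ∈ σ.L.tags, σ.tc < t → (σ.L.val t).isSome
  card_seen : ∀ t, σ.commitCounter t = (σ.seen.filter fun a => a.2 = t).card

namespace Execution

variable (E : Execution P R)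

theorem writesCommitted (n : ℕ) : WritesCommitted (E.conf n) :=
  E.invariant (by simp [WritesCommitted, Config.init]) (fun _ _ _ h hc => hc.transition h) n

/-- The bound on acknowledged tags from `writesCommitted` is what allows a completed write to erase
a value without emptying an entry above the committed tag. -/
theorem consistent (n : ℕ) (s : Fin P.n₁) : ((E.conf n).edges s).Consistent := by
  induction n with
  | zero =>
    rw [E.conf_zero]
    constructor <;> simp [Config.init, EdgeState.init]
  | succ n ih =>
    rcases (E.transition n).edge_eq s with h | ⟨m, hm, hd, h⟩ <;> rw [h]
    · exact ih
    · refine ⟨tc_mem_edgeReact m ih.tc_mem ih.mem_of_isSome, mem_tags_edgeReact m ih.mem_of_isSome,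
        isSome_edgeReact m ih.isSome_of_lt ?_, card_edgeReact m ih.card_seen⟩
      rintro i s' t rfl
      cases hd
      exact (E.writesCommitted n).2 _ _ _ hm

/-! ### Monotonicity in time and origins of PUT-DATA and COMMIT-TAG -/

variable {n n' : ℕ}

theorem tc_mono (h : n ≤ n') (s : Fin P.n₁) :
    ((E.conf n).edges s).tc ≤ ((E.conf n').edges s).tc :=
  monotone_nat_of_le_succ (f := fun n => ((E.conf n).edges s).tc)
    (fun n => (E.transition n).tc_le s) h

theorem tags_mono (h : n ≤ n') (s : Fin P.n₁) :
    ((E.conf n).edges s).L.tags ⊆ ((E.conf n').edges s).L.tags :=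
  monotone_nat_of_le_succ (f := fun n => ((E.conf n).edges s).L.tags)
    (fun n => (E.transition n).tags_subset s) h

theorem seen_mono (h : n ≤ n') (s : Fin P.n₁) :
    ((E.conf n).edges s).seen ⊆ ((E.conf n').edges s).seen :=
  monotone_nat_of_le_succ (f := fun n => ((E.conf n).edges s).seen)
    (fun n => (E.transition n).seen_subset s) h

theorem readCounter_mono (h : n ≤ n') (s : Fin P.n₁) (o : ReadOp R) :
    ((E.conf n).edges s).readCounter o ≤ ((E.conf n').edges s).readCounter o :=
  monotone_nat_of_le_succ (f := fun n => ((E.conf n).edges s).readCounter o)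
    (fun n => (E.transition n).readCounter_le s o) h

theorem tag_mono (h : n ≤ n') (i : Fin P.n₂) :
    ((E.conf n).backs i).tag ≤ ((E.conf n').backs i).tag :=
  monotone_nat_of_le_succ (f := fun n => ((E.conf n).backs i).tag)
    (fun n => (E.transition n).tag_le i) h

theorem t₀_le_tc (n : ℕ) (s : Fin P.n₁) : P.t₀ ≤ ((E.conf n).edges s).tc := by
  have := E.tc_mono n.zero_le s
  rwa [E.conf_zero] at this

theorem t₀_le_tag (n : ℕ) (i : Fin P.n₂) : P.t₀ ≤ ((E.conf n).backs i).tag := by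
  have := E.tag_mono n.zero_le i
  rwa [E.conf_zero] at this

/-- A write acknowledgment is sent only when the list contains a tag at least as large. -/
theorem exists_tag_of_ackWrite (n : ℕ) {s : Fin P.n₁} {w : W} {t : Tag W}
    (h : .ackWrite s w t ∈ (E.conf n).net) : ∃ t' ∈ ((E.conf n).edges s).L.tags, t ≤ t' := by
  induction n with
  | zero => rw [E.conf_zero] at h; simp [Config.init] at h
  | succ n ih =>
    have ht := E.transition n
    have hsub := ht.tags_subset s
    rcases ht.origin h with h1 | ⟨s, m, -, -, -, h1, -⟩ | ⟨i, m, hm, -, h1⟩ |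
      ⟨w, e, -, -, -, h1, -⟩ | ⟨r, e, -, -, -, h1, -⟩
    · obtain ⟨t', h1, h2⟩ := ih h1
      exact ⟨t', hsub h1, h2⟩
    · obtain ⟨rfl, h1 | h1⟩ := h1
      · exact ⟨t, hsub h1, le_rfl⟩
      · exact ⟨_, hsub (E.consistent n _).tc_mem, h1⟩
    all_goals exact h1.elim

/-- The writer id is a component of the tag that the writer forms. Two PUT-DATA messages with equal
tags therefore come from the same writer. -/
theorem writer_of_putData (n : ℕ) {s : Fin P.n₁} {w : W} {t : Tag W} {v : P.Val}
    (h : .putData w s t v ∈ (E.conf n).net) : (ofLex t).2 = w := by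
  induction n with
  | zero => rw [E.conf_zero] at h; simp [Config.init] at h
  | succ n ih =>
    rcases (E.transition n).origin h with h1 | ⟨s, m, -, -, -, h1, -⟩ | ⟨i, m, hm, -, h1⟩ |
      ⟨w, e, -, -, -, h1, -⟩ | ⟨r, e, -, -, -, h1, -⟩
    · exact ih h1
    · exact h1.elim
    · exact h1.elim
    · obtain ⟨rfl, -, -, h1, -⟩ := h1; exact h1
    · exact h1.elim

/-- COMMIT-TAG messages originate from the receipt of PUT-DATA by their initiator. -/
theorem putData_of_commitTag (n : ℕ) {src : Fin P.n₁} {t : Tag W} {s : Fin P.n₁}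
    (h : .commitTag src t s ∈ (E.conf n).net ∨ (src, t) ∈ ((E.conf n).edges s).seen) :
    ∃ n' < n, ∃ w v, .putData w src t v ∈ (E.conf n').net ∧
      (E.act n' = .run (.receive (.putData w src t v)) ∨
        E.act n' = .runCrash (.receive (.putData w src t v))) := by
  induction n generalizing s with
  | zero => rw [E.conf_zero] at h; simp [Config.init, EdgeState.init] at h
  | succ n ih =>
    have ht := E.transition n
    have lift : (∃ n' < n, ∃ w v, .putData w src t v ∈ (E.conf n').net ∧
        (E.act n' = .run (.receive (.putData w src t v)) ∨
        E.act n' = .runCrash (.receive (.putData w src t v)))) →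
        (∃ n' < n + 1, ∃ w v, .putData w src t v ∈ (E.conf n').net ∧
        (E.act n' = .run (.receive (.putData w src t v)) ∨
        E.act n' = .runCrash (.receive (.putData w src t v)))) := by
      rintro ⟨n', h, h'⟩; exact ⟨n', by omega, h'⟩
    rcases h with h | h
    · rcases ht.origin h with h1 | ⟨s', m, hm, hd, ha, h1, -⟩ | ⟨i, m, hm, -, h1⟩ |
        ⟨w, e, -, -, -, h1, -⟩ | ⟨r, e, -, -, -, h1, -⟩
      · exact lift (ih (.inl h1))
      · cases m <;> simp only [EdgeSends] at h1
        · obtain ⟨rfl, rfl, -⟩ := h1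
          cases hd
          exact ⟨n, by omega, _, _, hm, ha⟩
        · obtain ⟨rfl, rfl, -⟩ := h1
          exact lift (ih (.inl hm))
      all_goals exact h1.elim
    · rcases ht.edge_eq s with h1 | ⟨m, hm, hd, h1⟩
      · rw [h1] at h; exact lift (ih (.inr h))
      · rw [h1, seen_edgeReact] at h
        split at h
        · rcases Finset.mem_insert.1 h with h | h
          · cases h; exact lift (ih (.inl hm))
          · exact lift (ih (.inr h))
        · exact lift (ih (.inr h))

/-- Copies of the broadcast of `t` by `src` have been sent to all relays by time `n`. -/
def Forwarded (n : ℕ) (src : Fin P.n₁) (t : Tag W) : Prop :=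
  ∀ r ∈ P.relays, ∃ n' ≤ n, .commitTag src t r ∈ (E.conf n').net

/-- Only a relay sends copies to servers outside the set of relays, and it does so after having sent
to all relays; likewise a relay records a broadcast as seen only after that batch. Any other server
that consumes a copy has received one of the former kind. -/
theorem forwarded_aux (n : ℕ) {src : Fin P.n₁} {t : Tag W} {s : Fin P.n₁}
    (h : (.commitTag src t s ∈ (E.conf n).net ∧ s ∉ P.relays) ∨
      (src, t) ∈ ((E.conf n).edges s).seen) : E.Forwarded n src t := by
  induction n generalizing s with
  | zero => rw [E.conf_zero] at h; simp [Config.init, EdgeState.init] at h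
  | succ n ih =>
    have ht := E.transition n
    have lift : E.Forwarded n src t → E.Forwarded (n + 1) src t := fun h r hr => by
      obtain ⟨n', h, h'⟩ := h r hr; exact ⟨n', by omega, h'⟩
    rcases h with ⟨h, hs⟩ | h
    · rcases ht.origin h with h1 | ⟨s', m, hm, hd, ha, h1, h2⟩ | ⟨i, m, hm, -, h1⟩ |
        ⟨w, e, -, -, -, h1, -⟩ | ⟨r, e, -, -, -, h1, -⟩
      · exact lift (ih (.inl ⟨h1, hs⟩))
      · rcases h2 with ⟨_, _, _, hs', h2⟩ | ⟨-, h2⟩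
        · cases h2; exact absurd hs' hs
        cases m <;> simp only [EdgeSends] at h1
        · exact absurd h1.2.2 hs
        · obtain ⟨rfl, rfl, h3, h4⟩ := h1
          intro r hr
          refine ⟨n + 1, le_rfl, h2 _ ?_⟩
          simp [edgeReact, onCommitTag, h3, h4, hr]
      all_goals exact h1.elim
    · by_cases h0 : (src, t) ∈ ((E.conf n).edges s).seen
      · exact lift (ih (.inr h0))
      rcases ht.edge_eq' s with h1 | ⟨m, hm, hd, h1, h2⟩
      · rw [h1] at h; exact absurd h h0
      rw [h1, seen_edgeReact] at h
      split at h
      case h_2 => exact absurd h h0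
      rename_i src' t' s'
      cases hd
      rcases Finset.mem_insert.1 h with h | h
      case inr => exact absurd h h0
      cases h
      -- A relay that records the broadcast has just sent the batch itself; for any other server the
      -- consumed copy falls under the induction hypothesis.
      by_cases hs : s ∈ P.relays
      · intro r hr
        refine ⟨n + 1, le_rfl, h2 _ ?_⟩
        simp [edgeReact, onCommitTag, hs, h0, hr]
      · exact lift (ih (.inl ⟨hm, hs⟩))

end Execution

/-- The acknowledgment is sent whether or not `t` exceeds the committed tag, and after the test the
committed tag is at least `t` in either branch. -/
theorem commit_edgeReact {s : Fin P.n₁} {σ : EdgeState P R} {src : Fin P.n₁} {t : Tag W}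
    {x : Fin P.n₁} (hseen : (src, t) ∉ σ.seen) (ht : t ∈ σ.L.tags)
    (hc : P.f₁ + P.k ≤ (edgeReact s σ (.commitTag src t x)).state.commitCounter t) :
    t ≤ (edgeReact s σ (.commitTag src t x)).state.tc ∧
    .ackWrite s (ofLex t).2 t ∈ (edgeReact s σ (.commitTag src t x)).rest := by
  revert hc
  simp only [edgeReact, onCommitTag, broadcastResp, if_neg hseen, unregister]
  (repeat' split) <;> simp_all

/-! ### Quorums of survivors, reliable broadcast, and commits -/

namespace Execution

variable (E : Execution P R)

theorem card_le_card_filter_not_faulty (hcrash₁ : {s : Fin P.n₁ | E.Faulty (.edge s)}.ncard ≤ P.f₁)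
    (S : Finset (Fin P.n₁)) [DecidablePred fun s : Fin P.n₁ => ¬ E.Faulty (.edge s)] :
    S.card ≤ (S.filter fun s => ¬ E.Faulty (.edge s)).card + P.f₁ := by
  classical
  have h1 := S.card_filter_add_card_filter_not (p := fun s : Fin P.n₁ => E.Faulty (.edge s))
  have h2 : (S.filter fun s : Fin P.n₁ => E.Faulty (.edge s)).card ≤ P.f₁ := by
    refine le_trans ?_ hcrash₁
    rw [← Set.ncard_coe_finset]
    exact Set.ncard_le_ncard (fun s hs => by simpa using (Finset.mem_filter.1 hs).2)
      (Set.toFinite _)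
  convert (show S.card ≤ (S.filter fun s => ¬ E.Faulty (.edge s)).card + P.f₁ by omega)

/-- If a growing set of servers eventually contains every non-faulty server of layer `L1`, then it
eventually contains `f₁ + k` servers. -/
theorem exists_quorum (hcrash₁ : {s : Fin P.n₁ | E.Faulty (.edge s)}.ncard ≤ P.f₁)
    {g : ℕ → Finset (Fin P.n₁)} (hg : Monotone g) {n₀ : ℕ}
    (h : ∀ s, ¬ E.Faulty (.edge s) → ∃ n, s ∈ g n) :
    ∃ n ≥ n₀, (∀ s, ¬ E.Faulty (.edge s) → s ∈ g n) ∧ P.f₁ + P.k ≤ (g n).card := by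
  classical
  have h' : ∀ s, ∃ n, ¬ E.Faulty (.edge s) → s ∈ g n := fun s => by
    by_cases hs : E.Faulty (.edge s)
    · exact ⟨0, fun h => absurd hs h⟩
    · exact (h s hs).imp fun n hn _ => hn
  choose N hN using h'
  -- There are finitely many servers and the set only grows, so the latest of the individual times
  -- serves all of them.
  let M := max n₀ (Finset.univ.sup N)
  have hM : ∀ s, ¬ E.Faulty (.edge s) → s ∈ g M := fun s hs =>
    hg ((Finset.le_sup (f := N) (Finset.mem_univ s)).trans (le_max_right _ _)) (hN s hs)
  refine ⟨M, le_max_left _ _, hM, ?_⟩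
  have h1 := E.card_le_card_filter_not_faulty hcrash₁ Finset.univ
  have h2 : (Finset.univ.filter fun s : Fin P.n₁ => ¬ E.Faulty (.edge s)).card ≤ (g M).card :=
    Finset.card_le_card fun s hs => hM s (Finset.mem_filter.1 hs).2
  have h3 := P.n₁_eq
  simp only [Finset.card_univ, Fintype.card_fin] at h1
  omega

/-- A non-faulty relay that has received a broadcast has forwarded it. -/
theorem exists_commitTag_of_relay {r : Fin P.n₁} (hr : ¬ E.Faulty (.edge r)) (hrel : r ∈ P.relays)
    {src : Fin P.n₁} {t : Tag W} {n : ℕ} (h : (src, t) ∈ ((E.conf n).edges r).seen)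
    (s : Fin P.n₁) : ∃ n', .commitTag src t s ∈ (E.conf n').net := by
  induction n with
  | zero => rw [E.conf_zero] at h; simp [Config.init, EdgeState.init] at h
  | succ n ih =>
    by_cases h0 : (src, t) ∈ ((E.conf n).edges r).seen
    · exact ih h0
    rcases E.edge_local_step n hr with h1 | ⟨m, ha, hm, hd, h1⟩
    · rw [h1] at h; exact absurd h h0
    rw [h1, seen_edgeReact] at h
    split at h
    case h_2 => exact absurd h h0
    rcases Finset.mem_insert.1 h with h | h
    case inr => exact absurd h h0
    cases h
    refine ⟨n + 1, (E.run_edge ha hd).2 _ ?_⟩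
    by_cases hs : s ∈ P.relays <;> simp [edgeReact, onCommitTag, h0, hrel, hs]

theorem seen_of_run {n : ℕ} {src s : Fin P.n₁} {t : Tag W}
    (h : E.act n = .run (.receive (.commitTag src t s))) :
    (src, t) ∈ ((E.conf (n + 1)).edges s).seen := by
  rw [(E.run_edge h rfl).1, seen_edgeReact]
  simp

/-- If the relays are sent a broadcast, then all non-faulty servers consume it. -/
theorem Forwarded.exists_seen {E : Execution P R} (hrel : E.Reliable)
    (hcrash₁ : {s : Fin P.n₁ | E.Faulty (.edge s)}.ncard ≤ P.f₁) {n : ℕ}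
    {src : Fin P.n₁} {t : Tag W} (h : E.Forwarded n src t) {s : Fin P.n₁}
    (hs : ¬ E.Faulty (.edge s)) : ∃ n', (src, t) ∈ ((E.conf n').edges s).seen := by
  classical
  have h1 := E.card_le_card_filter_not_faulty hcrash₁ P.relays
  rw [P.relays_card] at h1
  -- Among `f₁ + 1` relays at least one is non-faulty.
  obtain ⟨r, hr⟩ := Finset.card_pos.1 (show 0 <
    (P.relays.filter fun s => ¬ E.Faulty (.edge s)).card by omega)
  obtain ⟨hr, hr'⟩ := Finset.mem_filter.1 hr
  obtain ⟨n₁, -, h1⟩ := h r hr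
  obtain ⟨n₂, -, h2⟩ := hrel _ _ h1 hr'
  obtain ⟨n₃, h3⟩ := E.exists_commitTag_of_relay hr' hr (E.seen_of_run h2) s
  obtain ⟨n₄, -, h4⟩ := hrel _ _ h3 hs
  exact ⟨_, E.seen_of_run h4⟩

theorem forwarded_of_seen {n : ℕ} {src : Fin P.n₁} {t : Tag W} {s : Fin P.n₁}
    (h : (src, t) ∈ ((E.conf n).edges s).seen) : E.Forwarded n src t :=
  E.forwarded_aux n (.inr h)

theorem forwarded_of_putData {n : ℕ} {w : W} {s : Fin P.n₁} {t : Tag W} {v : P.Val}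
    (h : E.act n = .run (.receive (.putData w s t v))) : E.Forwarded (n + 1) s t := by
  intro r hr
  refine ⟨n + 1, le_rfl, (E.run_edge h rfl).2 _ ?_⟩
  simp only [edgeReact, onPutData]
  split <;> simp [hr]

/-- A non-faulty server that has `t` in its list commits `t` or a larger tag, and acknowledges `t`,
when it consumes the last one of `f₁ + k` broadcasts that include its own. -/
theorem exists_commit {s : Fin P.n₁} (hs : ¬ E.Faulty (.edge s)) {p : ℕ} {t : Tag W}
    (ht : t ∈ ((E.conf p).edges s).L.tags) (h0 : (s, t) ∉ ((E.conf p).edges s).seen)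
    {S : Finset (Fin P.n₁)} (hS : P.f₁ + P.k ≤ S.card) (hsS : s ∈ S)
    (hall : ∀ src ∈ S, ∃ n, (src, t) ∈ ((E.conf n).edges s).seen) :
    ∃ u ≥ p, t ≤ ((E.conf (u + 1)).edges s).tc ∧
      .ackWrite s (ofLex t).2 t ∈ (E.conf (u + 1)).net := by
  classical
  have hex : ∃ n, ∀ src ∈ S, (src, t) ∈ ((E.conf n).edges s).seen := by
    have h' : ∀ src, ∃ n, src ∈ S → (src, t) ∈ ((E.conf n).edges s).seen := fun src => by
      by_cases h : src ∈ S
      · exact (hall src h).imp fun _ h _ => h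
      · exact ⟨0, fun h' => absurd h' h⟩
    choose N hN using h'
    exact ⟨Finset.univ.sup N, fun src hsrc =>
      E.seen_mono (Finset.le_sup (f := N) (Finset.mem_univ src)) s (hN src hsrc)⟩
  -- The first time at which all broadcasts from `S` are consumed. It is after `p` because the
  -- server's own broadcast, which belongs to `S`, is still missing at `p`.
  have hfind := Nat.find_spec hex
  have hlt : p < Nat.find hex := by
    by_contra hle
    exact h0 (E.seen_mono (not_lt.1 hle) s (hfind s hsS))
  obtain ⟨u, hu⟩ : ∃ u, Nat.find hex = u + 1 := ⟨Nat.find hex - 1, by omega⟩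
  have hmin := Nat.find_min hex (m := u) (by omega)
  rw [hu] at hfind hlt
  push Not at hmin
  obtain ⟨src₀, hsrc₀, hnot⟩ := hmin
  refine ⟨u, by omega, ?_⟩
  -- The initiators in `S` contribute distinct pairs to `seen`, and the counter is the number of
  -- such pairs.
  have hcard : P.f₁ + P.k ≤ ((E.conf (u + 1)).edges s).commitCounter t := by
    rw [(E.consistent (u + 1) s).card_seen]
    refine hS.trans (Finset.card_le_card_of_injOn (fun src => (src, t)) ?_ ?_)
    · intro src hsrc
      simpa using hfind src hsrc
    · intro a _ b _ h; exact (Prod.mk.inj h).1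
  rcases E.edge_local_step u hs with h1 | ⟨m, ha, hm, hd, h1⟩
  · exact absurd (h1 ▸ hfind src₀ hsrc₀) hnot
  have h2 := hfind src₀ hsrc₀
  rw [h1, seen_edgeReact] at h2
  split at h2
  case h_2 => exact absurd h2 hnot
  rcases Finset.mem_insert.1 h2 with h2 | h2
  case inr => exact absurd h2 hnot
  cases h2
  rw [h1] at hcard
  obtain ⟨h3, h4⟩ := commit_edgeReact hnot (E.tags_mono (by omega) s ht) hcard
  exact ⟨by rw [h1]; exact h3, (E.run_edge ha hd).2 _ (by simp [h4])⟩

end Execution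

/-! ## Writers -/

theorem le_maxTag {n : ℕ} {resp : List (Fin n × Tag W)} {a : Fin n × Tag W} (h : a ∈ resp) :
    a.2 ≤ maxTag P resp := by
  induction resp with
  | nil => simp at h
  | cons b l ih =>
    rcases List.mem_cons.1 h with rfl | h
    · exact le_max_left _ _
    · exact (ih h).trans (le_max_right _ _)

theorem maxTag_mem {n : ℕ} {D : Set (Tag W)} {resp : List (Fin n × Tag W)} (h₀ : P.t₀ ∈ D)
    (h : ∀ a ∈ resp, a.2 ∈ D) : maxTag P resp ∈ D := by
  induction resp with
  | nil => exact h₀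
  | cons b l ih =>
    rcases max_choice b.2 (maxTag P l) with h' | h'
    · exact (show maxTag P (b :: l) = _ from h') ▸ h b (by simp)
    · exact (show maxTag P (b :: l) = _ from h') ▸ ih fun a ha => h a (by simp [ha])

/-- The tag that a writer forms from the responses in its get-tag phase. -/
def newTag (P : Params F W) (w : W) (resp : List (Fin P.n₁ × Tag W)) : Tag W :=
  toLex ((ofLex (maxTag P resp)).1 + 1, w)

theorem maxTag_lt_newTag (w : W) (resp : List (Fin P.n₁ × Tag W)) :
    maxTag P resp < newTag P w resp := by
  rw [Prod.Lex.lt_iff]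
  left
  simp [newTag]

/-- Lists the effects of an event on a writer rather than the events, so that ignored answers fall
into the first case together with events that do nothing. -/
theorem writerReact_cases (w : W) (σ : WriterState P) (e : Event P R) :
    (writerReact w σ e).state = σ ∨
    (∃ w' v, e = .invokeWrite w' v ∧ (writerReact w σ e).state = ⟨σ.op + 1, .getTag v []⟩ ∧
      ∀ s, .queryTag w (σ.op + 1) s ∈ (writerReact w σ e).rest) ∨
    (∃ s w' t v resp, e = .receive (.tagResp s w' σ.op t) ∧ σ.phase = .getTag v resp ∧
      ((numServers ((s, t) :: resp) < P.f₁ + P.k ∧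
        (writerReact w σ e).state = ⟨σ.op, .getTag v ((s, t) :: resp)⟩) ∨
      (P.f₁ + P.k ≤ numServers ((s, t) :: resp) ∧
        (writerReact w σ e).state = ⟨σ.op, .putData (newTag P w ((s, t) :: resp)) ∅⟩ ∧
        ∀ s', .putData w s' (newTag P w ((s, t) :: resp)) v ∈ (writerReact w σ e).rest))) ∨
    (∃ s w' t acks, e = .receive (.ackWrite s w' t) ∧ σ.phase = .putData t acks ∧
      (((insert s acks).card < P.f₁ + P.k ∧
        (writerReact w σ e).state = ⟨σ.op, .putData t (insert s acks)⟩) ∨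
      (P.f₁ + P.k ≤ (insert s acks).card ∧ (writerReact w σ e).state = ⟨σ.op, .returned⟩))) := by
  rcases e with ⟨w', v⟩ | r | m
  · refine .inr (.inl ⟨w', v, rfl, rfl, fun s => ?_⟩)
    exact mem_toEdge.2 ⟨s, rfl⟩
  · exact .inl rfl
  cases m
  case tagResp s w' op t =>
    rcases hp : σ.phase with _ | ⟨v, resp⟩ | ⟨tw, acks⟩ | _
    case getTag =>
      by_cases h1 : op = σ.op
      · subst h1
        refine .inr (.inr (.inl ⟨s, w', t, v, resp, rfl, rfl, ?_⟩))
        by_cases h2 : P.f₁ + P.k ≤ numServers ((s, t) :: resp)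
        · refine .inr ⟨h2, ?_, fun s' => ?_⟩
          · simp [writerReact, onTagResp, hp, h2, newTag]
          · simp [writerReact, onTagResp, hp, h2, newTag, mem_toEdge]
        · exact .inl ⟨not_le.1 h2, by simp [writerReact, onTagResp, hp, h2]⟩
      · left; simp [writerReact, onTagResp, hp, h1]
    all_goals left; simp [writerReact, onTagResp, hp]
  case ackWrite s w' t =>
    rcases hp : σ.phase with _ | ⟨v, resp⟩ | ⟨tw, acks⟩ | _
    case putData =>
      by_cases h1 : t = tw
      · subst h1
        refine .inr (.inr (.inr ⟨s, w', t, acks, rfl, rfl, ?_⟩))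
        by_cases h2 : P.f₁ + P.k ≤ (insert s acks).card
        · exact .inr ⟨h2, by simp [writerReact, onAckWrite, hp, h2]⟩
        · exact .inl ⟨not_le.1 h2, by simp [writerReact, onAckWrite, hp, h2]⟩
      · left; simp [writerReact, onAckWrite, hp, h1]
    all_goals left; simp [writerReact, onAckWrite, hp]
  all_goals exact .inl rfl

/-- The servers whose answers are recorded in the current phase of a writer. -/
def WriterPhase.servers : WriterPhase P → Finset (Fin P.n₁)
  | .getTag _ resp => (resp.map Prod.fst).toFinset
  | .putData _ acks => acks
  | _ => ∅

theorem op_le_writerReact (w : W) (σ : WriterState P) (e : Event P R) :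
    σ.op ≤ (writerReact w σ e).state.op := by
  rcases writerReact_cases w σ e with h | ⟨_, _, -, h, -⟩ |
    ⟨_, _, _, _, _, -, -, ⟨-, h⟩ | ⟨-, h, -⟩⟩ |
    ⟨_, _, _, _, -, -, ⟨-, h⟩ | ⟨-, h⟩⟩ <;> rw [h]
  exact Nat.le_succ _

namespace Execution

variable (E : Execution P R)

/-- The answer that would complete a quorum ends the phase in the same action, and every new phase
starts with an empty record; `k ≥ 1` makes the empty record smaller than a quorum. -/
theorem card_writer_servers_lt (n : ℕ) (w : W) :
    ((E.conf n).writers w).phase.servers.card < P.f₁ + P.k := by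
  have hk := P.code.one_le_k
  induction n with
  | zero =>
    rw [E.conf_zero]
    simp only [Config.init, WriterPhase.servers, Finset.card_empty]
    omega
  | succ n ih =>
    rcases (E.transition n).writer_eq w with h | ⟨e, -, -, -, h⟩ <;> rw [h]
    · exact ih
    rcases writerReact_cases w ((E.conf n).writers w) e with h | ⟨_, _, -, h, -⟩ |
      ⟨_, _, _, _, _, -, -, ⟨h', h⟩ | ⟨-, h, -⟩⟩ | ⟨_, _, _, _, -, -, ⟨h', h⟩ | ⟨-, h⟩⟩ <;> rw [h]
    · exact ih
    · simp only [WriterPhase.servers, List.map_nil, List.toFinset_nil, Finset.card_empty]; omega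
    · exact h'
    · simp only [WriterPhase.servers, Finset.card_empty]; omega
    · exact h'
    · simp only [WriterPhase.servers, Finset.card_empty]; omega

theorem writer_op_le (n : ℕ) (w : W) :
    ((E.conf n).writers w).op ≤ ((E.conf (n + 1)).writers w).op := by
  rcases (E.transition n).writer_eq w with h | ⟨e, -, -, -, h⟩ <;> rw [h]
  exact op_le_writerReact _ _ _

/-- No message anticipates a future operation; a writer that starts an operation therefore finds no
answers that already carry the new number. -/
theorem op_le_of_tagResp (n : ℕ) {w : W} {op : ℕ} {s : Fin P.n₁}
    (h : .queryTag w op s ∈ (E.conf n).net ∨ ∃ t, .tagResp s w op t ∈ (E.conf n).net) :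
    op ≤ ((E.conf n).writers w).op := by
  induction n with
  | zero => rw [E.conf_zero] at h; simp [Config.init] at h
  | succ n ih =>
    have hle := E.writer_op_le n w
    rcases h with h | ⟨t, h⟩
    · rcases (E.transition n).origin h with h1 | ⟨s, m, -, -, -, h1, -⟩ | ⟨i, m, hm, -, h1⟩ |
        ⟨w, e, -, -, -, h1, -⟩ | ⟨r, e, -, -, -, h1, -⟩
      · exact (ih (.inl h1)).trans hle
      · exact h1.elim
      · exact h1.elim
      · obtain ⟨rfl, h1⟩ := h1; exact h1.le
      · exact h1.elim
    · rcases (E.transition n).origin h with h1 | ⟨s, m, hm, hd, -, h1, -⟩ | ⟨i, m, hm, -, h1⟩ |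
        ⟨w, e, -, -, -, h1, -⟩ | ⟨r, e, -, -, -, h1, -⟩
      · exact (ih (.inr ⟨t, h1⟩)).trans hle
      · obtain ⟨rfl, -, h1⟩ := h1
        cases m <;> simp only at h1
        obtain ⟨rfl, rfl⟩ := h1
        cases hd
        exact (ih (.inl hm)).trans hle
      all_goals exact h1.elim

/-- A PUT-DATA message of the writer `w` with tag `t` was sent by time `n`. -/
def Put (n : ℕ) (w : W) (t : Tag W) : Prop :=
  ∃ n' ≤ n, ∃ s v, .putData w s t v ∈ (E.conf n').net

theorem Put.of_succ {E : Execution P R} {n : ℕ} {w : W} {t : Tag W} (h : E.Put (n + 1) w t) :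
    E.Put n w t ∨ ((∃ v resp, ((E.conf n).writers w).phase = .getTag v resp) ∧
      ((E.conf (n + 1)).writers w).phase = .putData t ∅) := by
  obtain ⟨n', hn', s, v, h⟩ := h
  rcases Nat.lt_or_ge n' (n + 1) with h1 | h1
  · exact .inl ⟨n', by omega, s, v, h⟩
  obtain rfl : n' = n + 1 := by omega
  rcases (E.transition n).origin h with h1 | ⟨s, m, hm, hd, -, h1, -⟩ | ⟨i, m, hm, -, h1⟩ |
    ⟨w, e, -, -, -, h1, -⟩ | ⟨r, e, -, -, -, h1, -⟩
  · exact .inl ⟨n, le_rfl, s, v, h1⟩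
  · exact h1.elim
  · exact h1.elim
  · obtain ⟨rfl, h1, h2, -⟩ := h1
    exact .inr ⟨h1, h2⟩
  · exact h1.elim

/-- Server `s` has a tag in its list that is at least `t`. -/
def HasTag (n : ℕ) (s : Fin P.n₁) (t : Tag W) : Prop :=
  ∃ t' ∈ ((E.conf n).edges s).L.tags, t ≤ t'

theorem HasTag.succ {E : Execution P R} {n : ℕ} {s : Fin P.n₁} {t : Tag W} (h : E.HasTag n s t) :
    E.HasTag (n + 1) s t := by
  obtain ⟨t', h1, h2⟩ := h
  exact ⟨t', (E.transition n).tags_subset s h1, h2⟩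

/-- An answer sent in this step reports the maximum of a list that already contains a tag at least
`t`. -/
theorem le_of_tagResp_succ {n : ℕ} {s : Fin P.n₁} {t : Tag W} (h : E.HasTag n s t) {w : W} {op : ℕ}
    {t' : Tag W} (hm : .tagResp s w op t' ∈ (E.conf (n + 1)).net) :
    .tagResp s w op t' ∈ (E.conf n).net ∨ t ≤ t' := by
  rcases (E.transition n).origin hm with h1 | ⟨s, m, hm, hd, -, h1, -⟩ | ⟨i, m, hm, -, h1⟩ |
    ⟨w, e, -, -, -, h1, -⟩ | ⟨r, e, -, -, -, h1, -⟩
  · exact .inl h1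
  · obtain ⟨rfl, rfl, -⟩ := h1
    obtain ⟨t', h1, h2⟩ := h
    right
    obtain ⟨b, hb⟩ := Finset.max_of_mem h1
    have := Finset.le_max h1
    rw [hb] at this ⊢
    exact h2.trans (WithBot.coe_le_coe.1 this)
  all_goals exact h1.elim

/-- A server acknowledges a tag only if its list has a tag at least as large, and list entries are
never deleted. -/
theorem hasTag_of_mem_acks (n : ℕ) {w : W} {tw : Tag W} {acks : Finset (Fin P.n₁)}
    (h : ((E.conf n).writers w).phase = .putData tw acks) {s : Fin P.n₁} (hs : s ∈ acks) :
    E.HasTag n s tw := by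
  induction n generalizing acks with
  | zero => rw [E.conf_zero] at h; simp [Config.init] at h
  | succ n ih =>
    rcases (E.transition n).writer_eq w with h1 | ⟨e, -, he, -, h1⟩ <;> rw [h1] at h
    · exact (ih h hs).succ
    rcases writerReact_cases w ((E.conf n).writers w) e with h2 | ⟨_, _, -, h2, -⟩ |
      ⟨_, _, _, _, _, -, -, ⟨h', h2⟩ | ⟨-, h2, -⟩⟩ |
      ⟨s', w', t, acks', rfl, h3, ⟨h', h2⟩ | ⟨-, h2⟩⟩ <;>
      rw [h2] at h
    · exact (ih h hs).succ
    · simp at h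
    · simp at h
    · simp only [WriterPhase.putData.injEq] at h
      obtain ⟨-, rfl⟩ := h
      simp at hs
    · simp only [WriterPhase.putData.injEq] at h
      obtain ⟨rfl, rfl⟩ := h
      rcases Finset.mem_insert.1 hs with rfl | hs
      · exact HasTag.succ (E.exists_tag_of_ackWrite n he)
      · exact (ih h3 hs).succ
    · simp at h

/-- What the state of the writer `w` says about the tags that it used before. -/
def Used (n : ℕ) (w : W) (t : Tag W) : Prop :=
  match ((E.conf n).writers w).phase with
  | .idle => False
  | .getTag _ resp => ∃ Q : Finset (Fin P.n₁), P.f₁ + P.k ≤ Q.card ∧ ∀ s ∈ Q, E.HasTag n s t ∧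
      (∀ t', .tagResp s w ((E.conf n).writers w).op t' ∈ (E.conf n).net → t ≤ t') ∧
      ∀ a ∈ resp, a.1 = s → t ≤ a.2
  | .putData tw _ =>
      t = tw ∨ ∃ Q : Finset (Fin P.n₁), P.f₁ + P.k ≤ Q.card ∧ ∀ s ∈ Q, E.HasTag n s t
  | .returned => ∃ Q : Finset (Fin P.n₁), P.f₁ + P.k ≤ Q.card ∧ ∀ s ∈ Q, E.HasTag n s t

/-- The quorum for `t` arises from the acknowledgments when the write of `t` completes. It survives
because lists only grow; during a later get-tag phase the bound passes from the lists to the answers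
of these servers, both in transit and recorded. -/
theorem used_of_put (hwf : E.WellFormed) (n : ℕ) {w : W} {t : Tag W} (h : E.Put n w t) :
    E.Used n w t := by
  induction n with
  | zero =>
    obtain ⟨n', hn', s, v, h⟩ := h
    obtain rfl : n' = 0 := by omega
    rw [E.conf_zero] at h; simp [Config.init] at h
  | succ n ih =>
    rcases h.of_succ with h0 | ⟨⟨v, resp, h0⟩, h1⟩
    swap
    · simp [Used, h1]
    have hu := ih h0
    rcases (E.transition n).writer_eq w with h1 | ⟨e, ha, he, hd, h1⟩
    · rw [Used] at hu ⊢
      rw [h1]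
      split at hu
      · exact hu
      · obtain ⟨Q, hQ, hu⟩ := hu
        refine ⟨Q, hQ, fun s hs => ⟨(hu s hs).1.succ, fun t' ht' => ?_, (hu s hs).2.2⟩⟩
        exact (E.le_of_tagResp_succ (hu s hs).1 ht').elim ((hu s hs).2.1 t') id
      · exact hu.imp id fun ⟨Q, hQ, hu⟩ => ⟨Q, hQ, fun s hs => (hu s hs).succ⟩
      · obtain ⟨Q, hQ, hu⟩ := hu
        exact ⟨Q, hQ, fun s hs => (hu s hs).succ⟩
    rcases writerReact_cases w ((E.conf n).writers w) e with h2 | ⟨w', v, rfl, h2, -⟩ |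
      ⟨s', w', t', v, resp, rfl, h3, ⟨h', h2⟩ | ⟨-, h2, -⟩⟩ |
      ⟨s', w', t', acks', rfl, h3, ⟨h', h2⟩ | ⟨h', h2⟩⟩ <;> rw [h2] at h1
    · rw [Used] at hu ⊢
      rw [h1]
      split at hu
      · exact hu
      · obtain ⟨Q, hQ, hu⟩ := hu
        refine ⟨Q, hQ, fun s hs => ⟨(hu s hs).1.succ, fun t' ht' => ?_, (hu s hs).2.2⟩⟩
        exact (E.le_of_tagResp_succ (hu s hs).1 ht').elim ((hu s hs).2.1 t') id
      · exact hu.imp id fun ⟨Q, hQ, hu⟩ => ⟨Q, hQ, fun s hs => (hu s hs).succ⟩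
      · obtain ⟨Q, hQ, hu⟩ := hu
        exact ⟨Q, hQ, fun s hs => (hu s hs).succ⟩
    · cases hd
      -- Well-formedness leaves only the phases `idle`, where no tag has been used, and `returned`,
      -- where a quorum is already available.
      have hfree := hwf.1 n w v ha
      rw [Used] at hu ⊢
      rw [h1]
      split at hu
      · exact hu.elim
      · simp_all [WriterPhase.Free]
      · simp_all [WriterPhase.Free]
      · obtain ⟨Q, hQ, hu⟩ := hu
        refine ⟨Q, hQ, fun s hs => ⟨(hu s hs).succ, fun t' ht' => ?_, by simp⟩⟩
        -- An answer older than this step would bear an operation number above the current one.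
        refine (E.le_of_tagResp_succ (hu s hs) ht').elim (fun h4 => ?_) id
        have := E.op_le_of_tagResp n (.inr ⟨t', h4⟩)
        simp only at this
        omega
    · cases hd
      simp only [Used, h3] at hu
      simp only [Used, h1]
      obtain ⟨Q, hQ, hu⟩ := hu
      refine ⟨Q, hQ, fun s hs => ⟨(hu s hs).1.succ, fun t' ht' => ?_, fun a ha' has => ?_⟩⟩
      · exact (E.le_of_tagResp_succ (hu s hs).1 ht').elim ((hu s hs).2.1 t') id
      · rcases List.mem_cons.1 ha' with rfl | ha'
        · obtain rfl := has
          exact (hu s' hs).2.1 _ he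
        · exact (hu s hs).2.2 a ha' has
    · simp only [Used, h3] at hu
      simp only [Used, h1]
      obtain ⟨Q, hQ, hu⟩ := hu
      exact .inr ⟨Q, hQ, fun s hs => (hu s hs).1.succ⟩
    · simp only [Used, h3] at hu
      simp only [Used, h1]
      exact hu.imp id fun ⟨Q, hQ, hu⟩ => ⟨Q, hQ, fun s hs => (hu s hs).succ⟩
    · simp only [Used, h3] at hu
      simp only [Used, h1]
      -- If `t` is the tag of the write that ends here, the acknowledging servers form the quorum;
      -- otherwise the old quorum persists.
      rcases hu with rfl | ⟨Q, hQ, hu⟩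
      · refine ⟨insert s' acks', h', fun s hs => ?_⟩
        rcases Finset.mem_insert.1 hs with rfl | hs
        · exact HasTag.succ (E.exists_tag_of_ackWrite n he)
        · exact (E.hasTag_of_mem_acks n h3 hs).succ
      · exact ⟨Q, hQ, fun s hs => (hu s hs).succ⟩

/-- Two quorums share at least `2 (f₁ + k) - n₁ = k ≥ 1` servers. -/
theorem exists_mem_inter {A B : Finset (Fin P.n₁)} (hA : P.f₁ + P.k ≤ A.card)
    (hB : P.f₁ + P.k ≤ B.card) : ∃ s ∈ A, s ∈ B := by
  have h1 := Finset.card_union_add_card_inter A B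
  have h2 : (A ∪ B).card ≤ P.n₁ := by simpa using Finset.card_le_univ (A ∪ B)
  have h3 := P.n₁_eq
  have h4 := P.code.one_le_k
  obtain ⟨s, hs⟩ := Finset.card_pos.1 (show 0 < (A ∩ B).card by omega)
  exact ⟨s, (Finset.mem_inter.1 hs).1, (Finset.mem_inter.1 hs).2⟩

/-- The tag of a write is new. -/
theorem not_put (hwf : E.WellFormed) {n : ℕ} {w : W} {s : Fin P.n₁} {t : Tag W} {v : P.Val}
    {resp : List (Fin P.n₁ × Tag W)} (hp : ((E.conf n).writers w).phase = .getTag v resp)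
    (hm : .tagResp s w ((E.conf n).writers w).op t ∈ (E.conf n).net)
    (hq : P.f₁ + P.k ≤ numServers ((s, t) :: resp)) :
    ¬ E.Put n w (newTag P w ((s, t) :: resp)) := by
  intro h
  have hu := E.used_of_put hwf n h
  simp only [Used, hp] at hu
  obtain ⟨Q, hQ, hu⟩ := hu
  obtain ⟨s', h1, h2⟩ := exists_mem_inter hQ hq
  simp only [List.mem_toFinset, List.mem_map] at h2
  obtain ⟨a, h2, rfl⟩ := h2
  -- Had the new tag been used before, the answer of a common server of the two quorums would be at
  -- least the new tag, which exceeds all answers.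
  refine absurd (maxTag_lt_newTag w ((s, t) :: resp)) (not_lt.2 (le_trans ?_ (le_maxTag h2)))
  rcases List.mem_cons.1 h2 with rfl | h3
  · exact (hu _ h1).2.1 _ hm
  · exact (hu _ h1).2.2 _ h3 rfl

end Execution

/-! ### Completion of writes -/

namespace Execution

variable (E : Execution P R)

/-- An incomplete write of a non-faulty writer remains its current operation. -/
theorem writer_stays (hwf : E.WellFormed) {w : W} (hw : ¬ E.Faulty (.writer w)) {n : ℕ}
    (hn : ¬ ((E.conf n).writers w).phase.Free)
    (hnever : ∀ m > n, ((E.conf m).writers w).op = ((E.conf n).writers w).op →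
      ((E.conf m).writers w).phase ≠ .returned) {m : ℕ} (hm : n ≤ m) :
    ((E.conf m).writers w).op = ((E.conf n).writers w).op ∧
      ¬ ((E.conf m).writers w).phase.Free := by
  induction m, hm using Nat.le_induction with
  | base => exact ⟨rfl, hn⟩
  | succ m hm ih =>
    have hnever := hnever (m + 1) (by omega)
    rcases E.writer_local_step m hw with h | ⟨e, ha, -, hd, h⟩ <;> rw [h] at hnever ⊢
    · exact ih
    rcases writerReact_cases w ((E.conf m).writers w) e with h2 | ⟨w', v, rfl, h2, -⟩ |
      ⟨s', w', t', v, resp, rfl, h3, ⟨h', h2⟩ | ⟨-, h2, -⟩⟩ |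
      ⟨s', w', t', acks', rfl, h3, ⟨h', h2⟩ | ⟨h', h2⟩⟩ <;> rw [h2] at hnever ⊢
    · exact ih
    · cases hd
      exact absurd (hwf.1 m w v (.inl ha)) ih.2
    · exact ⟨ih.1, by simp [WriterPhase.Free]⟩
    · exact ⟨ih.1, by simp [WriterPhase.Free]⟩
    · exact ⟨ih.1, by simp [WriterPhase.Free]⟩
    · exact absurd rfl (hnever ih.1)

/-- The get-tag phase of a write of a non-faulty writer ends. -/
theorem exists_putData (hwf : E.WellFormed) (hrel : E.Reliable)
    (hcrash₁ : {s : Fin P.n₁ | E.Faulty (.edge s)}.ncard ≤ P.f₁)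
    {w : W} (hw : ¬ E.Faulty (.writer w)) {n : ℕ} {v : P.Val} {resp : List (Fin P.n₁ × Tag W)}
    (hn : ((E.conf n).writers w).phase = .getTag v resp)
    (hsent : ∀ s, .queryTag w ((E.conf n).writers w).op s ∈ (E.conf n).net) :
    ∃ m ≥ n, ∃ t v, ¬ E.Put m w t ∧ ((E.conf (m + 1)).writers w).op = ((E.conf n).writers w).op ∧
      ((E.conf (m + 1)).writers w).phase = .putData t ∅ ∧
      ∀ s, .putData w s t v ∈ (E.conf (m + 1)).net := by
  -- If the phase never ends, then no answer is ever lost, the record grows until it contains all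
  -- non-faulty servers, and this exceeds the size possible in a pending phase.
  by_contra hcon
  set j := ((E.conf n).writers w).op with hj
  have hstep : ∀ m ≥ n, (((E.conf m).writers w).op = j ∧
      ∃ v resp, ((E.conf m).writers w).phase = .getTag v resp) →
      (((E.conf (m + 1)).writers w).op = j ∧
      ∃ v resp, ((E.conf (m + 1)).writers w).phase = .getTag v resp) ∧
      ((E.conf m).writers w).phase.servers ⊆ ((E.conf (m + 1)).writers w).phase.servers ∧
      ∀ s t, E.act m = .run (.receive (.tagResp s w j t)) →
        s ∈ ((E.conf (m + 1)).writers w).phase.servers := by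
    rintro m hm ⟨h1, v₁, resp₁, h2⟩
    have hreact : ∀ e, e.proc P = .writer w → E.act m = .run e → e.Enabled P (E.conf m) →
        (((writerReact w ((E.conf m).writers w) e).state.op = j ∧
      ∃ v resp, (writerReact w ((E.conf m).writers w) e).state.phase = .getTag v resp) ∧
      ((E.conf m).writers w).phase.servers ⊆
        (writerReact w ((E.conf m).writers w) e).state.phase.servers ∧
      ∀ s t, e = .receive (.tagResp s w j t) →
        s ∈ (writerReact w ((E.conf m).writers w) e).state.phase.servers) := by
      intro e hd ha he
      rcases writerReact_cases w ((E.conf m).writers w) e with h3 | ⟨w', v, rfl, -⟩ |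
        ⟨s', w', t', v, resp, rfl, h3, ⟨h', h4⟩ | ⟨h5, h4, h6⟩⟩ |
        ⟨s', w', t', acks', -, h3, -⟩
      · rw [h3]
        refine ⟨⟨h1, v₁, resp₁, h2⟩, subset_rfl, ?_⟩
        rintro s t rfl
        -- A matching answer either lengthens the record or ends the phase, so it cannot leave the
        -- state unchanged.
        exfalso
        simp only [writerReact, onTagResp, h2, h1] at h3
        have h6 := congrArg WriterState.phase h3
        by_cases h5 : P.f₁ + P.k ≤ numServers ((s, t) :: resp₁)
        · simp [h5, h2] at h6
        · simp [h5, h2] at h6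
      · cases hd
        have := hwf.1 m w v (.inl ha)
        simp [h2, WriterPhase.Free] at this
      · rw [h4]
        refine ⟨⟨h1, v, _, rfl⟩, ?_, ?_⟩
        · rw [h3]; simp [WriterPhase.servers]
        · intro s t h
          simp only [Event.receive.injEq, Msg.tagResp.injEq] at h
          obtain ⟨rfl, -⟩ := h
          simp [WriterPhase.servers]
      · cases hd
        obtain ⟨h7, h8⟩ := E.run_writer ha rfl
        rw [h4] at h7
        exact absurd ⟨m, hm, _, v, E.not_put hwf h3 he h5, by rw [h7]; exact h1, by rw [h7],
          fun s => h8 _ (Multiset.mem_add.2 (.inr (h6 s)))⟩ hcon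
      · simp [h2] at h3
    rcases E.writer_local_step m hw with h | ⟨e, ha, he, hd, h⟩
    · rw [h]
      refine ⟨⟨h1, v₁, resp₁, h2⟩, subset_rfl, fun s t ha => ?_⟩
      obtain ⟨-, -, h3⟩ := hreact _ rfl ha (E.mem_net_of_run ha)
      rw [← (E.run_writer ha rfl).1, h] at h3
      exact h3 s t rfl
    · rw [h]
      obtain ⟨h3, h4, h5⟩ := hreact e hd ha he
      exact ⟨h3, h4, fun s t h6 => h5 s t (by rw [ha] at h6; simpa using h6)⟩
  have hall : ∀ m ≥ n, ((E.conf m).writers w).op = j ∧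
      ∃ v resp, ((E.conf m).writers w).phase = .getTag v resp := by
    intro m hm
    induction m, hm using Nat.le_induction with
    | base => exact ⟨rfl, v, resp, hn⟩
    | succ m hm ih => exact (hstep m hm ih).1
  obtain ⟨m, -, -, hm⟩ := E.exists_quorum hcrash₁ (n₀ := 0)
    (g := fun m => ((E.conf (n + m)).writers w).phase.servers)
    (monotone_nat_of_le_succ fun m => (hstep (n + m) (by omega) (hall _ (by omega))).2.1)
    (fun s hs => by
      obtain ⟨n₁, h1, h2⟩ := hrel _ _ (hsent s) hs
      have h3 := (E.run_edge h2 rfl).2 (.tagResp s w j _)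
        (by simp only [edgeReact, onQueryTag, zero_add, Multiset.mem_singleton]; rfl)
      obtain ⟨n₂, h4, h5⟩ := hrel _ _ h3 hw
      -- The growing family is indexed by the time elapsed since `n`, and the answer received in
      -- step `n₂` is on record at time `n₂ + 1`.
      refine ⟨n₂ + 1 - n, ?_⟩
      rw [show n + (n₂ + 1 - n) = n₂ + 1 by omega]
      exact (hstep n₂ (by omega) (hall _ (by omega))).2.2 s _ h5)
  exact absurd hm (not_le.2 (E.card_writer_servers_lt _ _))

/-- Every non-faulty server acknowledges the tag of a write. -/
theorem exists_ackWrite (hrel : E.Reliable)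
    (hcrash₁ : {s : Fin P.n₁ | E.Faulty (.edge s)}.ncard ≤ P.f₁)
    {n : ℕ} {w : W} {t : Tag W} {v : P.Val} (hput : ¬ E.Put n w t)
    (hsent : ∀ s, .putData w s t v ∈ (E.conf (n + 1)).net) {s : Fin P.n₁}
    (hs : ¬ E.Faulty (.edge s)) : ∃ m > n, .ackWrite s w t ∈ (E.conf m).net := by
  classical
  have hwt : (ofLex t).2 = w := E.writer_of_putData _ (hsent s)
  have hrecv : ∀ s, ¬ E.Faulty (.edge s) →
      ∃ p > n, E.act p = .run (.receive (.putData w s t v)) := fun s hs => by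
    obtain ⟨p, h1, h2⟩ := hrel _ _ (hsent s) hs
    exact ⟨p, h1, h2⟩
  -- The first receipt after time `n` of any PUT-DATA with this tag. The value is left open because
  -- an earlier broadcast would be traced back only to some PUT-DATA with tag `t`.
  have hex : ∃ p, p > n ∧ ∃ v, E.act p = .run (.receive (.putData w s t v)) :=
    let ⟨p, hp, h⟩ := hrecv s hs; ⟨p, hp, v, h⟩
  obtain ⟨hp, v', ha⟩ := Nat.find_spec hex
  set p := Nat.find hex
  obtain ⟨h1, h2⟩ := E.run_edge ha rfl
  by_cases htc : ((E.conf p).edges s).tc < t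
  swap
  · refine ⟨p + 1, by omega, h2 _ ?_⟩
    simp [edgeReact, onPutData, htc]
  -- A copy of the server's own broadcast already consumed would stem from an earlier receipt of
  -- PUT-DATA with tag `t`: after `n` this contradicts the choice of `p`, up to `n` it contradicts
  -- `hput`.
  have h0 : (s, t) ∉ ((E.conf (p + 1)).edges s).seen := by
    rw [h1, seen_edgeReact]
    intro h
    obtain ⟨n', h3, w', v'', h4, h5⟩ := E.putData_of_commitTag p (.inr h)
    obtain rfl : w = w' := hwt.symm.trans (E.writer_of_putData _ h4)
    have h5 := E.run_of_not_faulty hs h5 rfl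
    by_cases h6 : n' > n
    · exact Nat.find_min hex h3 ⟨h6, _, h5⟩
    · exact hput ⟨n', by omega, _, _, h4⟩
  have ht : t ∈ ((E.conf (p + 1)).edges s).L.tags := by
    rw [h1]; simp [edgeReact, onPutData, htc, TagList.insertVal]
  -- All non-faulty servers receive PUT-DATA and broadcast; they number at least `n₁ - f₁ = f₁ + k`
  -- and include `s`.
  obtain ⟨u, hu, -, h3⟩ := E.exists_commit hs ht h0
    (S := Finset.univ.filter fun s => ¬ E.Faulty (.edge s)) (by
      have h1 := E.card_le_card_filter_not_faulty hcrash₁ Finset.univ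
      have h2 := P.n₁_eq
      simp only [Finset.card_univ, Fintype.card_fin] at h1
      omega) (by simp [hs]) (fun src hsrc => by
      obtain ⟨q, -, hq⟩ := hrecv src (by simpa using hsrc)
      exact (E.forwarded_of_putData hq).exists_seen hrel hcrash₁ hs)
  exact ⟨u + 1, by omega, hwt ▸ h3⟩

/-- If the write never returned, its put-data phase would remain pending while the acknowledgments
of all non-faulty servers arrive, which are too many for a pending phase. -/
theorem writeCompletes (hwf : E.WellFormed) (hrel : E.Reliable)
    (hcrash₁ : {s : Fin P.n₁ | E.Faulty (.edge s)}.ncard ≤ P.f₁) {w : W} {v : P.Val} {n : ℕ}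
    (hw : ¬ E.Faulty (.writer w)) (hact : E.act n = .run (.invokeWrite w v)) :
    E.WriteCompletes w n := by
  by_contra hcon
  obtain ⟨h1, h2⟩ := E.run_writer hact rfl
  have hnever : ∀ m > n + 1, ((E.conf m).writers w).op = ((E.conf (n + 1)).writers w).op →
      ((E.conf m).writers w).phase ≠ .returned := fun m hm ho hr => hcon ⟨m, by omega, ho, hr⟩
  obtain ⟨m, hm, t, v', hput, hop, hph, hsent⟩ := E.exists_putData hwf hrel hcrash₁ hw
    (n := n + 1) (v := v) (resp := []) (by rw [h1]; rfl) (fun s => h2 _ (by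
      rw [h1]; simp [writerReact, invokeWrite, mem_toEdge]))
  have hstay : ∀ m' ≥ m + 1, ((E.conf m').writers w).op = ((E.conf (m + 1)).writers w).op ∧
      ¬ ((E.conf m').writers w).phase.Free := fun m' hm' =>
    E.writer_stays hwf hw (by rw [hph]; simp [WriterPhase.Free])
      (fun m' hm' ho => hnever m' (by omega) (ho.trans hop)) hm'
  have hstep : ∀ m' ≥ m + 1, (∃ acks, ((E.conf m').writers w).phase = .putData t acks) →
      (∃ acks, ((E.conf (m' + 1)).writers w).phase = .putData t acks) ∧
      ((E.conf m').writers w).phase.servers ⊆ ((E.conf (m' + 1)).writers w).phase.servers ∧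
      ∀ s, E.act m' = .run (.receive (.ackWrite s w t)) →
        s ∈ ((E.conf (m' + 1)).writers w).phase.servers := by
    rintro m' hm' ⟨acks, hp⟩
    have hfree := (hstay (m' + 1) (by omega)).2
    have hrecv : ∀ s, E.act m' = .run (.receive (.ackWrite s w t)) →
        s ∈ ((E.conf (m' + 1)).writers w).phase.servers := by
      intro s ha
      have h3 := (E.run_writer ha rfl).1
      by_cases h4 : P.f₁ + P.k ≤ (insert s acks).card
      · simp [h3, writerReact, onAckWrite, hp, h4, WriterPhase.Free] at hfree
      · simp [h3, writerReact, onAckWrite, hp, h4, WriterPhase.servers]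
    rcases E.writer_local_step m' hw with h | ⟨e, ha, he, hd, h⟩
    · exact ⟨by rw [h]; exact ⟨_, hp⟩, by rw [h], hrecv⟩
    rcases writerReact_cases w ((E.conf m').writers w) e with h3 | ⟨w', v, rfl, -⟩ |
        ⟨s', w', t', v, resp, rfl, h3, -⟩ |
        ⟨s', w', t', acks', -, h3, ⟨-, h4⟩ | ⟨-, h4⟩⟩
    · rw [h3] at h
      exact ⟨by rw [h]; exact ⟨_, hp⟩, by rw [h], hrecv⟩
    · cases hd
      have := hwf.1 m' w v (.inl ha)
      simp [hp, WriterPhase.Free] at this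
    · simp [hp] at h3
    · rw [hp] at h3
      cases h3
      refine ⟨by rw [h, h4]; exact ⟨_, rfl⟩, ?_, hrecv⟩
      rw [h, h4, hp]; exact Finset.subset_insert _ _
    · rw [h, h4] at hfree
      simp [WriterPhase.Free] at hfree
  have hall : ∀ m' ≥ m + 1, ∃ acks, ((E.conf m').writers w).phase = .putData t acks := by
    intro m' hm'
    induction m', hm' using Nat.le_induction with
    | base => exact ⟨_, hph⟩
    | succ m' hm' ih => exact (hstep m' hm' ih).1
  obtain ⟨m', -, -, hm'⟩ := E.exists_quorum hcrash₁ (n₀ := 0)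
    (g := fun i => ((E.conf (m + 1 + i)).writers w).phase.servers)
    (monotone_nat_of_le_succ fun i => (hstep (m + 1 + i) (by omega) (hall _ (by omega))).2.1)
    (fun s hs => by
      obtain ⟨n₁, h3, h4⟩ := E.exists_ackWrite hrel hcrash₁ hput hsent hs
      obtain ⟨n₂, h5, h6⟩ := hrel _ _ h4 hw
      refine ⟨n₂ - m, ?_⟩
      rw [show m + 1 + (n₂ - m) = n₂ + 1 by omega]
      exact (hstep n₂ (by omega) (hall _ (by omega))).2.2 s h6)
  exact absurd hm' (not_le.2 (E.card_writer_servers_lt _ _))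

end Execution

/-! ## Readers -/

theorem readerReact_cases (r : R) (σ : ReaderState P) (e : Event P R) :
    (readerReact r σ e).state = σ ∨
    (∃ r', e = .invokeRead r' ∧ (readerReact r σ e).state = ⟨σ.op + 1, .getCommTag []⟩) ∨
    (∃ s r' t resp, e = .receive (.commTagResp s (r', σ.op) t) ∧ σ.phase = .getCommTag resp ∧
      ((numServers ((s, t) :: resp) < P.f₁ + P.k ∧
        (readerReact r σ e).state = ⟨σ.op, .getCommTag ((s, t) :: resp)⟩) ∨
      ((readerReact r σ e).state = ⟨σ.op, .getData (maxTag P ((s, t) :: resp)) []⟩ ∧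
        ∀ s', .queryData (r, σ.op) s' (maxTag P ((s, t) :: resp)) ∈ (readerReact r σ e).rest))) ∨
    (∃ s r' a treq resp, e = .receive (.dataResp s (r', σ.op) a) ∧ σ.phase = .getData treq resp ∧
      ((¬ (P.f₁ + P.k ≤ numServers ((s, a) :: resp) ∧ candidates P ((s, a) :: resp) ≠ []) ∧
        (readerReact r σ e).state = ⟨σ.op, .getData treq ((s, a) :: resp)⟩) ∨
      (∃ t v, (t, v) ∈ candidates P ((s, a) :: resp) ∧
        (readerReact r σ e).state = ⟨σ.op, .putTag t v ∅⟩ ∧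
        ∀ s', .putTag (r, σ.op) s' t ∈ (readerReact r σ e).rest))) ∨
    (∃ s r' t v acks, e = .receive (.ackRead s (r', σ.op)) ∧ σ.phase = .putTag t v acks ∧
      (((insert s acks).card < P.f₁ + P.k ∧
        (readerReact r σ e).state = ⟨σ.op, .putTag t v (insert s acks)⟩) ∨
      (readerReact r σ e).state = ⟨σ.op, .returned v⟩)) := by
  rcases e with ⟨w', v⟩ | r | m
  · exact .inl rfl
  · exact .inr (.inl ⟨r, rfl, rfl⟩)
  cases m
  case commTagResp s o t =>
    rcases hp : σ.phase with _ | resp | ⟨treq, resp⟩ | ⟨t', v, acks⟩ | v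
    case getCommTag =>
      by_cases h1 : o.2 = σ.op
      · obtain ⟨r', op⟩ := o
        obtain rfl : op = σ.op := h1
        refine .inr (.inr (.inl ⟨s, r', t, resp, rfl, rfl, ?_⟩))
        by_cases h2 : P.f₁ + P.k ≤ numServers ((s, t) :: resp)
        · refine .inr ⟨?_, fun s' => ?_⟩
          · simp [readerReact, onCommTagResp, hp, h2]
          · simp [readerReact, onCommTagResp, hp, h2, mem_toEdge]
        · exact .inl ⟨not_le.1 h2, by simp [readerReact, onCommTagResp, hp, h2]⟩
      · left; simp [readerReact, onCommTagResp, hp, h1]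
    all_goals left; simp [readerReact, onCommTagResp, hp]
  case dataResp s o a =>
    rcases hp : σ.phase with _ | resp | ⟨treq, resp⟩ | ⟨t', v, acks⟩ | v
    case getData =>
      by_cases h1 : o.2 = σ.op
      · obtain ⟨r', op⟩ := o
        obtain rfl : op = σ.op := h1
        refine .inr (.inr (.inr (.inl ⟨s, r', a, treq, resp, rfl, rfl, ?_⟩)))
        by_cases h2 : P.f₁ + P.k ≤ numServers ((s, a) :: resp)
        · rcases h3 : (candidates P ((s, a) :: resp)).argmax Prod.fst with _ | ⟨t, v⟩
          · refine .inl ⟨?_, by simp [readerReact, onDataResp, hp, h2, h3]⟩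
            simp [List.argmax_eq_none.1 h3]
          · refine .inr ⟨t, v, List.argmax_mem h3, ?_, fun s' => ?_⟩
            · simp [readerReact, onDataResp, hp, h2, h3]
            · simp [readerReact, onDataResp, hp, h2, h3, mem_toEdge]
        · exact .inl ⟨fun h => h2 h.1, by simp [readerReact, onDataResp, hp, h2]⟩
      · left; simp [readerReact, onDataResp, hp, h1]
    all_goals left; simp [readerReact, onDataResp, hp]
  case ackRead s o =>
    rcases hp : σ.phase with _ | resp | ⟨treq, resp⟩ | ⟨t', v, acks⟩ | v
    case putTag =>
      by_cases h1 : o.2 = σ.op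
      · obtain ⟨r', op⟩ := o
        obtain rfl : op = σ.op := h1
        refine .inr (.inr (.inr (.inr ⟨s, r', t', v, acks, rfl, rfl, ?_⟩)))
        by_cases h2 : P.f₁ + P.k ≤ (insert s acks).card
        · exact .inr (by simp [readerReact, onAckRead, hp, h2])
        · exact .inl ⟨not_le.1 h2, by simp [readerReact, onAckRead, hp, h2]⟩
      · left; simp [readerReact, onAckRead, hp, h1]
    all_goals left; simp [readerReact, onAckRead, hp]
  all_goals exact .inl rfl

/-- The servers whose answers are recorded in the current phase of a reader. -/
def ReaderPhase.servers : ReaderPhase P → Finset (Fin P.n₁)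
  | .getCommTag resp => (resp.map Prod.fst).toFinset
  | .getData _ resp => (resp.map Prod.fst).toFinset
  | .putTag _ _ acks => acks
  | _ => ∅

/-- The answers that a reader needs to end its current phase have not arrived. -/
def ReaderPhase.Waiting : ReaderPhase P → Prop
  | .getData _ resp => ¬ (P.f₁ + P.k ≤ numServers resp ∧ candidates P resp ≠ [])
  | p => p.servers.card < P.f₁ + P.k

theorem ReaderPhase.waiting_of_servers_eq_empty {p : ReaderPhase P} (h : p.servers = ∅) :
    p.Waiting := by
  have hk := P.code.one_le_k
  cases p <;> simp only [ReaderPhase.Waiting, h, Finset.card_empty] <;> try omega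
  rintro ⟨h', -⟩
  simp only [ReaderPhase.servers] at h
  simp only [numServers, h, Finset.card_empty] at h'
  omega

/-! ### The counting phases of a read -/

namespace Execution

variable (E : Execution P R)

/-- A reader tests its condition whenever it records an answer, so a satisfied condition is never
found in a state. In the get-data phase, `f₁ + k` answers together with one candidate are therefore
contradictory. -/
theorem reader_waiting (n : ℕ) (r : R) : ((E.conf n).readers r).phase.Waiting := by
  induction n with
  | zero =>
    rw [E.conf_zero]
    exact ReaderPhase.waiting_of_servers_eq_empty rfl
  | succ n ih =>
    rcases (E.transition n).reader_eq r with h | ⟨e, -, -, -, h⟩ <;> rw [h]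
    · exact ih
    rcases readerReact_cases r ((E.conf n).readers r) e with h | ⟨_, -, h⟩ |
      ⟨_, _, _, _, -, -, ⟨h', h⟩ | ⟨h, -⟩⟩ | ⟨_, _, _, _, _, -, -, ⟨h', h⟩ | ⟨_, _, -, h, -⟩⟩ |
      ⟨_, _, _, _, _, -, -, ⟨h', h⟩ | h⟩ <;> rw [h]
    · exact ih
    · exact ReaderPhase.waiting_of_servers_eq_empty rfl
    · exact h'
    · exact ReaderPhase.waiting_of_servers_eq_empty rfl
    · exact h'
    · exact ReaderPhase.waiting_of_servers_eq_empty rfl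
    · exact h'
    · exact ReaderPhase.waiting_of_servers_eq_empty rfl

/-- An incomplete read of a non-faulty reader remains its current operation. -/
theorem reader_stays (hwf : E.WellFormed) {r : R} (hr : ¬ E.Faulty (.reader r)) {n : ℕ}
    (hn : ¬ ((E.conf n).readers r).phase.Free)
    (hnever : ∀ m > n, ((E.conf m).readers r).op = ((E.conf n).readers r).op →
      ∀ v, ((E.conf m).readers r).phase ≠ .returned v) {m : ℕ} (hm : n ≤ m) :
    ((E.conf m).readers r).op = ((E.conf n).readers r).op ∧
      ¬ ((E.conf m).readers r).phase.Free := by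
  induction m, hm using Nat.le_induction with
  | base => exact ⟨rfl, hn⟩
  | succ m hm ih =>
    have hnever := hnever (m + 1) (by omega)
    rcases E.reader_local_step m hr with h | ⟨e, ha, -, hd, h⟩ <;> rw [h] at hnever ⊢
    · exact ih
    rcases readerReact_cases r ((E.conf m).readers r) e with h | ⟨r', rfl, h⟩ |
      ⟨_, _, _, _, -, -, ⟨-, h⟩ | ⟨h, -⟩⟩ | ⟨_, _, _, _, _, -, -, ⟨-, h⟩ | ⟨_, _, -, h, -⟩⟩ |
      ⟨_, _, _, _, _, -, -, ⟨-, h⟩ | h⟩ <;> rw [h] at hnever ⊢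
    · exact ih
    · cases hd
      exact absurd (hwf.2 m r (.inl ha)) ih.2
    · exact ⟨ih.1, by simp [ReaderPhase.Free]⟩
    · exact ⟨ih.1, by simp [ReaderPhase.Free]⟩
    · exact ⟨ih.1, by simp [ReaderPhase.Free]⟩
    · exact ⟨ih.1, by simp [ReaderPhase.Free]⟩
    · exact ⟨ih.1, by simp [ReaderPhase.Free]⟩
    · exact absurd rfl (hnever ih.1 _)

/-- The get-committed-tag phase of a read of a non-faulty reader ends. -/
theorem exists_getData (hwf : E.WellFormed) (hrel : E.Reliable)
    (hcrash₁ : {s : Fin P.n₁ | E.Faulty (.edge s)}.ncard ≤ P.f₁)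
    {r : R} (hr : ¬ E.Faulty (.reader r)) {n : ℕ} {resp : List (Fin P.n₁ × Tag W)}
    (hn : ((E.conf n).readers r).phase = .getCommTag resp)
    (hsent : ∀ s, .queryCommTag (r, ((E.conf n).readers r).op) s ∈ (E.conf n).net) :
    ∃ m ≥ n, ∃ t, ((E.conf (m + 1)).readers r).op = ((E.conf n).readers r).op ∧
      ((E.conf (m + 1)).readers r).phase = .getData t [] ∧
      ∀ s, .queryData (r, ((E.conf n).readers r).op) s t ∈ (E.conf (m + 1)).net := by
  by_contra hcon
  set j := ((E.conf n).readers r).op with hj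
  have hstep : ∀ m ≥ n, (((E.conf m).readers r).op = j ∧
      ∃ resp, ((E.conf m).readers r).phase = .getCommTag resp) →
      (((E.conf (m + 1)).readers r).op = j ∧
      ∃ resp, ((E.conf (m + 1)).readers r).phase = .getCommTag resp) ∧
      ((E.conf m).readers r).phase.servers ⊆ ((E.conf (m + 1)).readers r).phase.servers ∧
      ∀ s t, E.act m = .run (.receive (.commTagResp s (r, j) t)) →
        s ∈ ((E.conf (m + 1)).readers r).phase.servers := by
    rintro m hm ⟨h1, resp₁, h2⟩
    have hreact : ∀ e, e.proc P = .reader r → E.act m = .run e → e.Enabled P (E.conf m) →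
        (((readerReact r ((E.conf m).readers r) e).state.op = j ∧
      ∃ resp, (readerReact r ((E.conf m).readers r) e).state.phase = .getCommTag resp) ∧
      ((E.conf m).readers r).phase.servers ⊆
        (readerReact r ((E.conf m).readers r) e).state.phase.servers ∧
      ∀ s t, e = .receive (.commTagResp s (r, j) t) →
        s ∈ (readerReact r ((E.conf m).readers r) e).state.phase.servers) := by
      intro e hd ha he
      rcases readerReact_cases r ((E.conf m).readers r) e with h3 | ⟨r', rfl, -⟩ |
        ⟨s', r', t', resp, rfl, h3, ⟨h', h4⟩ | ⟨h4, h6⟩⟩ |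
        ⟨_, _, _, _, _, -, h3, -⟩ | ⟨_, _, _, _, _, -, h3, -⟩
      · rw [h3]
        refine ⟨⟨h1, resp₁, h2⟩, subset_rfl, ?_⟩
        rintro s t rfl
        exfalso
        simp only [readerReact, onCommTagResp, h2, h1] at h3
        have h6 := congrArg ReaderState.phase h3
        by_cases h5 : P.f₁ + P.k ≤ numServers ((s, t) :: resp₁)
        · simp [h5, h2] at h6
        · simp [h5, h2] at h6
      · cases hd
        have := hwf.2 m r (.inl ha)
        simp [h2, ReaderPhase.Free] at this
      · rw [h4]
        refine ⟨⟨h1, _, rfl⟩, ?_, ?_⟩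
        · rw [h3]; simp [ReaderPhase.servers]
        · intro s t h
          simp only [Event.receive.injEq, Msg.commTagResp.injEq] at h
          obtain ⟨rfl, -⟩ := h
          simp [ReaderPhase.servers]
      · obtain rfl : r' = r := by simpa [Event.proc, Msg.dest] using hd
        obtain ⟨h7, h8⟩ := E.run_reader ha rfl
        rw [h4] at h7
        exact absurd ⟨m, hm, _, by rw [h7]; exact h1, by rw [h7],
          fun s => by rw [← h1]; exact h8 _ (Multiset.mem_add.2 (.inr (h6 s)))⟩ hcon
      · simp [h2] at h3
      · simp [h2] at h3
    rcases E.reader_local_step m hr with h | ⟨e, ha, he, hd, h⟩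
    · rw [h]
      refine ⟨⟨h1, resp₁, h2⟩, subset_rfl, fun s t ha => ?_⟩
      obtain ⟨-, -, h3⟩ := hreact _ rfl ha (E.mem_net_of_run ha)
      rw [← (E.run_reader ha rfl).1, h] at h3
      exact h3 s t rfl
    · rw [h]
      obtain ⟨h3, h4, h5⟩ := hreact e hd ha he
      exact ⟨h3, h4, fun s t h6 => h5 s t (by rw [ha] at h6; simpa using h6)⟩
  have hall : ∀ m ≥ n, ((E.conf m).readers r).op = j ∧
      ∃ resp, ((E.conf m).readers r).phase = .getCommTag resp := by
    intro m hm
    induction m, hm using Nat.le_induction with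
    | base => exact ⟨rfl, resp, hn⟩
    | succ m hm ih => exact (hstep m hm ih).1
  obtain ⟨m, -, -, hm⟩ := E.exists_quorum hcrash₁ (n₀ := 0)
    (g := fun m => ((E.conf (n + m)).readers r).phase.servers)
    (monotone_nat_of_le_succ fun m => (hstep (n + m) (by omega) (hall _ (by omega))).2.1)
    (fun s hs => by
      obtain ⟨n₁, h1, h2⟩ := hrel _ _ (hsent s) hs
      have h3 := (E.run_edge h2 rfl).2 (.commTagResp s (r, j) _)
        (by simp only [edgeReact, onQueryCommTag, zero_add, Multiset.mem_singleton]; rfl)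
      obtain ⟨n₂, h4, h5⟩ := hrel _ _ h3 hr
      refine ⟨n₂ + 1 - n, ?_⟩
      rw [show n + (n₂ + 1 - n) = n₂ + 1 by omega]
      exact (hstep n₂ (by omega) (hall _ (by omega))).2.2 s _ h5)
  obtain ⟨-, resp', h⟩ := hall (n + m) (by omega)
  have h' := E.reader_waiting (n + m) r
  rw [h] at h' hm
  exact absurd hm (not_le.2 h')

/-- The put-tag phase of a read of a non-faulty reader ends. -/
theorem exists_returned (hwf : E.WellFormed) (hrel : E.Reliable)
    (hcrash₁ : {s : Fin P.n₁ | E.Faulty (.edge s)}.ncard ≤ P.f₁)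
    {r : R} (hr : ¬ E.Faulty (.reader r)) {n : ℕ} {t : Tag W} {v : P.Val}
    {acks : Finset (Fin P.n₁)} (hn : ((E.conf n).readers r).phase = .putTag t v acks)
    (hsent : ∀ s, .putTag (r, ((E.conf n).readers r).op) s t ∈ (E.conf n).net) :
    ∃ m > n, ((E.conf m).readers r).op = ((E.conf n).readers r).op ∧
      ∃ v, ((E.conf m).readers r).phase = .returned v := by
  by_contra hcon
  set j := ((E.conf n).readers r).op with hj
  have hstay : ∀ m ≥ n, ((E.conf m).readers r).op = j ∧ ¬ ((E.conf m).readers r).phase.Free :=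
    fun m hm => E.reader_stays hwf hr (by rw [hn]; simp [ReaderPhase.Free])
      (fun m hm ho v hv => hcon ⟨m, hm, ho, v, hv⟩) hm
  have hstep : ∀ m ≥ n, (∃ acks, ((E.conf m).readers r).phase = .putTag t v acks) →
      (∃ acks, ((E.conf (m + 1)).readers r).phase = .putTag t v acks) ∧
      ((E.conf m).readers r).phase.servers ⊆ ((E.conf (m + 1)).readers r).phase.servers ∧
      ∀ s, E.act m = .run (.receive (.ackRead s (r, j))) →
        s ∈ ((E.conf (m + 1)).readers r).phase.servers := by
    rintro m hm ⟨acks, hp⟩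
    have hfree := (hstay (m + 1) (by omega)).2
    have hrecv : ∀ s, E.act m = .run (.receive (.ackRead s (r, j))) →
        s ∈ ((E.conf (m + 1)).readers r).phase.servers := by
      intro s ha
      have h3 := (E.run_reader ha rfl).1
      have h1 := (hstay m hm).1
      by_cases h4 : P.f₁ + P.k ≤ (insert s acks).card
      · simp [h3, readerReact, onAckRead, hp, h4, h1, ReaderPhase.Free] at hfree
      · simp [h3, readerReact, onAckRead, hp, h4, h1, ReaderPhase.servers]
    rcases E.reader_local_step m hr with h | ⟨e, ha, he, hd, h⟩
    · exact ⟨by rw [h]; exact ⟨_, hp⟩, by rw [h], hrecv⟩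
    rcases readerReact_cases r ((E.conf m).readers r) e with h3 | ⟨r', rfl, -⟩ |
      ⟨_, _, _, _, -, h3, -⟩ | ⟨_, _, _, _, _, -, h3, -⟩ |
      ⟨s', _, _, _, acks', -, h3, ⟨-, h4⟩ | h4⟩
    · rw [h3] at h
      exact ⟨by rw [h]; exact ⟨_, hp⟩, by rw [h], hrecv⟩
    · cases hd
      have := hwf.2 m r (.inl ha)
      simp [hp, ReaderPhase.Free] at this
    · simp [hp] at h3
    · simp [hp] at h3
    · rw [hp] at h3
      cases h3
      refine ⟨by rw [h, h4]; exact ⟨_, rfl⟩, ?_, hrecv⟩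
      rw [h, h4, hp]; exact Finset.subset_insert _ _
    · rw [h, h4] at hfree
      simp [ReaderPhase.Free] at hfree
  have hall : ∀ m ≥ n, ∃ acks, ((E.conf m).readers r).phase = .putTag t v acks := by
    intro m hm
    induction m, hm using Nat.le_induction with
    | base => exact ⟨_, hn⟩
    | succ m hm ih => exact (hstep m hm ih).1
  obtain ⟨m, -, -, hm⟩ := E.exists_quorum hcrash₁ (n₀ := 0)
    (g := fun i => ((E.conf (n + i)).readers r).phase.servers)
    (monotone_nat_of_le_succ fun i => (hstep (n + i) (by omega) (hall _ (by omega))).2.1)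
    (fun s hs => by
      obtain ⟨n₁, h1, h2⟩ := hrel _ _ (hsent s) hs
      have h3 := (E.run_edge h2 rfl).2 (.ackRead s (r, j)) (by
        simp only [edgeReact, onPutTag]
        (repeat' split) <;> simp)
      obtain ⟨n₂, h5, h6⟩ := hrel _ _ h3 hr
      refine ⟨n₂ + 1 - n, ?_⟩
      rw [show n + (n₂ + 1 - n) = n₂ + 1 by omega]
      exact (hstep n₂ (by omega) (hall _ (by omega))).2.2 s h6)
  obtain ⟨acks', h⟩ := hall (n + m) (by omega)
  have h' := E.reader_waiting (n + m) r
  rw [h] at h' hm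
  exact absurd hm (not_le.2 h')

/-- The answers recorded by a reader in the get-data phase. -/
def answers (n : ℕ) (r : R) : Answers P :=
  match ((E.conf n).readers r).phase with
  | .getData _ resp => resp
  | _ => []

/-- A non-faulty reader that does not leave the get-data phase records all answers. -/
theorem answers_succ (hwf : E.WellFormed) {r : R} (hr : ¬ E.Faulty (.reader r)) {m : ℕ}
    {treq : Tag W} (hp : ∃ resp, ((E.conf m).readers r).phase = .getData treq resp)
    (hp' : ∃ resp, ((E.conf (m + 1)).readers r).phase = .getData treq resp) :
    E.answers m r ⊆ E.answers (m + 1) r ∧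
    ∀ s a, E.act m = .run (.receive (.dataResp s (r, ((E.conf m).readers r).op) a)) →
        (s, a) ∈ E.answers (m + 1) r := by
  obtain ⟨resp, hp⟩ := hp
  obtain ⟨resp', hp'⟩ := hp'
  constructor
  · rcases E.reader_local_step m hr with h | ⟨e, ha, he, hd, h⟩
    · simp [answers, h]
    rcases readerReact_cases r ((E.conf m).readers r) e with h3 | ⟨r', rfl, -⟩ |
      ⟨_, _, _, _, -, h3, -⟩ | ⟨_, _, _, _, _, -, h3, ⟨-, h4⟩ | ⟨_, _, -, h4, -⟩⟩ |
      ⟨s', _, _, _, acks', -, h3, -⟩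
    · simp [answers, h, h3]
    · cases hd
      have := hwf.2 m r (.inl ha)
      simp [hp, ReaderPhase.Free] at this
    · simp [hp] at h3
    · rw [h3] at hp
      cases hp
      simp [answers, h, h4, h3]
    · simp [h, h4] at hp'
    · simp [hp] at h3
  · intro s a ha
    have h1 := (E.run_reader ha rfl).1
    simp only [readerReact, onDataResp, hp, if_true] at h1
    split at h1
    · split at h1
      · simp [h1] at hp'
      · simp [answers, h1]
    · simp [answers, h1]

end Execution

/-! ## Tags that belong to reads -/

/-- The tag of an answer, if there is one, lies in `D`. -/
def DataResp.In {T V C : Type*} (D : Set T) : DataResp T V C → Prop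
  | .value t _ => t ∈ D
  | .coded t _ => t ∈ D
  | .failed => True

theorem mem_of_mem_candidates {D : Set (Tag W)} {resp : Answers P} (h : ∀ a ∈ resp, a.2.In D)
    {t : Tag W} {v : P.Val} (hc : (t, v) ∈ candidates P resp) : t ∈ D := by
  simp only [candidates, List.mem_append, List.mem_filterMap] at hc
  rcases hc with ⟨⟨s, a⟩, ha, hc⟩ | ⟨⟨s, a⟩, ha, hc⟩
  all_goals
    have := h _ ha
    rcases a with ⟨t', v'⟩ | ⟨t', c⟩ | _ <;> simp only [reduceCtorEq] at hc
  · cases hc; exact this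
  · split at hc
    · cases hc; exact this
    · cases hc

/-- The tags recorded by a reader lie in `D`. -/
def ReaderPhase.In (D : Set (Tag W)) : ReaderPhase P → Prop
  | .getCommTag resp => ∀ a ∈ resp, a.2 ∈ D
  | .getData treq resp => treq ∈ D ∧ ∀ a ∈ resp, a.2.In D
  | .putTag t _ _ => t ∈ D
  | _ => True

/-- The tags in `L2` and in the messages and states that belong to reads lie in `D`. -/
structure TagsIn (D : Set (Tag W)) (c : Config P R) : Prop where
  back : ∀ i, (c.backs i).tag ∈ D
  helperElem : ∀ i s o t h, .helperElem i s o t h ∈ c.net → t ∈ D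
  helpers : ∀ s o, ∀ a ∈ (c.edges s).helpers o, a.2.1 ∈ D
  commTagResp : ∀ s o t, .commTagResp s o t ∈ c.net → t ∈ D
  reader : ∀ r, (c.readers r).phase.In D
  queryData : ∀ o s t, .queryData o s t ∈ c.net → t ∈ D
  dataResp : ∀ s o a, .dataResp s o a ∈ c.net → a.In D
  putTag : ∀ o s t, .putTag o s t ∈ c.net → t ∈ D

/-- Tags circulate from committed tags of `L1` to `L2`, back through helper data to readers, and on
in QUERY-DATA and PUT-TAG. Each hop copies a tag, selects one, or takes one that is bounded by a
committed tag; only the last needs `D` to be a lower set. The committed tags after the step enter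
because a served tag may have been committed in this very step. -/
theorem TagsIn.transition {D : Set (Tag W)} (hD : IsLowerSet D) (h₀ : P.t₀ ∈ D) {c c' : Config P R}
    {a : Action P R} (ht : Transition c a c') (hw : WritesCommitted c)
    (htc : ∀ s, (c.edges s).tc ∈ D) (htc' : ∀ s, (c'.edges s).tc ∈ D) (hc : TagsIn D c) :
    TagsIn D c' := by
  have hreader : ∀ r, (c'.readers r).phase.In D := by
    intro r
    have hr := hc.reader r
    rcases ht.reader_eq r with h | ⟨e, -, he, -, h⟩ <;> rw [h]
    · exact hr
    rcases readerReact_cases r (c.readers r) e with h | ⟨_, -, h⟩ |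
      ⟨s, r', t, resp, rfl, hp, h⟩ | ⟨s, r', a, treq, resp, rfl, hp, h⟩ |
      ⟨_, _, _, _, _, -, hp, ⟨-, h⟩ | h⟩
    · rw [h]; exact hr
    · rw [h]; simp [ReaderPhase.In]
    · rw [hp] at hr
      have h1 : ∀ a ∈ (s, t) :: resp, a.2 ∈ D := by
        intro a ha
        rcases List.mem_cons.1 ha with rfl | ha
        · exact hc.commTagResp _ _ _ he
        · exact hr a ha
      rcases h with ⟨-, h⟩ | ⟨h, -⟩ <;> rw [h]
      · exact h1
      · exact ⟨maxTag_mem h₀ h1, by simp⟩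
    · rw [hp] at hr
      have h1 : ∀ b ∈ (s, a) :: resp, b.2.In D := by
        intro b hb
        rcases List.mem_cons.1 hb with rfl | hb
        · exact hc.dataResp _ _ _ he
        · exact hr.2 b hb
      rcases h with ⟨-, h⟩ | ⟨t, v, h2, h, -⟩ <;> rw [h]
      · exact ⟨hr.1, h1⟩
      · exact mem_of_mem_candidates h1 h2
    · rw [h]; rw [hp] at hr; exact hr
    · rw [h]; trivial
  refine ⟨fun i => ?_, fun i s o t h hm => ?_, fun s o b hb => ?_, fun s o t hm => ?_, hreader,
    fun o s t hm => ?_, fun s o b hm => ?_, fun o s t hm => ?_⟩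
  · rcases ht.back_eq i with h | ⟨m, hm, hd, h⟩ <;> rw [h]
    · exact hc.back i
    rw [tag_backReact]
    split
    · rcases max_choice (c.backs i).tag _ with h' | h' <;> rw [h']
      · exact hc.back i
      -- A tag stored anew in `L2` is at most the committed tag of the server that wrote it.
      · exact hD (hw.1 _ _ _ _ hm) (htc _)
    · exact hc.back i
  · rcases ht.origin hm with h1 | ⟨s, m, -, -, -, h1, -⟩ | ⟨i, m, hm, -, h1⟩ |
      ⟨w, e, -, -, -, h1, -⟩ | ⟨r, e, -, -, -, h1, -⟩
    · exact hc.helperElem _ _ _ _ _ h1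
    · exact h1.elim
    · obtain ⟨rfl, rfl, -⟩ := h1; exact hc.back _
    all_goals exact h1.elim
  · rcases ht.edge_eq s with h | ⟨m, hm, -, h⟩ <;> rw [h] at hb
    · exact hc.helpers s o b hb
    have h1 := helpers_edgeReact s (c.edges s) m o
    split at h1
    · split at h1
      · rename_i ho
        subst ho
        rw [h1] at hb
        split at hb
        · simp at hb
        · rcases List.mem_cons.1 hb with rfl | hb
          · exact hc.helperElem _ _ _ _ _ hm
          · exact hc.helpers s _ b hb
      · rw [h1] at hb; exact hc.helpers s o b hb
    · rw [h1] at hb; exact hc.helpers s o b hb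
  · rcases ht.origin hm with h1 | ⟨s, m, -, -, -, h1, -⟩ | ⟨i, m, hm, -, h1⟩ |
      ⟨w, e, -, -, -, h1, -⟩ | ⟨r, e, -, -, -, h1, -⟩
    · exact hc.commTagResp _ _ _ h1
    · obtain ⟨rfl, rfl⟩ := h1; exact htc _
    all_goals exact h1.elim
  · rcases ht.origin hm with h1 | ⟨s, m, -, -, -, h1, -⟩ | ⟨i, m, hm, -, h1⟩ |
      ⟨w, e, -, -, -, h1, -⟩ | ⟨r, e, -, -, -, h1, -⟩
    · exact hc.queryData _ _ _ h1
    · exact h1.elim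
    · exact h1.elim
    · exact h1.elim
    · obtain ⟨-, -, -, h1⟩ := h1
      have := hreader r
      rw [h1] at this
      exact this.1
  · rcases ht.origin hm with h1 | ⟨s, m, hm', hd, -, h1, -⟩ | ⟨i, m, hm, -, h1⟩ |
      ⟨w, e, -, -, -, h1, -⟩ | ⟨r, e, -, -, -, h1, -⟩
    · exact hc.dataResp _ _ _ h1
    · rcases b with ⟨t, v⟩ | ⟨t, x⟩ | _
      · obtain ⟨rfl, h1 | h1⟩ := h1
        · exact hD h1 (htc' _)
        · cases m <;> simp only at h1
          obtain ⟨rfl, rfl⟩ := h1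
          exact hc.queryData _ _ _ hm'
      · obtain ⟨rfl, h1⟩ := h1
        cases m <;> simp only at h1
        rcases h1 with rfl | ⟨b, hb, rfl⟩
        · exact hc.helperElem _ _ _ _ _ hm'
        · exact hc.helpers _ _ b hb
      · trivial
    all_goals exact h1.elim
  · rcases ht.origin hm with h1 | ⟨s, m, -, -, -, h1, -⟩ | ⟨i, m, hm, -, h1⟩ |
      ⟨w, e, -, -, -, h1, -⟩ | ⟨r, e, -, -, -, h1, -⟩
    · exact hc.putTag _ _ _ h1
    · exact h1.elim
    · exact h1.elim
    · exact h1.elim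
    · obtain ⟨-, -, v, h1⟩ := h1
      have := hreader r
      rw [h1] at this
      exact this

/-- The read operation `o` has not yet entered its get-data phase. -/
def NotYet (c : Config P R) (o : ReadOp R) : Prop :=
  (c.readers o.1).op < o.2 ∨
    ((c.readers o.1).op = o.2 ∧ ∃ resp, (c.readers o.1).phase = .getCommTag resp)

/-- The read operation `o` is in its get-data phase, with requested tag `treq`. -/
def GettingData (c : Config P R) (o : ReadOp R) (treq : Tag W) : Prop :=
  (c.readers o.1).op = o.2 ∧ ∃ resp, (c.readers o.1).phase = .getData treq resp

/-- Operation numbers do not decrease and the phases of one operation occur in order, so this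
property, once lost, is lost forever. -/
theorem notYet_of_transition {c c' : Config P R} {a : Action P R} {o : ReadOp R}
    (ht : Transition c a c') (h : NotYet c' o) : NotYet c o := by
  unfold NotYet at *
  rcases ht.reader_eq o.1 with h1 | ⟨e, -, he, -, h1⟩ <;> rw [h1] at h
  · exact h
  rcases readerReact_cases o.1 (c.readers o.1) e with h2 | ⟨_, -, h2⟩ |
      ⟨s, r', t, resp, -, hp, ⟨-, h2⟩ | ⟨h2, -⟩⟩ |
      ⟨s, r', a, treq, resp, -, hp, ⟨-, h2⟩ | ⟨t, v, -, h2, -⟩⟩ |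
      ⟨_, _, _, _, _, -, hp, ⟨-, h2⟩ | h2⟩ <;> rw [h2] at h
  · exact h
  · left
    rcases h with h | ⟨h, -⟩ <;> simp only at h <;> omega
  · exact h.imp id fun h => ⟨h.1, _, hp⟩
  all_goals exact h.imp id fun h => by simpa using h.2

theorem gettingData_of_transition {c c' : Config P R} {a : Action P R} {o : ReadOp R}
    (ht : Transition c a c') {treq : Tag W} (h : GettingData c' o treq) :
    NotYet c o ∨ GettingData c o treq := by
  unfold GettingData NotYet at *
  rcases ht.reader_eq o.1 with h1 | ⟨e, -, he, -, h1⟩ <;> rw [h1] at h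
  · exact .inr h
  rcases readerReact_cases o.1 (c.readers o.1) e with h2 | ⟨_, -, h2⟩ |
      ⟨s, r', t, resp, -, hp, ⟨-, h2⟩ | ⟨h2, -⟩⟩ |
      ⟨s, r', a, treq, resp, -, hp, ⟨-, h2⟩ | ⟨t, v, -, h2, -⟩⟩ |
      ⟨_, _, _, _, _, -, hp, ⟨-, h2⟩ | h2⟩ <;> rw [h2] at h
  · exact .inr h
  · simp at h
  · simp at h
  · exact .inl (.inr ⟨h.1, _, hp⟩)
  · obtain ⟨h3, resp', h4⟩ := h
    simp only [ReaderPhase.getData.injEq] at h4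
    exact .inr ⟨h3, resp, h4.1 ▸ hp⟩
  all_goals simp at h

/-- The messages and registrations of a read are consistent with its progress. -/
structure ReadConsistent (o : ReadOp R) (c : Config P R) : Prop where
  queryData : ∀ s t, .queryData o s t ∈ c.net →
    ¬ NotYet c o ∧ ∀ treq, GettingData c o treq → t = treq
  gamma : ∀ s t, (o, t) ∈ (c.edges s).gamma → ¬ NotYet c o ∧ ∀ treq, GettingData c o treq → t = treq
  putTag : ∀ s t, .putTag o s t ∈ c.net → ¬ NotYet c o ∧ ∀ treq, ¬ GettingData c o treq

/-- Each message arises at a definite stage: QUERY-DATA on entering the get-data phase with its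
requested tag, PUT-TAG on leaving that phase. Since stages are not revisited, a pending get-data
phase excludes PUT-TAG messages and fixes the tag of every registration. -/
theorem ReadConsistent.transition {c c' : Config P R} {a : Action P R} {o : ReadOp R}
    (ht : Transition c a c') (hc : ReadConsistent o c) : ReadConsistent o c' := by
  have lift : ∀ t, (¬ NotYet c o ∧ ∀ treq, GettingData c o treq → t = treq) →
      (¬ NotYet c' o ∧ ∀ treq, GettingData c' o treq → t = treq) := fun t ⟨h1, h2⟩ =>
    ⟨fun h => h1 (notYet_of_transition ht h), fun treq h =>
      h2 treq ((gettingData_of_transition ht h).resolve_left h1)⟩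
  refine ⟨fun s t hm => ?_, fun s t hg => ?_, fun s t hm => ?_⟩
  · rcases ht.origin hm with h1 | ⟨s, m, -, -, -, h1, -⟩ | ⟨i, m, hm, -, h1⟩ |
      ⟨w, e, -, -, -, h1, -⟩ | ⟨r, e, -, -, -, h1, -⟩
    · exact lift t (hc.queryData s t h1)
    · exact h1.elim
    · exact h1.elim
    · exact h1.elim
    · obtain ⟨rfl, h1, -, h2⟩ := h1
      refine ⟨?_, ?_⟩
      · rintro (h | ⟨-, resp, h⟩)
        · simp [h1] at h
        · simp [h2] at h
      · rintro treq ⟨-, resp, h⟩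
        simp only [h2, ReaderPhase.getData.injEq] at h
        exact h.1
  · rcases ht.edge_eq s with h | ⟨m, hm, hd, h⟩ <;> rw [h] at hg
    · exact lift t (hc.gamma s t hg)
    rcases gamma_edgeReact m hg with h1 | h1
    · exact lift t (hc.gamma s t h1)
    · cases m <;> simp only [Prod.mk.injEq] at h1
      obtain ⟨rfl, rfl⟩ := h1
      exact lift t (hc.queryData _ t hm)
  · rcases ht.origin hm with h1 | ⟨s, m, -, -, -, h1, -⟩ | ⟨i, m, hm, -, h1⟩ |
      ⟨w, e, -, -, -, h1, -⟩ | ⟨r, e, -, -, -, h1, -⟩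
    · obtain ⟨h1, h2⟩ := hc.putTag s t h1
      exact ⟨fun h => h1 (notYet_of_transition ht h), fun treq h =>
        h2 treq ((gettingData_of_transition ht h).resolve_left h1)⟩
    · exact h1.elim
    · exact h1.elim
    · exact h1.elim
    · obtain ⟨rfl, h1, v, h2⟩ := h1
      refine ⟨?_, ?_⟩
      · rintro (h | ⟨-, resp, h⟩)
        · simp [h1] at h
        · simp [h2] at h
      · rintro treq ⟨-, resp, h⟩
        simp [h2] at h

namespace Execution

variable (E : Execution P R)

/-- As long as all committed tags lie in `D`, so do all tags that belong to reads. -/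
theorem tagsIn {D : Set (Tag W)} (hD : IsLowerSet D) (h₀ : P.t₀ ∈ D) {N : ℕ}
    (htc : ∀ n ≤ N, ∀ s, ((E.conf n).edges s).tc ∈ D) {n : ℕ} (hn : n ≤ N) :
    TagsIn D (E.conf n) := by
  induction n with
  | zero =>
    rw [E.conf_zero]
    constructor <;> simp [Config.init, EdgeState.init, BackState.init, ReaderPhase.In, h₀]
  | succ n ih =>
    exact (ih (by omega)).transition hD h₀ (E.transition n) (E.writesCommitted n)
      (htc n (by omega)) (htc _ hn)

theorem readConsistent (o : ReadOp R) (n : ℕ) : ReadConsistent o (E.conf n) :=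
  E.invariant (by constructor <;> simp [Config.init, EdgeState.init])
    (fun _ _ _ h hc => hc.transition h) n

end Execution

/-! ## Counting messages -/

/-- The number of messages of a given kind. -/
def num (p : Message P R → Bool) (M : Multiset (Message P R)) : ℕ := M.countP fun m => p m = true

theorem num_add (p : Message P R → Bool) (M N : Multiset (Message P R)) :
    num p (M + N) = num p M + num p N := Multiset.countP_add _ _ _

theorem num_mono (p : Message P R → Bool) {M N : Multiset (Message P R)} (h : M ≤ N) :
    num p M ≤ num p N := Multiset.countP_le_of_le _ h

theorem num_eq_zero {p : Message P R → Bool} {M : Multiset (Message P R)}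
    (h : ∀ m ∈ M, p m = false) : num p M = 0 :=
  Multiset.countP_eq_zero.2 fun m hm => by simp [h m hm]

theorem num_pos {p : Message P R → Bool} {M : Multiset (Message P R)} :
    0 < num p M ↔ ∃ m ∈ M, p m = true := Multiset.countP_pos

theorem num_erase (p : Message P R → Bool) {M : Multiset (Message P R)} {m : Message P R}
    (h : m ∈ M) : num p (M.erase m) + (if p m then 1 else 0) = num p M := by
  conv_rhs => rw [← Multiset.cons_erase h]
  simp [num, Multiset.countP_cons]

theorem num_channels_le (p : Message P R → Bool) {c : Config P R} (e : Event P R) :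
    num p (e.channels P c) ≤ num p c.net := by
  cases e
  case receive m => exact num_mono p (Multiset.erase_le _ _)
  all_goals exact le_rfl

theorem num_map_le_one {n : ℕ} {p : Message P R → Bool} {f : Fin n → Message P R}
    (h : ∀ i j, p (f i) = true → p (f j) = true → i = j) :
    num p ((Finset.univ : Finset (Fin n)).val.map f) ≤ 1 := by
  rw [num, Multiset.countP_map]
  have : (Multiset.filter (fun a => p (f a) = true) (Finset.univ : Finset (Fin n)).val).card =
    (Finset.univ.filter fun a => p (f a) = true).card := rfl
  rw [this, Finset.card_le_one]
  simp only [Finset.mem_filter]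
  exact fun a ha b hb => h a b ha.2 hb.2

/-- WRITE-CODE-ELEM messages from `s` to `i` for the tag `t`. -/
def isWrite (s : Fin P.n₁) (i : Fin P.n₂) (t : Tag W) : Message P R → Bool
  | .writeCodeElem s' i' t' _ => decide (s' = s ∧ i' = i ∧ t' = t)
  | _ => false

/-- ACK-CODE-ELEM messages from `i` to `s` for the tag `t`. -/
def isWriteAck (s : Fin P.n₁) (i : Fin P.n₂) (t : Tag W) : Message P R → Bool
  | .ackCodeElem i' s' t' => decide (s' = s ∧ i' = i ∧ t' = t)
  | _ => false

/-- QUERY-DATA messages of the read `o` to `s`. -/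
def isQueryData (s : Fin P.n₁) (o : ReadOp R) : Message P R → Bool
  | .queryData o' s' _ => decide (s' = s ∧ o' = o)
  | _ => false

/-- QUERY-CODE-ELEM messages from `s` to `i` for the read `o`. -/
def isQueryCode (s : Fin P.n₁) (i : Fin P.n₂) (o : ReadOp R) : Message P R → Bool
  | .queryCodeElem s' i' o' => decide (s' = s ∧ i' = i ∧ o' = o)
  | _ => false

/-- SEND-HELPER-ELEM messages from `i` to `s` for the read `o`. -/
def isHelper (s : Fin P.n₁) (i : Fin P.n₂) (o : ReadOp R) : Message P R → Bool
  | .helperElem i' s' o' _ _ => decide (s' = s ∧ i' = i ∧ o' = o)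
  | _ => false

/-- An action performs write-to-L2 at most once, and this sends one message to each server of `L2`.
-/
theorem num_isWrite_rest_le (s s' : Fin P.n₁) (i : Fin P.n₂) (t : Tag W) (σ : EdgeState P R)
    (m : Message P R) : num (isWrite s i t) (edgeReact s' σ m).rest ≤ 1 := by
  have hw : ∀ t' v, num (isWrite s i t) (writeToL2 P s' t' v : Multiset (Message P R)) ≤ 1 :=
    fun t' v => num_map_le_one fun a b ha hb => by
      simp only [isWrite, decide_eq_true_eq] at ha hb
      exact ha.2.1.trans hb.2.1.symm
  have hs : ∀ (σ' : EdgeState P R) t' v, num (isWrite s i t) (serve P s' σ' t' v) = 0 :=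
    fun σ' t' v => num_eq_zero fun m hm => by
      obtain ⟨γ, -, -, rfl⟩ := mem_serve.1 hm
      rfl
  have h0 : num (isWrite (R := R) s i t) 0 = 0 := rfl
  have h1 : ∀ m' : Message P R, num (isWrite s i t) {m'} ≤ 1 := fun m' =>
    (Multiset.countP_le_card _ _).trans (by simp)
  have h2 : ∀ a b c, num (isWrite (R := R) s i t) {.ackWrite a b c} = 0 := fun a b c =>
    num_eq_zero fun m hm => by rw [Multiset.mem_singleton.1 hm]; rfl
  have h3 : ∀ a b, num (isWrite (R := R) s i t) {.ackRead a b} = 0 := fun a b =>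
    num_eq_zero fun m hm => by rw [Multiset.mem_singleton.1 hm]; rfl
  have h4 : ∀ o, num (isWrite s i t)
    (toBack P fun i' => (.queryCodeElem s' i' o : Message P R)) = 0 :=
    fun o => num_eq_zero fun m hm => by
      obtain ⟨γ, rfl⟩ := mem_toBack.1 hm
      rfl
  have h5 : ∀ (A : Finset (Fin P.n₁)) src t', num (isWrite s i t)
      (A.val.map fun s'' => (.commitTag src t' s'' : Message P R)) = 0 :=
    fun A src t' => num_eq_zero fun m hm => by
      obtain ⟨a, -, rfl⟩ := Multiset.mem_map.1 hm
      rfl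
  cases m <;> simp only [edgeReact, onQueryTag, onPutData, onQueryCommTag, onQueryData, onPutTag,
    onCommitTag, onAckCodeElem, onHelperElem, broadcastResp] <;> (repeat' split) <;>
    simp only [num_add, hs, h0, h1, h2, h3, h4, h5, hw, zero_add, add_zero, zero_le]

theorem num_isQueryCode_rest_le (s s' : Fin P.n₁) (i : Fin P.n₂) (o : ReadOp R) (σ : EdgeState P R)
    (m : Message P R) : num (isQueryCode s i o) (edgeReact s' σ m).rest ≤ 1 := by
  by_cases hm : ∃ o' x t, m = .queryData o' x t
  · obtain ⟨o', x, t, rfl⟩ := hm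
    have h1 : ∀ m' : Message P R, num (isQueryCode s i o) {m'} ≤ 1 := fun m' =>
      (Multiset.countP_le_card _ _).trans (by simp)
    have h2 : num (isQueryCode s i o)
        (toBack P fun i' => (.queryCodeElem s' i' o' : Message P R)) ≤ 1 :=
      num_map_le_one fun a b ha hb => by
        simp only [isQueryCode, decide_eq_true_eq] at ha hb
        exact ha.2.1.trans hb.2.1.symm
    simp only [edgeReact, onQueryData]
    (repeat' split) <;> simp only [h1, h2]
  · rw [num_eq_zero]
    · omega
    intro m' hm'
    have := edgeSends_of_mem (.inr hm')
    cases m'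
    case queryCodeElem =>
      obtain ⟨-, h⟩ := this
      cases m <;> simp only at h
      exact absurd ⟨_, _, _, rfl⟩ hm
    all_goals rfl

/-- The messages sent by a server of layer `L1`, whether or not it crashes. -/
theorem Outcome.edgeSends {s : Fin P.n₁} {σ σ' : EdgeState P R} {m : Message P R}
    {sent : Multiset (Message P R)} (h : Outcome σ (edgeReact s σ m) σ' sent) {m' : Message P R}
    (hm' : m' ∈ sent) : EdgeSends s σ m σ' m' := by
  rcases h.mem_sent hm' with h1 | ⟨h1, h2⟩
  · obtain ⟨src, t, s', hs', rfl⟩ := first_edgeReact h1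
    exact edgeSends_of_mem (.inl h1)
  · exact h2 ▸ edgeSends_of_mem (.inr h1)

theorem num_first_edgeReact {p : Message P R → Bool} (hp : ∀ a b c, p (.commitTag a b c) = false)
    (s : Fin P.n₁) (σ : EdgeState P R) (m : Message P R) : num p (edgeReact s σ m).first = 0 :=
  num_eq_zero fun m' hm' => by
    obtain ⟨_, _, _, -, rfl⟩ := first_edgeReact hm'
    exact hp _ _ _

theorem Outcome.num_le_rest {s : Fin P.n₁} {σ σ' : EdgeState P R} {m : Message P R}
    {sent : Multiset (Message P R)} (h : Outcome σ (edgeReact s σ m) σ' sent)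
    {p : Message P R → Bool} (hp : ∀ a b c, p (.commitTag a b c) = false) :
    num p sent ≤ num p (edgeReact s σ m).rest := by
  refine (num_mono p h.sent_le).trans ?_
  rw [num_add, num_first_edgeReact hp, zero_add]

/-- Writes of `t` leave a server only in the step in which its committed tag rises to `t`. As
committed tags never decrease, this happens once. -/
theorem Outcome.num_isWrite_le {s s' : Fin P.n₁} {σ σ' : EdgeState P R} {m : Message P R}
    {sent : Multiset (Message P R)} (h : Outcome σ (edgeReact s' σ m) σ' sent) (i : Fin P.n₂)
    (t : Tag W) :
    num (isWrite s i t) sent ≤ if s' = s ∧ σ.tc < t ∧ σ'.tc = t then 1 else 0 := by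
  split
  · exact (h.num_le_rest fun _ _ _ => rfl).trans (num_isWrite_rest_le _ _ _ _ _ _)
  · rename_i hne
    rw [num_eq_zero]
    intro m' hm'
    have h1 := h.edgeSends hm'
    cases m' <;> try rfl
    obtain ⟨rfl, h1⟩ := h1
    simp only [isWrite, decide_eq_false_iff_not]
    rintro ⟨rfl, -, rfl⟩
    exact hne ⟨rfl, h1⟩

theorem Outcome.num_isQueryCode_le {s s' : Fin P.n₁} {σ σ' : EdgeState P R} {m : Message P R}
    {sent : Multiset (Message P R)} (h : Outcome σ (edgeReact s' σ m) σ' sent)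
    (hd : m.dest = .edge s')
    (i : Fin P.n₂) (o : ReadOp R) :
    num (isQueryCode s i o) sent ≤ if isQueryData s o m then 1 else 0 := by
  split
  · exact (h.num_le_rest fun _ _ _ => rfl).trans (num_isQueryCode_rest_le _ _ _ _ _ _)
  · rename_i hne
    rw [num_eq_zero]
    intro m' hm'
    have h1 := h.edgeSends hm'
    cases m' <;> try rfl
    obtain ⟨rfl, h1⟩ := h1
    simp only [isQueryCode, decide_eq_false_iff_not]
    rintro ⟨rfl, -, rfl⟩
    cases m <;> simp only at h1
    cases hd
    exact hne (by simp [isQueryData, h1])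

/-- Messages that no server of layer `L1` sends. -/
theorem Outcome.num_eq_zero_of_edge {s' : Fin P.n₁} {σ σ' : EdgeState P R} {m : Message P R}
    {sent : Multiset (Message P R)} (h : Outcome σ (edgeReact s' σ m) σ' sent)
    {p : Message P R → Bool} (hp : ∀ m', p m' = true → ¬ EdgeSends s' σ m σ' m') :
    num p sent = 0 :=
  num_eq_zero fun m' hm' => by
    by_contra h'
    exact hp m' (by simpa using h') (h.edgeSends hm')

theorem num_rest_backReact_le (p : Message P R → Bool) (i : Fin P.n₂) (σ : BackState P)
    (m : Message P R) : num p (backReact i σ m).rest ≤ 1 := by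
  refine (Multiset.countP_le_card _ _).trans ?_
  cases m <;> simp [backReact, onWriteCodeElem, onQueryCodeElem]

/-! ### Acknowledgments of writes to `L2`, counted by sender -/

/-- Each of the acknowledgments counted by `s` for `t` comes from a different server of layer `L2`,
whose tag is at least `t`; here `g i` is the number of those received from `i`. -/
def WriteQuorum (s : Fin P.n₁) (t : Tag W) (c : Config P R) : Prop :=
  ∃ g : Fin P.n₂ → ℕ, ∑ i, g i = (c.edges s).writeCounter t ∧
    (∀ i, num (isWrite s i t) c.net + num (isWriteAck s i t) c.net + g i ≤ 1) ∧
    (∀ i, 0 < num (isWriteAck s i t) c.net + g i → t ≤ (c.backs i).tag) ∧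
    ((c.edges s).tc < t → ∀ i, num (isWrite s i t) c.net = 0 ∧ num (isWriteAck s i t) c.net = 0 ∧
      g i = 0)

/-- Disposes of the steps that neither send a relevant message nor change the counter; the same `g`
serves again. -/
theorem WriteQuorum.mono {s : Fin P.n₁} {t : Tag W} {c c' : Config P R} (hc : WriteQuorum s t c)
    (h1 : ∀ i, num (isWrite s i t) c'.net ≤ num (isWrite s i t) c.net)
    (h2 : ∀ i, num (isWriteAck s i t) c'.net ≤ num (isWriteAck s i t) c.net)
    (h3 : ∀ i, (c.backs i).tag ≤ (c'.backs i).tag) (h4 : (c.edges s).tc ≤ (c'.edges s).tc)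
    (h5 : (c'.edges s).writeCounter t = (c.edges s).writeCounter t) : WriteQuorum s t c' := by
  obtain ⟨g, g1, g2, g3, g4⟩ := hc
  refine ⟨g, g1.trans h5.symm, fun i => ?_, fun i hi => ?_, fun ht i => ?_⟩
  · have := g2 i; have := h1 i; have := h2 i; omega
  · exact (g3 i (by have := h2 i; omega)).trans (h3 i)
  · have := g4 (h4.trans_lt ht) i; have := h1 i; have := h2 i; omega

/-- For each server of `L2` there is one token: a write in transit, then an acknowledgment in
transit, then a unit of `g`. Tokens are created only when the committed tag reaches `t`, and the tag
of the `L2` server is at least `t` from the second stage on. A crash can only destroy tokens. -/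
theorem WriteQuorum.transition {s : Fin P.n₁} {t : Tag W} {c c' : Config P R} {a : Action P R}
    (ht : Transition c a c') (hc : WriteQuorum s t c) : WriteQuorum s t c' := by
  have htag := ht.tag_le
  have htc := ht.tc_le s
  rcases ht with x | ⟨s', m, σ', sent, x, ha, hm, hd, ho⟩ | ⟨i', m, σ', sent, x, ha, hm, hd, ho⟩ |
    ⟨w, e, σ', sent, x, ha, hm, hd, ho⟩ | ⟨r, e, σ', sent, x, ha, hm, hd, ho⟩
  · exact hc
  · have hA0 : ∀ i, num (isWriteAck s i t) sent = 0 := fun i =>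
      ho.num_eq_zero_of_edge (fun m' h1 h2 => by cases m' <;> simp_all [isWriteAck, EdgeSends])
    have hW0 := fun i => ho.num_isWrite_le (s := s) i t
    have hA := fun i => num_erase (isWriteAck s i t) hm
    have hW := fun i => num_erase (isWrite s i t) hm
    by_cases hs : s' = s
    swap
    · simp only [hs, false_and, if_false] at hW0
      refine hc.mono (fun i => ?_) (fun i => ?_) htag htc ?_
      · have := hW0 i; have := hW i; simp only [num_add]; omega
      · have := hA0 i; have := hA i; simp only [num_add]; omega
      · simp only [Function.update_of_ne (Ne.symm hs)]
    subst hs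
    simp only [true_and] at hW0
    -- The only step that changes the counter for `t`: the acknowledgment from `i₀` leaves the
    -- channel and becomes a unit of `g i₀`.
    by_cases hwc : ∃ i₀, m = .ackCodeElem i₀ s' t ∧ σ' = (edgeReact s' (c.edges s') m).state
    · obtain ⟨i₀, rfl, rfl⟩ := hwc
      obtain ⟨g, g1, g2, g3, g4⟩ := hc
      -- An acknowledgment in transit shows that `t` was committed earlier, so no new writes of `t`
      -- are created here.
      have hpos : ¬ (c.edges s').tc < t := fun h => by
        have := (g4 h i₀).2.1
        have := num_pos.2 ⟨_, hm, (by simp [isWriteAck] : isWriteAck s' i₀ t _ = true)⟩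
        omega
      simp only [hpos, false_and, if_false] at hW0
      refine ⟨Function.update g i₀ (g i₀ + 1), ?_, fun i => ?_, fun i hi => ?_, fun h => ?_⟩
      · simp only [Function.update_self, writeCounter_edgeReact, if_true, ← g1]
        rw [Finset.sum_update_of_mem (Finset.mem_univ _),
          ← Finset.add_sum_erase _ g (Finset.mem_univ i₀), Finset.sdiff_singleton_eq_erase]
        ring
      · have h1 := g2 i; have h2 := hA i; have h3 := hW i; have h4 := hW0 i; have h5 := hA0 i
        simp only [num_add]
        by_cases hi : i = i₀
        · subst hi
          simp only [isWriteAck, decide_true, and_self, if_true] at h2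
          simp only [Function.update_self]
          omega
        · simp only [Function.update_of_ne hi]
          omega
      · have h1 := g3 i; have h2 := hA i; have h5 := hA0 i
        simp only [num_add] at hi
        refine h1 ?_
        by_cases hi' : i = i₀
        · subst hi'
          simp only [isWriteAck, decide_true, and_self, if_true] at h2
          omega
        · simp only [Function.update_of_ne hi'] at hi
          omega
      · exact absurd (lt_of_le_of_lt htc h) hpos
    have hcount : σ'.writeCounter t = (c.edges s').writeCounter t := by
      rcases ho.state_eq with rfl | h
      · rfl
      · rw [h, writeCounter_edgeReact]
        cases m <;> try rfl
        cases hd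
        simp only
        split
        · rename_i heq
          subst heq
          exact absurd ⟨_, rfl, h⟩ hwc
        · rfl
    -- Below `t` there are no tokens at all, so the commit of `t` may create one per server;
    -- otherwise none are created.
    by_cases htlt : (c.edges s').tc < t
    · obtain ⟨g, g1, g2, g3, g4⟩ := hc
      refine ⟨g, ?_, fun i => ?_, fun i hi => ?_, fun h i => ?_⟩
      · simp only [Function.update_self, hcount, g1]
      · have h1 := g4 htlt i; have h2 := hA i; have h3 := hW i; have h4 := hW0 i; have h5 := hA0 i
        simp only [num_add]
        split at h4 <;> omega
      · have h1 := g4 htlt i; have h2 := hA i; have h5 := hA0 i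
        simp only [num_add] at hi
        omega
      · have h1 := g4 htlt i; have h2 := hA i; have h3 := hW i; have h4 := hW0 i; have h5 := hA0 i
        simp only [Function.update_self] at h
        simp only [num_add]
        rw [if_neg (fun h' => h.ne h'.2)] at h4
        omega
    · simp only [htlt, false_and, if_false] at hW0
      refine hc.mono (fun i => ?_) (fun i => ?_) htag htc ?_
      · have := hW0 i; have := hW i; simp only [num_add]; omega
      · have := hA0 i; have := hA i; simp only [num_add]; omega
      · simp only [Function.update_self, hcount]
  · have hA := fun i => num_erase (isWriteAck s i t) hm
    have hW := fun i => num_erase (isWrite s i t) hm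
    have hW0 : ∀ i, num (isWrite s i t) sent = 0 := fun i => num_eq_zero fun m' hm' => by
      rcases ho.mem_sent hm' with h1 | ⟨h1, -⟩
      · simp [first_backReact] at h1
      · have := backSends_of_mem h1
        cases m' <;> simp_all [BackSends, isWrite]
    -- An `L2` server trades a received write for at most one acknowledgment, and its tag is then at
    -- least `t`.
    have hA0 : ∀ i, num (isWriteAck s i t) sent ≤ (if isWrite s i t m then 1 else 0) ∧
        (0 < num (isWriteAck s i t) sent → i = i' ∧ t ≤ σ'.tag) := fun i => by
      rcases Nat.eq_zero_or_pos (num (isWriteAck s i t) sent) with h | h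
      · rw [h]; simp
      obtain ⟨m', hm', h1⟩ := num_pos.1 h
      rcases ho.mem_sent hm' with h2 | ⟨h2, h3⟩
      · simp [first_backReact] at h2
      have h4 := backSends_of_mem h2
      cases m' <;> simp only [isWriteAck, decide_eq_true_eq, Bool.false_eq_true] at h1
      obtain ⟨rfl, rfl, rfl⟩ := h1
      obtain ⟨rfl, h4⟩ := h4
      cases m <;> simp only at h4
      obtain ⟨rfl, rfl⟩ := h4
      cases hd
      refine ⟨?_, fun _ => ⟨rfl, ?_⟩⟩
      · simp only [isWrite, and_self, decide_true, if_true]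
        refine (num_mono _ ho.sent_le).trans ?_
        rw [num_add, first_backReact]
        exact (zero_add _).le.trans (num_rest_backReact_le _ _ _ _)
      · rw [h3, tag_backReact]; exact le_max_right _ _
    obtain ⟨g, g1, g2, g3, g4⟩ := hc
    refine ⟨g, g1, fun i => ?_, fun i hi => ?_, fun h i => ?_⟩
    · have h1 := g2 i; have h2 := hA i; have h3 := hW i; have h4 := hW0 i; have h5 := (hA0 i).1
      simp only [num_add]
      omega
    · have h2 := hA i; have h5 := (hA0 i).2
      simp only [num_add] at hi
      by_cases h6 : 0 < num (isWriteAck s i t) sent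
      · obtain ⟨rfl, h7⟩ := h5 h6
        simpa using h7
      · exact (g3 i (by omega)).trans (htag i)
    · have h1 := g4 h i; have h2 := hA i; have h3 := hW i; have h4 := hW0 i; have h5 := (hA0 i).1
      simp only [num_add]
      split at h5 <;> split at h3 <;> omega
  · have h1 : ∀ i, num (isWrite s i t) sent = 0 := fun i => num_eq_zero fun m' hm' => by
      rcases ho.mem_sent hm' with h1 | ⟨h1, -⟩
      · simp [first_writerReact] at h1
      · have := writerSends_of_mem h1
        cases m' <;> simp_all [WriterSends, isWrite]
    have h2 : ∀ i, num (isWriteAck s i t) sent = 0 := fun i => num_eq_zero fun m' hm' => by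
      rcases ho.mem_sent hm' with h1 | ⟨h1, -⟩
      · simp [first_writerReact] at h1
      · have := writerSends_of_mem h1
        cases m' <;> simp_all [WriterSends, isWriteAck]
    refine hc.mono (fun i => ?_) (fun i => ?_) htag htc rfl
    · simp only [num_add, h1, add_zero]; exact num_channels_le _ _
    · simp only [num_add, h2, add_zero]; exact num_channels_le _ _
  · have h1 : ∀ i, num (isWrite s i t) sent = 0 := fun i => num_eq_zero fun m' hm' => by
      rcases ho.mem_sent hm' with h1 | ⟨h1, -⟩
      · simp [first_readerReact] at h1
      · have := readerSends_of_mem h1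
        cases m' <;> simp_all [ReaderSends, isWrite]
    have h2 : ∀ i, num (isWriteAck s i t) sent = 0 := fun i => num_eq_zero fun m' hm' => by
      rcases ho.mem_sent hm' with h1 | ⟨h1, -⟩
      · simp [first_readerReact] at h1
      · have := readerSends_of_mem h1
        cases m' <;> simp_all [ReaderSends, isWriteAck]
    refine hc.mono (fun i => ?_) (fun i => ?_) htag htc rfl
    · simp only [num_add, h1, add_zero]; exact num_channels_le _ _
    · simp only [num_add, h2, add_zero]; exact num_channels_le _ _

/-! ### Helper data of a read, counted by sender -/

/-- A server queries the layer `L2` at most once for a read, and receives at most one answer of each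
server. -/
structure ReadOnce (s : Fin P.n₁) (o : ReadOp R) (c : Config P R) : Prop where
  query_le : num (isQueryData s o) c.net ≤ 1
  le_one : ∀ i, num (isQueryCode s i o) c.net + num (isHelper s i o) c.net +
    (((c.edges s).helpers o).map Prod.fst).count i ≤ 1
  length_eq : (c.edges s).readCounter o < P.n₂ - P.f₂ →
    ((c.edges s).helpers o).length = (c.edges s).readCounter o
  fresh : 0 < num (isQueryData s o) c.net ∨ NotYet c o →
    (c.edges s).readCounter o = 0 ∧ (c.edges s).helpers o = [] ∧
      ∀ i, num (isQueryCode s i o) c.net = 0 ∧ num (isHelper s i o) c.net = 0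
  query_eq_zero : NotYet c o → num (isQueryData s o) c.net = 0

/-- For steps in which tokens of the read at most disappear or turn from queries to `L2` into helper
messages. -/
theorem ReadOnce.mono {s : Fin P.n₁} {o : ReadOp R} {c c' : Config P R} (hc : ReadOnce s o c)
    (h1 : num (isQueryData s o) c'.net ≤ num (isQueryData s o) c.net)
    (h2 : ∀ i, num (isQueryCode s i o) c'.net + num (isHelper s i o) c'.net ≤
      num (isQueryCode s i o) c.net + num (isHelper s i o) c.net)
    (h3 : (c'.edges s).helpers o = (c.edges s).helpers o)
    (h4 : (c'.edges s).readCounter o = (c.edges s).readCounter o)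
    (h5 : NotYet c' o → NotYet c o) : ReadOnce s o c' := by
  obtain ⟨g1, g2, g3, g4, g5⟩ := hc
  refine ⟨h1.trans g1, fun i => ?_, ?_, fun h => ?_, fun h => ?_⟩
  · rw [h3]; have := g2 i; have := h2 i; omega
  · rw [h3, h4]; exact g3
  · obtain ⟨k1, k2, k3⟩ := g4 (h.imp (fun h => by omega) h5)
    rw [h3, h4]
    refine ⟨k1, k2, fun i => ?_⟩
    have := k3 i; have := h2 i; omega
  · have := g5 (h5 h); omega

-- QUERY-DATA is sent to a server once per read, on leaving the get-committed-tag phase; its receipt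
-- causes at most one query to each server of `L2`, which causes at most one helper message. The
-- field `fresh` says that nothing has happened at `s` for the read before the receipt of
-- QUERY-DATA, so the queries meet an empty record.
set_option maxHeartbeats 1000000 in
theorem ReadOnce.transition {s : Fin P.n₁} {o : ReadOp R} {c c' : Config P R} {a : Action P R}
    (ht : Transition c a c') (hc : ReadOnce s o c) : ReadOnce s o c' := by
  have hny := fun h => notYet_of_transition ht (o := o) h
  rcases ht with x | ⟨s', m, σ', sent, x, ha, hm, hd, ho⟩ | ⟨i', m, σ', sent, x, ha, hm, hd, ho⟩ |
    ⟨w, e, σ', sent, x, ha, hm, hd, ho⟩ | ⟨r, e, σ', sent, x, ha, hm, hd, ho⟩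
  · exact hc.mono le_rfl (fun _ => le_rfl) rfl rfl hny
  · have hQ0 : num (isQueryData s o) sent = 0 :=
      ho.num_eq_zero_of_edge (fun m' h1 h2 => by cases m' <;> simp_all [isQueryData, EdgeSends])
    have hH0 : ∀ i, num (isHelper s i o) sent = 0 := fun i =>
      ho.num_eq_zero_of_edge (fun m' h1 h2 => by cases m' <;> simp_all [isHelper, EdgeSends])
    have hB0 := fun i => ho.num_isQueryCode_le (s := s) hd i o
    have hQ := num_erase (isQueryData s o) hm
    have hH := fun i => num_erase (isHelper s i o) hm
    have hB := fun i => num_erase (isQueryCode s i o) hm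
    by_cases hq : isQueryData s o m = true
    · simp only [hq, if_true] at hB0 hQ
      cases m <;> simp only [isQueryData, decide_eq_true_eq, Bool.false_eq_true] at hq
      rename_i o' s₁ treq
      obtain ⟨h1, h2⟩ := hq
      subst s₁ o'
      cases hd
      -- The QUERY-DATA message being received was still in transit, so no query to `L2`, no helper
      -- message and no recorded data exist for this read.
      obtain ⟨k1, k2, k3⟩ := hc.fresh (.inl (by omega))
      have hst : (σ'.helpers o : List _) = [] ∧ σ'.readCounter o = 0 := by
        rcases ho.state_eq with rfl | h
        · exact ⟨k2, k1⟩
        · rw [h, readCounter_edgeReact, helpers_edgeReact s (c.edges s) (.queryData o s treq) o]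
          exact ⟨k2, k1⟩
      have h1 := hc.query_le
      refine ⟨?_, fun i => ?_, ?_, fun h => ?_, fun h => ?_⟩
      · simp only [num_add]; omega
      · have h2 := k3 i; have h3 := hB0 i; have h4 := hB i; have h5 := hH i; have h6 := hH0 i
        simp only [num_add, Function.update_self, hst.1, List.map_nil, List.count_nil]
        omega
      · simp [hst.1, hst.2]
      · rcases h with h | h
        · simp only [num_add] at h; omega
        · have := hc.query_eq_zero (hny h); omega
      · have := hc.query_eq_zero (hny h); omega
    simp only [hq] at hB0 hQ
    have hB1 : ∀ i, num (isQueryCode s i o) (c.net.erase m + sent) ≤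
        num (isQueryCode s i o) c.net := fun i => by
      have h2 := hB i; have h3 := hB0 i
      simp only [num_add]; simp at h3; omega
    have hQ1 : num (isQueryData s o) (c.net.erase m + sent) ≤ num (isQueryData s o) c.net := by
      simp only [num_add]; omega
    have hH1 : ∀ i, num (isHelper s i o) (c.net.erase m + sent) +
        (if isHelper s i o m then 1 else 0) = num (isHelper s i o) c.net := fun i => by
      have h2 := hH i; have h3 := hH0 i
      simp only [num_add]; omega
    by_cases hs : s' = s
    swap
    · refine hc.mono hQ1 (fun i => ?_) ?_ ?_ hny
      · have := hB1 i; have := hH1 i; simp only; omega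
      all_goals simp only [Function.update_of_ne (Ne.symm hs)]
    subst hs
    by_cases hh : ∃ i₀ t h, m = .helperElem i₀ s' o t h ∧
        σ' = (edgeReact s' (c.edges s') m).state
    swap
    · refine hc.mono hQ1 (fun i => ?_) ?_ ?_ hny
      · have := hB1 i; have := hH1 i; simp only; omega
      · simp only [Function.update_self]
        rcases ho.state_eq with rfl | h
        · rfl
        have h1 := helpers_edgeReact s' (c.edges s') m o
        rw [h]
        cases m
        case helperElem =>
          cases hd
          simp only at h1
          split at h1
          · rename_i heq
            subst heq
            exact absurd ⟨_, _, _, rfl, h⟩ hh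
          · exact h1
        all_goals exact h1
      · simp only [Function.update_self]
        rcases ho.state_eq with rfl | h
        · rfl
        rw [h, readCounter_edgeReact]
        cases m
        case helperElem =>
          cases hd
          simp only
          split
          · rename_i heq
            subst heq
            exact absurd ⟨_, _, _, rfl, h⟩ hh
          · rfl
        all_goals rfl
    obtain ⟨i₀, t, h, rfl, rfl⟩ := hh
    have h1 := helpers_edgeReact s' (c.edges s') (.helperElem i₀ s' o t h) o
    have h2 := readCounter_edgeReact s' (c.edges s') (.helperElem i₀ s' o t h) o
    simp only [if_true] at h1 h2
    have hpos : 0 < num (isHelper s' i₀ o) c.net :=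
      num_pos.2 ⟨_, hm, by simp [isHelper]⟩
    -- Helper data in transit rule out the fresh situation, before and hence also after the step.
    have hnf : ¬ (0 < num (isQueryData s' o) c.net ∨ NotYet c o) := fun h => by
      have := ((hc.fresh h).2.2 i₀).2; omega
    have hnf' : ∀ {p : Prop}, (0 < num (isQueryData s' o)
        (c.net.erase (.helperElem i₀ s' o t h) + sent) ∨ NotYet { c with
          edges := Function.update c.edges s' (edgeReact s' (c.edges s')
            (.helperElem i₀ s' o t h)).state
          net := c.net.erase (.helperElem i₀ s' o t h) + sent, crashed := x } o) → p := fun h' =>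
      absurd (h'.imp (fun h' => by omega) hny) hnf
    refine ⟨hQ1.trans hc.query_le, fun i => ?_, fun hlt => ?_, fun h' => hnf' h',
      fun h' => hnf' (.inr h')⟩
    · have h3 := hc.le_one i; have h4 := hB1 i; have h5 := hH1 i
      simp only [Function.update_self, h1]
      by_cases hi : i = i₀
      · subst hi
        simp only [isHelper, and_self, decide_true, if_true] at h5
        split
        · simp only [List.map_nil, List.count_nil]; omega
        · simp only [List.map_cons, List.count_cons_self]; omega
      · split
        · simp only [List.map_nil, List.count_nil]; omega
        · simp only [List.map_cons, List.count_cons_of_ne (Ne.symm hi)]; omega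
    · simp only [Function.update_self, h1, h2] at hlt ⊢
      have := hc.length_eq (by omega)
      split
      · omega
      · simp [this]
  · have hQ0 : num (isQueryData s o) sent = 0 := num_eq_zero fun m' hm' => by
      rcases ho.mem_sent hm' with h1 | ⟨h1, -⟩
      · simp [first_backReact] at h1
      · have := backSends_of_mem h1
        cases m' <;> simp_all [BackSends, isQueryData]
    have hB0 : ∀ i, num (isQueryCode s i o) sent = 0 := fun i => num_eq_zero fun m' hm' => by
      rcases ho.mem_sent hm' with h1 | ⟨h1, -⟩
      · simp [first_backReact] at h1
      · have := backSends_of_mem h1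
        cases m' <;> simp_all [BackSends, isQueryCode]
    have hH0 : ∀ i, num (isHelper s i o) sent ≤ if isQueryCode s i o m then 1 else 0 := fun i => by
      rcases Nat.eq_zero_or_pos (num (isHelper s i o) sent) with h | h
      · rw [h]; simp
      obtain ⟨m', hm', h1⟩ := num_pos.1 h
      rcases ho.mem_sent hm' with h2 | ⟨h2, h3⟩
      · simp [first_backReact] at h2
      have h4 := backSends_of_mem h2
      cases m' <;> simp only [isHelper, decide_eq_true_eq, Bool.false_eq_true] at h1
      obtain ⟨rfl, rfl, rfl⟩ := h1
      obtain ⟨rfl, -, h4⟩ := h4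
      cases m <;> simp only at h4
      obtain ⟨rfl, rfl⟩ := h4
      cases hd
      simp only [isQueryCode, and_self, decide_true, if_true]
      refine (num_mono _ ho.sent_le).trans ?_
      rw [num_add, first_backReact]
      exact (zero_add _).le.trans (num_rest_backReact_le _ _ _ _)
    have hQ := num_erase (isQueryData s o) hm
    have hH := fun i => num_erase (isHelper s i o) hm
    have hB := fun i => num_erase (isQueryCode s i o) hm
    refine hc.mono ?_ (fun i => ?_) rfl rfl hny
    · simp only [num_add]; omega
    · have := hH i; have := hB i; have := hB0 i; have := hH0 i
      simp only [num_add]; omega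
  · have h1 : ∀ p : Message P R → Bool, (∀ m', p m' = true →
        ¬ WriterSends w (c.writers w) (writerReact w (c.writers w) e).state m') →
        num p (e.channels P c + sent) ≤ num p c.net := by
      intro p hp
      rw [num_add, num_eq_zero (M := sent)]
      · exact num_channels_le _ _
      intro m' hm'
      rcases ho.mem_sent hm' with h1 | ⟨h1, -⟩
      · simp [first_writerReact] at h1
      · by_contra h2
        exact hp m' (by simpa using h2) (writerSends_of_mem h1)
    refine hc.mono (h1 _ fun m' h2 h3 => ?_) (fun i => add_le_add (h1 _ fun m' h2 h3 => ?_)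
      (h1 _ fun m' h2 h3 => ?_)) rfl rfl hny
    all_goals cases m' <;> first | exact h3 | exact Bool.false_ne_true h2
  · have h1 : ∀ p : Message P R → Bool, (∀ m', p m' = true →
        ¬ ReaderSends r (c.readers r) σ' m') →
        num p (e.channels P c + sent) ≤ num p c.net := by
      intro p hp
      rw [num_add, num_eq_zero (M := sent)]
      · exact num_channels_le _ _
      intro m' hm'
      rcases ho.mem_sent hm' with h1 | ⟨h1, h2⟩
      · simp [first_readerReact] at h1
      · by_contra h3
        exact hp m' (by simpa using h3) (h2 ▸ readerSends_of_mem h1)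
    have hB : ∀ i, num (isQueryCode s i o) (e.channels P c + sent) ≤
      num (isQueryCode s i o) c.net :=
      fun i => h1 _ fun m' h2 h3 => by cases m' <;> simp_all [isQueryCode, ReaderSends]
    have hH : ∀ i, num (isHelper s i o) (e.channels P c + sent) ≤ num (isHelper s i o) c.net :=
      fun i => h1 _ fun m' h2 h3 => by cases m' <;> simp_all [isHelper, ReaderSends]
    by_cases hq : ∀ m' ∈ sent, isQueryData s o m' = false
    · refine hc.mono ?_ (fun i => add_le_add (hB i) (hH i)) rfl rfl hny
      simp only [num_add, num_eq_zero hq, add_zero]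
      exact num_channels_le _ _
    push Not at hq
    obtain ⟨m', hm', h2⟩ := hq
    rcases ho.mem_sent hm' with h3 | ⟨h3, h4⟩
    · simp [first_readerReact] at h3
    have h5 := h4 ▸ readerSends_of_mem h3
    cases m' <;> simp only [isQueryData, ne_eq, not_true_eq_false, decide_eq_false_iff_not,
      not_not] at h2
    rename_i o' s₁ t'
    obtain ⟨h2, h2'⟩ := h2
    subst s₁ o'
    obtain ⟨rfl, h6, ⟨resp, h7⟩, h8⟩ := h5
    -- The sender was in the get-committed-tag phase, so no other QUERY-DATA of this read is in the
    -- channels, and freshness carries over.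
    have hN : NotYet c (r, (c.readers r).op) := .inr ⟨rfl, resp, h7⟩
    obtain ⟨k1, k2, k3⟩ := hc.fresh (.inr hN)
    have k4 := hc.query_eq_zero hN
    have hle : num (isQueryData s (r, (c.readers r).op)) sent ≤ 1 := by
      refine (num_mono _ ho.sent_le).trans ?_
      rw [num_add, first_readerReact]
      refine (zero_add _).le.trans ?_
      have h9 : ∀ j : ReadOp R, ∀ t, num (isQueryData s (r, (c.readers r).op))
          (toEdge P fun s' => (.queryData j s' t : Message P R)) ≤ 1 := fun j t =>
        num_map_le_one fun a b ha hb => by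
          simp only [isQueryData, decide_eq_true_eq] at ha hb
          exact ha.1.trans hb.1.symm
      have h10 : ∀ j : ReadOp R, ∀ t, num (isQueryData s (r, (c.readers r).op))
          (toEdge P fun s' => (.putTag j s' t : Message P R)) = 0 := fun j t =>
        num_eq_zero fun m hm => by obtain ⟨a, rfl⟩ := mem_toEdge.1 hm; rfl
      have h11 : num (isQueryData (P := P) s (r, (c.readers r).op)) 0 = 0 := rfl
      rcases e with _ | _ | m
      · exact Nat.zero_le _
      · refine le_of_eq_of_le (num_eq_zero fun m hm => ?_) (Nat.zero_le _)
        obtain ⟨a, rfl⟩ := mem_toEdge.1 hm; rfl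
      cases m <;> simp only [readerReact, onCommTagResp, onDataResp, onAckRead] <;>
        (repeat' split) <;> simp only [h9, h10, h11, zero_le]
    have hNot : ∀ {p : Prop}, NotYet { c with
        readers := Function.update c.readers r σ', net := e.channels P c + sent, crashed := x }
        (r, (c.readers r).op) → p := by
      rintro p (h | ⟨-, resp, h⟩)
      · simp [h6] at h
      · simp [h8] at h
    refine ⟨?_, fun i => ?_, ?_, fun _ => ⟨k1, k2, fun i => ?_⟩, fun h => hNot h⟩
    · have := num_channels_le (isQueryData s (r, (c.readers r).op)) (c := c) e
      simp only [num_add]; omega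
    · have := hB i; have := hH i; have := k3 i
      simp only [k2, List.map_nil, List.count_nil]
      omega
    · simp only [k1, k2]; simp
    · have := hB i; have := hH i; have := k3 i
      simp only
      omega

namespace Execution

variable (E : Execution P R)

theorem writeQuorum (s : Fin P.n₁) (t : Tag W) (n : ℕ) : WriteQuorum s t (E.conf n) :=
  E.invariant ⟨fun _ => 0, by simp [Config.init, EdgeState.init, num]⟩
    (fun _ _ _ h hc => hc.transition h) n

theorem readOnce (s : Fin P.n₁) (o : ReadOp R) (n : ℕ) : ReadOnce s o (E.conf n) :=
  E.invariant (by constructor <;> simp [Config.init, EdgeState.init, num])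
    (fun _ _ _ h hc => hc.transition h) n

/-- When a write to the layer `L2` is complete, `n₂ - f₂` of its servers have a tag that is at least
as large. -/
theorem le_card_tag (s : Fin P.n₁) (t : Tag W) (n : ℕ) :
    ((E.conf n).edges s).writeCounter t ≤
      (Finset.univ.filter fun i => t ≤ ((E.conf n).backs i).tag).card := by
  obtain ⟨g, g1, g2, g3, -⟩ := E.writeQuorum s t n
  rw [← g1, Finset.card_filter]
  refine Finset.sum_le_sum fun i _ => ?_
  have h1 := g2 i
  have h2 := g3 i
  split
  · omega
  · rename_i h
    by_contra h'
    exact h (h2 (by omega))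

end Execution

/-! ## How a server of layer `L1` answers a read -/

theorem mem_gamma_broadcastResp {s : Fin P.n₁} {σ : EdgeState P R} (t : Tag W) {o : ReadOp R}
    {treq : Tag W} (h : (o, treq) ∈ σ.gamma) :
    (o, treq) ∈ (broadcastResp P s σ t).1.gamma ∨
      ∃ v, .dataResp s o (.value t v) ∈ (broadcastResp P s σ t).2 := by
  simp only [broadcastResp]
  split
  · split
    · split
      · rename_i v _
        by_cases hle : treq ≤ t
        · exact .inr ⟨v, Multiset.mem_add.2 (.inl (Multiset.mem_add.2 (.inr
            (mem_serve.2 ⟨(o, treq), h, hle, rfl⟩))))⟩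
        · exact .inl (Finset.mem_filter.2 ⟨h, hle⟩)
      · exact .inl h
    · exact .inl h
  · exact .inl h

/-- By `h3` the tag being committed still has its value, so the commit takes the branch that serves
the outstanding reads. -/
theorem serve_broadcastResp {s : Fin P.n₁} {σ : EdgeState P R} {t : Tag W} {o : ReadOp R}
    {treq : Tag W} (h : (o, treq) ∈ σ.gamma) (hle : treq ≤ t) (h1 : σ.tc < t)
    (h2 : (broadcastResp P s σ t).1.tc = t) (h3 : t ∈ σ.L.tags → (σ.L.val t).isSome) :
    ∃ v, .dataResp s o (.value t v) ∈ (broadcastResp P s σ t).2 := by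
  revert h2
  simp only [broadcastResp]
  split
  · rename_i ht
    obtain ⟨v, hv⟩ := Option.isSome_iff_exists.1 (h3 ht.1)
    simp only [hv]
    exact fun _ => ⟨v, Multiset.mem_add.2 (.inl (Multiset.mem_add.2 (.inr
      (mem_serve.2 ⟨(o, treq), h, hle, rfl⟩))))⟩
  · exact fun h2 => absurd h2 h1.ne

/-- A registered read stays registered unless it is served or its reader sends PUT-TAG. -/
theorem mem_gamma_edgeReact {s : Fin P.n₁} {σ : EdgeState P R} (m : Message P R) {o : ReadOp R}
    {treq : Tag W} (h : (o, treq) ∈ σ.gamma) :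
    (o, treq) ∈ (edgeReact s σ m).state.gamma ∨
      (∃ t v, .dataResp s o (.value t v) ∈ (edgeReact s σ m).rest) ∨ ∃ x t, m = .putTag o x t := by
  cases m
  case queryData =>
    left
    simp only [edgeReact, onQueryData]
    (repeat' split) <;> simp [h]
  case commitTag src t x =>
    simp only [edgeReact, onCommitTag]
    have h' := mem_gamma_broadcastResp (s := s)
      (σ := { σ with seen := insert (src, t) σ.seen }) t h
    split
    · exact .inl h
    split
    · exact h'.imp id fun ⟨v, hv⟩ => .inl ⟨t, v, Multiset.mem_add.2 (.inr hv)⟩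
    · exact h'.imp id fun ⟨v, hv⟩ => .inl ⟨t, v, hv⟩
  case putTag o' x t =>
    by_cases ho : o = o'
    · subst ho; exact .inr (.inr ⟨_, _, rfl⟩)
    have h' : (o, treq) ∈ σ.gamma.filter fun γ => γ.1 ≠ o' := Finset.mem_filter.2 ⟨h, ho⟩
    simp only [edgeReact, onPutTag]
    split
    · split
      · rename_i v _
        by_cases hle : treq ≤ t
        · refine .inr (.inl ⟨t, v, ?_⟩)
          exact Multiset.mem_add.2 (.inl (Multiset.mem_add.2 (.inl
            (mem_serve.2 ⟨_, h', hle, rfl⟩))))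
        · left; exact Finset.mem_filter.2 ⟨h', hle⟩
      · split
        · rename_i t' v' _
          by_cases hle : treq ≤ t'
          · refine .inr (.inl ⟨t', v', ?_⟩)
            exact Multiset.mem_add.2 (.inl (mem_serve.2 ⟨_, h', hle, rfl⟩))
          · left; exact Finset.mem_filter.2 ⟨h', hle⟩
        · exact .inl h'
    · exact .inl h'
  all_goals
    left
    simp only [edgeReact, onQueryTag, onPutData, onQueryCommTag, onAckCodeElem, onHelperElem]
    (repeat' split) <;> exact h

/-- A server without a suitable value registers the read and queries the layer `L2`. -/
theorem queryData_edgeReact (s x : Fin P.n₁) (σ : EdgeState P R) (o : ReadOp R) (treq : Tag W) :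
    (∃ t v, .dataResp s o (.value t v) ∈ (edgeReact s σ (.queryData o x treq)).rest) ∨
    ((o, treq) ∈ (edgeReact s σ (.queryData o x treq)).state.gamma ∧
      (∀ i, .queryCodeElem s i o ∈ (edgeReact s σ (.queryData o x treq)).rest) ∧
      (treq ≤ σ.tc → σ.L.val σ.tc = none)) := by
  simp only [edgeReact, onQueryData]
  split
  · exact .inl ⟨treq, _, Multiset.mem_singleton_self _⟩
  split
  · split
    · exact .inl ⟨σ.tc, _, Multiset.mem_singleton_self _⟩
    · refine .inr ⟨by simp, fun i => mem_toBack.2 ⟨i, rfl⟩, fun _ => ‹_›⟩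
  · refine .inr ⟨by simp, fun i => mem_toBack.2 ⟨i, rfl⟩, fun h => ?_⟩
    rwa [← le_antisymm h (not_lt.1 ‹_›)]

/-- The last awaited helper data makes the server answer a registered read. -/
theorem helperElem_edgeReact {s x : Fin P.n₁} {σ : EdgeState P R} {o : ReadOp R} {treq : Tag W}
    {i : Fin P.n₂} {t : Tag W} {h : P.Helper} (hγ : (o, treq) ∈ σ.gamma)
    (hc : σ.readCounter o + 1 = P.n₂ - P.f₂) :
    (∃ a, .dataResp s o a ∈ (edgeReact s σ (.helperElem i x o t h)).rest) ∧
    ∀ t' c, regenerateFrom P s ((i, t, h) :: σ.helpers o) = some (t', c) →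
      (∀ t'', (o, t'') ∈ σ.gamma → t'' ≤ t') →
      .dataResp s o (.coded t' c) ∈ (edgeReact s σ (.helperElem i x o t h)).rest := by
  have hex : ∃ γ ∈ σ.gamma, γ.1 = o := ⟨_, hγ, rfl⟩
  simp only [edgeReact, onHelperElem, Function.update_self, hc, if_true, hex]
  constructor
  · split
    · split
      · exact ⟨_, Multiset.mem_singleton_self _⟩
      · exact ⟨_, Multiset.mem_singleton_self _⟩
    · exact ⟨_, Multiset.mem_singleton_self _⟩
  · intro t' c h1 h2
    rw [h1]
    have h3 : ∀ γ ∈ σ.gamma, γ.1 = o → γ.2 ≤ t' := by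
      rintro ⟨o', t''⟩ hm rfl
      exact h2 t'' hm
    simp only
    rw [if_pos h3]
    exact Multiset.mem_singleton_self _

/-- When the committed tag passes a tag whose value is in the list, the registered reads that
request no larger tag are served. -/
theorem serve_edgeReact {s : Fin P.n₁} {σ : EdgeState P R} {m : Message P R} {o : ReadOp R}
    {treq t : Tag W} (hσ : σ.Consistent) (hγ : (o, treq) ∈ σ.gamma) (hle : treq ≤ t)
    (ht : t ∈ σ.L.tags) (h1 : σ.tc < t) (h2 : t ≤ (edgeReact s σ m).state.tc)
    (hm : ∀ x t', m ≠ .putTag o x t') :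
    ∃ t' v, .dataResp s o (.value t' v) ∈ (edgeReact s σ m).rest := by
  have hchange := (tc_edgeReact s σ m).resolve_left (h1.trans_le h2).ne'
  cases m <;> simp only at hchange
  case putTag o' x t' =>
    rw [hchange] at h2
    have ho : o ≠ o' := fun h => hm x t' (by rw [h])
    have h' : (o, treq) ∈ σ.gamma.filter fun γ => γ.1 ≠ o' := Finset.mem_filter.2 ⟨hγ, ho⟩
    simp only [edgeReact, onPutTag, h1.trans_le h2, if_true]
    split
    · rename_i v _
      refine ⟨t', v, ?_⟩
      exact Multiset.mem_add.2 (.inl (Multiset.mem_add.2 (.inl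
        (mem_serve.2 ⟨_, h', hle.trans h2, rfl⟩))))
    · rename_i hnone
      -- Above the committed tag every entry has its value. When the value of `t'` is missing, the
      -- fallback is therefore at least `t`, hence at least the requested tag.
      have hs := hσ.isSome_of_lt t ht h1
      have hne : t ≠ t' := by rintro rfl; rw [hnone] at hs; cases hs
      obtain ⟨t₁, v₁, h3, h4⟩ := TagList.exists_lastBelow (L := σ.L.insertBot t') (t := t')
        (t₁ := t) (by simp [TagList.insertBot, ht]) (lt_of_le_of_ne h2 hne)
        (by simpa [TagList.insertBot, Function.update_of_ne hne] using hs)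
      rw [h3]
      exact ⟨t₁, v₁, Multiset.mem_add.2 (.inl (mem_serve.2 ⟨_, h', hle.trans h4, rfl⟩))⟩
  case commitTag src t' x =>
    obtain ⟨h3, -⟩ := hchange
    rw [h3] at h2
    have h5 : σ.tc < t' := h1.trans_le h2
    have h4 := fun h => serve_broadcastResp (s := s)
      (σ := { σ with seen := insert (src, t') σ.seen }) hγ (hle.trans h2) h5 h
      fun h => hσ.isSome_of_lt t' h h5
    revert h3
    simp only [edgeReact, onCommitTag]
    split
    · exact fun h => absurd h h5.ne
    split
    · intro h
      obtain ⟨v, hv⟩ := h4 h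
      exact ⟨t', v, Multiset.mem_add.2 (.inr hv)⟩
    · intro h
      obtain ⟨v, hv⟩ := h4 h
      exact ⟨t', v, hv⟩

/-- With `t` bounding all tags present and supported by `d` servers, the maximization can only
select `t`. That `t` occurs at all follows from `d ≥ 1`. -/
theorem exists_regenerateFrom (s : Fin P.n₁) {K : List (Fin P.n₂ × Tag W × P.Helper)} {t : Tag W}
    (hK : ∀ a ∈ K, a.2.1 ≤ t) (hd : P.d ≤ numServers (helpersWith P K t)) :
    ∃ c, regenerateFrom P s K = some (t, c) := by
  have hd0 : 1 ≤ P.d := P.code.one_le_k.trans P.code.k_le_d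
  have hmem : t ∈ (K.map fun a => a.2.1).filter fun t => P.d ≤ numServers (helpersWith P K t) := by
    simp only [List.mem_filter, List.mem_map, decide_eq_true_eq]
    refine ⟨?_, hd⟩
    have h1 : 0 < numServers (helpersWith P K t) := by omega
    obtain ⟨i, hi⟩ := Finset.card_pos.1 h1
    simp only [helpersWith, List.mem_toFinset, List.mem_map, List.mem_filterMap] at hi
    obtain ⟨a, ⟨b, hb, h2⟩, -⟩ := hi
    split at h2
    · exact ⟨b, hb, ‹_›⟩
    · cases h2
  obtain ⟨t', ht'⟩ : ∃ t', ((K.map fun a => a.2.1).filter fun t =>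
      P.d ≤ numServers (helpersWith P K t)).argmax id = some t' := by
    rw [← Option.ne_none_iff_exists', Ne, List.argmax_eq_none]
    exact List.ne_nil_of_mem hmem
  have h1 : t ≤ t' := List.le_of_mem_argmax hmem ht'
  have h2 := (List.mem_filter.1 (List.argmax_mem ht')).1
  obtain ⟨a, ha, rfl⟩ := List.mem_map.1 h2
  obtain rfl := le_antisymm h1 (hK a ha)
  exact ⟨_, by rw [regenerateFrom, ht']; rfl⟩

/-- `k` coded elements with a common tag can be decoded. -/
theorem candidates_ne_nil {resp : Answers P} {t : Tag W} {S : Finset (Fin P.n₁)} (hS : P.k ≤ S.card)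
    (h : ∀ s ∈ S, ∃ c, (s, .coded t c) ∈ resp) : candidates P resp ≠ [] := by
  have h1 : P.k ≤ numServers (codedWith P resp t) := by
    refine hS.trans (Finset.card_le_card fun s hs => ?_)
    obtain ⟨c, hc⟩ := h s hs
    simp only [codedWith, List.mem_toFinset, List.mem_map, List.mem_filterMap]
    exact ⟨(s, c), ⟨_, hc, by simp⟩, rfl⟩
  obtain ⟨s, hs⟩ := Finset.card_pos.1 (P.code.one_le_k.trans hS)
  obtain ⟨c, hc⟩ := h s hs
  refine List.ne_nil_of_mem (a := (t, decodeFrom P (codedWith P resp t))) ?_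
  simp only [candidates, List.mem_append, List.mem_filterMap]
  exact .inr ⟨_, hc, by simp [h1]⟩

theorem candidates_ne_nil_of_value {resp : Answers P} {s : Fin P.n₁} {t : Tag W} {v : P.Val}
    (h : (s, .value t v) ∈ resp) : candidates P resp ≠ [] := by
  refine List.ne_nil_of_mem (a := (t, v)) ?_
  simp only [candidates, List.mem_append, List.mem_filterMap]
  exact .inl ⟨_, h, rfl⟩

/-! ## Regeneration from layer `L2` -/

namespace Execution

variable (E : Execution P R)

-- Each distinct sender accounts for at least one increment. This direction forces the counter up to
-- the threshold; that no sender is counted twice is the business of `ReadOnce`.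
open Classical in
theorem card_le_readCounter (s : Fin P.n₁) (o : ReadOp R) (n : ℕ) :
    (Finset.univ.filter fun i : Fin P.n₂ => ∃ n' < n, ∃ t h,
      E.act n' = .run (.receive (.helperElem i s o t h))).card ≤
      ((E.conf n).edges s).readCounter o := by
  induction n with
  | zero => simp
  | succ n ih =>
    by_cases hact : ∃ i t h, E.act n = .run (.receive (.helperElem i s o t h))
    · obtain ⟨i, t, h, ha⟩ := hact
      rw [(E.run_edge ha rfl).1, readCounter_edgeReact]
      simp only [if_true]
      refine (Finset.card_le_card (t := insert i (Finset.univ.filter fun i : Fin P.n₂ => ∃ n' < n,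
        ∃ t h, E.act n' = .run (.receive (.helperElem i s o t h)))) fun i' hi' => ?_).trans
        ((Finset.card_insert_le _ _).trans (by omega))
      simp only [Finset.mem_filter, Finset.mem_univ, true_and, Finset.mem_insert] at hi' ⊢
      obtain ⟨n', hn', t', h', h1⟩ := hi'
      rcases Nat.lt_succ_iff_lt_or_eq.1 hn' with h2 | rfl
      · exact .inr ⟨n', h2, t', h', h1⟩
      · rw [ha] at h1
        cases h1
        exact .inl rfl
    · refine (Finset.card_le_card fun i' hi' => ?_).trans
        (ih.trans (E.readCounter_mono n.le_succ s o))
      simp only [Finset.mem_filter, Finset.mem_univ, true_and] at hi' ⊢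
      obtain ⟨n', hn', t', h', h1⟩ := hi'
      rcases Nat.lt_succ_iff_lt_or_eq.1 hn' with h2 | rfl
      · exact ⟨n', h2, t', h', h1⟩
      · exact absurd ⟨_, _, _, h1⟩ hact

/-- A server that queries the layer `L2` receives enough answers. -/
theorem exists_le_readCounter (hrel : E.Reliable)
    (hcrash₂ : {i : Fin P.n₂ | E.Faulty (.back i)}.ncard ≤ P.f₂) {s : Fin P.n₁}
    (hs : ¬ E.Faulty (.edge s)) {o : ReadOp R} {m : ℕ}
    (h : ∀ i, .queryCodeElem s i o ∈ (E.conf m).net) :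
    ∃ n, P.n₂ - P.f₂ ≤ ((E.conf n).edges s).readCounter o := by
  classical
  have h1 : ∀ i, ∃ n, ¬ E.Faulty (.back i) → ∃ t h,
      E.act n = .run (.receive (.helperElem i s o t h)) := fun i => by
    by_cases hi : E.Faulty (.back i)
    · exact ⟨0, fun h => absurd hi h⟩
    obtain ⟨n₁, -, h1⟩ := hrel _ _ (h i) hi
    obtain ⟨n₂, -, h2⟩ := hrel _ _ ((E.run_back h1 rfl).2 _ (Multiset.mem_add.2 (.inr
      (Multiset.mem_singleton_self _)))) hs
    exact ⟨n₂, fun _ => ⟨_, _, h2⟩⟩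
  choose N hN using h1
  refine ⟨Finset.univ.sup N + 1, le_trans ?_ (E.card_le_readCounter s o _)⟩
  have h2 := Finset.card_filter_add_card_filter_not (s := (Finset.univ : Finset (Fin P.n₂)))
    (p := fun i => E.Faulty (.back i))
  have h3 : (Finset.univ.filter fun i : Fin P.n₂ => E.Faulty (.back i)).card ≤ P.f₂ := by
    refine le_trans ?_ hcrash₂
    rw [← Set.ncard_coe_finset]
    exact Set.ncard_le_ncard (fun s hs => by simpa using hs) (Set.toFinite _)
  rw [Finset.card_univ, Fintype.card_fin] at h2
  refine le_trans (by omega : _ ≤ (Finset.univ.filter fun i : Fin P.n₂ =>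
    ¬ E.Faulty (.back i)).card) (Finset.card_le_card fun i hi => ?_)
  simp only [Finset.mem_filter, Finset.mem_univ, true_and] at hi ⊢
  exact ⟨N i, Nat.lt_succ_of_le (Finset.le_sup (f := N) (Finset.mem_univ i)), hN i hi⟩

/-- The awaited number of answers is reached by the receipt of helper data. -/
theorem exists_last_helperElem (hrel : E.Reliable)
    (hcrash₂ : {i : Fin P.n₂ | E.Faulty (.back i)}.ncard ≤ P.f₂) {s : Fin P.n₁}
    (hs : ¬ E.Faulty (.edge s)) {o : ReadOp R} {treq : Tag W} {T : ℕ}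
    (hT : E.act T = .run (.receive (.queryData o s treq)))
    (h : ∀ i, .queryCodeElem s i o ∈ (E.conf (T + 1)).net) :
    ∃ C > T, ∃ i t h, E.act C = .run (.receive (.helperElem i s o t h)) ∧
      ((E.conf C).edges s).readCounter o + 1 = P.n₂ - P.f₂ := by
  classical
  have hex := E.exists_le_readCounter hrel hcrash₂ hs h
  -- A positive threshold is not met by the counter at its initial value zero, so it is crossed at
  -- some step after `T + 1`; as the counter grows by one at a time, it is then hit exactly.
  have hpos : 0 < P.n₂ - P.f₂ := by
    have := P.n₂_eq; have := P.code.one_le_k; have := P.code.k_le_d; omega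
  have h0 : ((E.conf T).edges s).readCounter o = 0 :=
    ((E.readOnce s o T).fresh (.inl (num_pos.2 ⟨_, E.mem_net_of_run hT, by simp [isQueryData]⟩))).1
  have h1 : ((E.conf (T + 1)).edges s).readCounter o = 0 := by
    rw [(E.run_edge hT rfl).1, readCounter_edgeReact]; exact h0
  have hfind := Nat.find_spec hex
  have hlt : T + 1 < Nat.find hex := by
    by_contra hle
    have := E.readCounter_mono (not_lt.1 hle) s o
    omega
  obtain ⟨C, hC⟩ : ∃ C, Nat.find hex = C + 1 := ⟨Nat.find hex - 1, by omega⟩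
  have hmin := Nat.find_min hex (m := C) (by omega)
  rw [hC] at hfind hlt
  refine ⟨C, by omega, ?_⟩
  rcases E.edge_local_step C hs with h2 | ⟨m, ha, hm, hd, h2⟩
  · rw [h2] at hfind; exact absurd hfind hmin
  rw [h2, readCounter_edgeReact] at hfind
  cases m <;> simp only [add_zero] at hfind
  case helperElem i s' o' t h =>
    split at hfind
    · subst o'
      cases hd
      exact ⟨i, t, h, ha, by omega⟩
    · exact absurd hfind hmin
  all_goals exact absurd hfind hmin

/-- Helper data for a read are at least as recent as the servers of layer `L2` were when the read
arrived. -/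
theorem le_of_helper {s : Fin P.n₁} {o : ReadOp R} {treq t₁ : Tag W} {T : ℕ}
    (hT : .queryData o s treq ∈ (E.conf T).net) {i : Fin P.n₂}
    (hi : t₁ ≤ ((E.conf T).backs i).tag) {n : ℕ} (hn : T ≤ n) :
    (∀ t h, .helperElem i s o t h ∈ (E.conf n).net → t₁ ≤ t) ∧
    ∀ t h, (i, t, h) ∈ ((E.conf n).edges s).helpers o → t₁ ≤ t := by
  induction n, hn using Nat.le_induction with
  | base =>
    -- While QUERY-DATA is in transit there are no helper data for the read, so all of them will be
    -- produced after `T`, when the tag of `i` is at least `t₁`.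
    obtain ⟨-, h1, h2⟩ := (E.readOnce s o T).fresh (.inl (num_pos.2 ⟨_, hT, by simp [isQueryData]⟩))
    refine ⟨fun t h hm => ?_, by simp [h1]⟩
    have := (h2 i).2
    have := num_pos.2 ⟨_, hm, (by simp [isHelper] : isHelper s i o _ = true)⟩
    omega
  | succ n hn ih =>
    refine ⟨fun t h hm => ?_, fun t h hm => ?_⟩
    · rcases (E.transition n).origin hm with h1 | ⟨s, m, -, -, -, h1, -⟩ | ⟨i, m, hm, -, h1⟩ |
        ⟨w, e, -, -, -, h1, -⟩ | ⟨r, e, -, -, -, h1, -⟩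
      · exact ih.1 t h h1
      · exact h1.elim
      · obtain ⟨rfl, rfl, -⟩ := h1
        exact hi.trans (E.tag_mono hn _)
      all_goals exact h1.elim
    · rcases (E.transition n).edge_eq s with h1 | ⟨m, hm', hd, h1⟩ <;> rw [h1] at hm
      · exact ih.2 t h hm
      have h2 := helpers_edgeReact s ((E.conf n).edges s) m o
      cases m <;> simp only at h2
      case helperElem i' s' o' t' h' =>
        cases hd
        split at h2
        · subst o'
          rw [h2] at hm
          split at hm
          · simp at hm
          · rcases List.mem_cons.1 hm with hm | hm
            · cases hm
              exact ih.1 t h hm'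
            · exact ih.2 t h hm
        · rw [h2] at hm
          exact ih.2 t h hm
      all_goals
        rw [h2] at hm
        exact ih.2 t h hm

/-- If sufficiently many servers of layer `L2` have a tag that is at least `t₁` when the read
arrives, and no larger tags are in use when the helper data are complete, then the coded element for
`t₁` is regenerated. -/
theorem exists_regenerateFrom_eq {s : Fin P.n₁} {o : ReadOp R} {treq t₁ : Tag W} {T C : ℕ}
    (hT : .queryData o s treq ∈ (E.conf T).net)
    (hgood : P.n₂ - P.f₂ ≤ (Finset.univ.filter fun i => t₁ ≤ ((E.conf T).backs i).tag).card)
    (hTC : T ≤ C) {i : Fin P.n₂} {t : Tag W} {h : P.Helper}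
    (hC : .helperElem i s o t h ∈ (E.conf C).net)
    (hcount : ((E.conf C).edges s).readCounter o + 1 = P.n₂ - P.f₂)
    (hD : TagsIn {t | t ≤ t₁} (E.conf C)) :
    ∃ c, regenerateFrom P s ((i, t, h) :: ((E.conf C).edges s).helpers o) = some (t₁, c) := by
  set K := (i, t, h) :: ((E.conf C).edges s).helpers o with hK
  have hro := E.readOnce s o C
  have hle : ∀ a ∈ K, a.2.1 ≤ t₁ := by
    intro a ha
    rcases List.mem_cons.1 ha with rfl | ha
    · exact hD.helperElem _ _ _ _ _ hC
    · exact hD.helpers _ _ _ ha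
  have hge : ∀ a ∈ K, t₁ ≤ ((E.conf T).backs a.1).tag → t₁ ≤ a.2.1 := by
    intro a ha hg
    rcases List.mem_cons.1 ha with rfl | ha
    · exact (E.le_of_helper hT hg hTC).1 _ _ hC
    · exact (E.le_of_helper hT hg hTC).2 _ _ ha
  -- The message just received plus those counted before; the record has not been cleared yet
  -- because the counter is still below the threshold.
  have hlen : K.length = P.n₂ - P.f₂ := by
    rw [hK, List.length_cons, hro.length_eq (by omega), hcount]
  -- The message from `i` in transit and any entry of `i` on record share a single token of
  -- `ReadOnce`.
  have hnodup : (K.map Prod.fst).Nodup := by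
    rw [List.nodup_iff_count_le_one]
    intro j
    have h1 := hro.le_one j
    rw [hK, List.map_cons, List.count_cons]
    split
    · rename_i h2
      obtain rfl : i = j := by simpa using h2
      have := num_pos.2 ⟨_, hC, (by simp [isHelper] : isHelper s i o _ = true)⟩
      omega
    · omega
  refine exists_regenerateFrom s hle ?_
  have h1 : (K.map Prod.fst).toFinset.card = P.n₂ - P.f₂ := by
    rw [List.toFinset_card_of_nodup hnodup, List.length_map, hlen]
  have h2 := Finset.card_union_add_card_inter (K.map Prod.fst).toFinset
    (Finset.univ.filter fun i => t₁ ≤ ((E.conf T).backs i).tag)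
  have h3 := Finset.card_le_univ ((K.map Prod.fst).toFinset ∪
    (Finset.univ.filter fun i => t₁ ≤ ((E.conf T).backs i).tag))
  rw [Fintype.card_fin] at h3
  have h4 := P.n₂_eq
  -- Two sets of at least `n₂ - f₂` servers among `n₂` share at least `n₂ - 2 f₂ = d`.
  refine le_trans (by omega : P.d ≤ ((K.map Prod.fst).toFinset ∩
    (Finset.univ.filter fun i => t₁ ≤ ((E.conf T).backs i).tag)).card)
    (Finset.card_le_card fun j hj => ?_)
  simp only [Finset.mem_inter, List.mem_toFinset, List.mem_map, Finset.mem_filter,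
    Finset.mem_univ, true_and] at hj
  obtain ⟨⟨a, ha, rfl⟩, hj⟩ := hj
  simp only [helpersWith, List.mem_toFinset, List.mem_map, List.mem_filterMap]
  exact ⟨(a.1, a.2.2), ⟨a, ha, if_pos (le_antisymm (hle a ha) (hge a ha hj))⟩, rfl⟩

end Execution

/-! ## The get-data phase -/

namespace Execution

/-- The read `o` of a non-faulty reader, whose QUERY-DATA messages for `treq` are in the channels at
time `n₀`, never leaves its get-data phase. -/
structure Stuck (E : Execution P R) (o : ReadOp R) (treq : Tag W) (n₀ : ℕ) : Prop where
  wf : E.WellFormed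
  reliable : E.Reliable
  crash₁ : {s : Fin P.n₁ | E.Faulty (.edge s)}.ncard ≤ P.f₁
  crash₂ : {i : Fin P.n₂ | E.Faulty (.back i)}.ncard ≤ P.f₂
  not_faulty : ¬ E.Faulty (.reader o.1)
  sent : ∀ s, .queryData o s treq ∈ (E.conf n₀).net
  getting : ∀ m ≥ n₀, GettingData (E.conf m) o treq

namespace Stuck

variable {E : Execution P R} {o : ReadOp R} {treq : Tag W} {n₀ : ℕ}

theorem answers_mono (h : E.Stuck o treq n₀) {m m' : ℕ} (hm : n₀ ≤ m) (hm' : m ≤ m') :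
    E.answers m o.1 ⊆ E.answers m' o.1 := by
  induction m', hm' using Nat.le_induction with
  | base => exact List.Subset.refl _
  | succ m' hm' ih =>
    exact List.Subset.trans ih (E.answers_succ h.wf h.not_faulty (h.getting m' (by omega)).2
      (h.getting (m' + 1) (by omega)).2).1

theorem exists_mem_answers (h : E.Stuck o treq n₀) {m : ℕ} (hm : n₀ ≤ m) {s : Fin P.n₁}
    {a : DataResp (Tag W) P.Val P.Coded} (ha : .dataResp s o a ∈ (E.conf m).net) :
    ∃ M ≥ n₀, (s, a) ∈ E.answers M o.1 := by
  obtain ⟨m', hm', h1⟩ := h.reliable _ _ ha h.not_faulty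
  refine ⟨m' + 1, by omega, (E.answers_succ h.wf h.not_faulty (h.getting m' (by omega)).2
      (h.getting (m' + 1) (by omega)).2).2 s a ?_⟩
  rw [(h.getting m' (by omega)).1]
  exact h1

/-- Finitely many answers are eventually all recorded. -/
theorem exists_forall_mem_answers (h : E.Stuck o treq n₀) {p : Fin P.n₁ → Prop}
    {q : Fin P.n₁ → DataResp (Tag W) P.Val P.Coded → Prop}
    (hpq : ∀ s, p s → ∃ m ≥ n₀, ∃ a, q s a ∧ .dataResp s o a ∈ (E.conf m).net) :
    ∃ M ≥ n₀, ∀ s, p s → ∃ a, q s a ∧ (s, a) ∈ E.answers M o.1 := by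
  classical
  have h1 : ∀ s, ∃ M ≥ n₀, p s → ∃ a, q s a ∧ (s, a) ∈ E.answers M o.1 := fun s => by
    by_cases hs : p s
    · obtain ⟨m, hm, a, hq, ha⟩ := hpq s hs
      obtain ⟨M, hM, h2⟩ := h.exists_mem_answers hm ha
      exact ⟨M, hM, fun _ => ⟨a, hq, h2⟩⟩
    · exact ⟨n₀, le_rfl, fun h => absurd h hs⟩
  choose N hN hN' using h1
  refine ⟨max n₀ (Finset.univ.sup N), le_max_left _ _, fun s hs => ?_⟩
  obtain ⟨a, hq, ha⟩ := hN' s hs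
  exact ⟨a, hq, h.answers_mono (hN s)
    ((Finset.le_sup (f := N) (Finset.mem_univ s)).trans (le_max_right _ _)) ha⟩

/-- PUT-TAG is sent only on leaving the get-data phase. Hence the read is never unregistered for
that reason, only by being served. -/
theorem putTag_notMem (h : E.Stuck o treq n₀) {m : ℕ} (hm : n₀ ≤ m) (s : Fin P.n₁) (t : Tag W) :
    .putTag o s t ∉ (E.conf m).net := fun h1 =>
  ((E.readConsistent o m).putTag s t h1).2 treq (h.getting m hm)

theorem exists_queried (h : E.Stuck o treq n₀) {s : Fin P.n₁} (hs : ¬ E.Faulty (.edge s)) :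
    ∃ T ≥ n₀, E.act T = .run (.receive (.queryData o s treq)) :=
  h.reliable _ _ (h.sent s) hs

/-- A registered read stays registered as long as it is not served. -/
theorem gamma_or_value (h : E.Stuck o treq n₀)
    {s : Fin P.n₁} (hs : ¬ E.Faulty (.edge s)) {m : ℕ} (hm : n₀ ≤ m)
    (hγ : (o, treq) ∈ ((E.conf m).edges s).gamma) {m' : ℕ} (hm' : m ≤ m') :
    (o, treq) ∈ ((E.conf m').edges s).gamma ∨
      ∃ n ≥ n₀, ∃ t v, .dataResp s o (.value t v) ∈ (E.conf n).net := by
  induction m', hm' using Nat.le_induction with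
  | base => exact .inl hγ
  | succ m' hm' ih =>
    rcases ih with ih | ih
    swap
    · exact .inr ih
    rcases E.edge_local_step m' hs with h1 | ⟨m, ha, hmem, hd, h1⟩ <;> rw [h1]
    · exact .inl ih
    rcases mem_gamma_edgeReact (s := s) m ih with h2 | ⟨t, v, h2⟩ | ⟨x, t, rfl⟩
    · exact .inl h2
    · exact .inr ⟨m' + 1, by omega, t, v, (E.run_edge ha hd).2 _ (Multiset.mem_add.2 (.inr h2))⟩
    · exact absurd hmem (h.putTag_notMem (by omega) _ _)

/-- Every non-faulty server answers. -/
theorem exists_answer (h : E.Stuck o treq n₀) {s : Fin P.n₁} (hs : ¬ E.Faulty (.edge s)) :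
    ∃ m ≥ n₀, ∃ a, .dataResp s o a ∈ (E.conf m).net := by
  obtain ⟨T, hT, ha⟩ := h.exists_queried hs
  obtain ⟨h1, h2⟩ := E.run_edge ha rfl
  rcases queryData_edgeReact s s ((E.conf T).edges s) o treq with ⟨t, v, h3⟩ | ⟨h3, h4, -⟩
  · exact ⟨T + 1, by omega, _, h2 _ (Multiset.mem_add.2 (.inr h3))⟩
  rw [← h1] at h3
  obtain ⟨C, hC, i, t, x, haC, hcount⟩ := E.exists_last_helperElem h.reliable h.crash₂ hs ha
    fun i => h2 _ (Multiset.mem_add.2 (.inr (h4 i)))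
  rcases h.gamma_or_value hs (by omega) h3 (show T + 1 ≤ C from hC) with h5 | ⟨n, hn, t, v, h5⟩
  · obtain ⟨a, h6⟩ := (helperElem_edgeReact (s := s) (x := s) (i := i) (t := t) (h := x)
      h5 hcount).1
    exact ⟨C + 1, by omega, a, (E.run_edge haC rfl).2 _ (Multiset.mem_add.2 (.inr h6))⟩
  · exact ⟨n, hn, _, h5⟩

/-- The answers recorded by the reader never suffice for a candidate for the returned value. -/
theorem false_of_answers (h : E.Stuck o treq n₀) {m : ℕ} (hm : n₀ ≤ m)
    (hb : ∀ resp : Answers P, (∀ a ∈ E.answers m o.1, a ∈ resp) →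
      candidates P resp ≠ []) : False := by
  classical
  obtain ⟨M, hM, h1⟩ := h.exists_forall_mem_answers (p := fun s => ¬ E.Faulty (.edge s))
    (q := fun _ _ => True) fun s hs => by
      obtain ⟨m, hm, a, ha⟩ := h.exists_answer hs
      exact ⟨m, hm, a, trivial, ha⟩
  obtain ⟨-, resp, h2⟩ := h.getting (max m M) (by omega)
  have h3 : E.answers (max m M) o.1 = resp := by simp only [answers, h2]
  have h4 := E.reader_waiting (max m M) o.1
  rw [h2] at h4
  refine h4 ⟨?_, hb resp fun a ha => h3 ▸ h.answers_mono hm (le_max_left _ _) ha⟩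
  have h5 := E.card_le_card_filter_not_faulty h.crash₁ Finset.univ
  have h6 := P.n₁_eq
  rw [Finset.card_univ, Fintype.card_fin] at h5
  refine le_trans (by omega : _ ≤ (Finset.univ.filter fun s : Fin P.n₁ =>
    ¬ E.Faulty (.edge s)).card) (Finset.card_le_card fun s hs => ?_)
  obtain ⟨a, -, ha⟩ := h1 s (Finset.mem_filter.1 hs).2
  simp only [List.mem_toFinset, List.mem_map]
  exact ⟨_, h3 ▸ h.answers_mono hM (le_max_right _ _) ha, rfl⟩

/-- A value would reach the reader and be a candidate, and the count of answers is met anyway. Being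
served is thus impossible for a stuck read. -/
theorem value_notMem (h : E.Stuck o treq n₀)
    {m : ℕ} (hm : n₀ ≤ m) (s : Fin P.n₁) (t : Tag W) (v : P.Val) :
    .dataResp s o (.value t v) ∉ (E.conf m).net := fun h1 => by
  obtain ⟨M, hM, h2⟩ := h.exists_mem_answers hm h1
  exact h.false_of_answers hM fun resp hr => candidates_ne_nil_of_value (hr _ h2)

/-- The elements may be sent at different times; the record keeps them all, and `k` of them with a
common tag make a candidate. -/
theorem false_of_coded (h : E.Stuck o treq n₀)
    {t : Tag W} {S : Finset (Fin P.n₁)} (hS : P.k ≤ S.card)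
    (hc : ∀ s ∈ S, ∃ m ≥ n₀, ∃ c, .dataResp s o (.coded t c) ∈ (E.conf m).net) : False := by
  obtain ⟨M, hM, h2⟩ := h.exists_forall_mem_answers (p := fun s => s ∈ S)
    (q := fun _ a => ∃ c, a = .coded t c) fun s hs => by
      obtain ⟨m, hm, c, hc⟩ := hc s hs
      exact ⟨m, hm, _, ⟨c, rfl⟩, hc⟩
  refine h.false_of_answers hM fun resp hr => candidates_ne_nil (t := t) hS fun s hs => ?_
  obtain ⟨a, ⟨c, rfl⟩, ha⟩ := h2 s hs
  exact ⟨c, hr _ ha⟩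

/-- How a non-faulty server deals with the read. -/
theorem exists_course (h : E.Stuck o treq n₀) {s : Fin P.n₁} (hs : ¬ E.Faulty (.edge s)) :
    ∃ T C, n₀ ≤ T ∧ T < C ∧ E.act T = .run (.receive (.queryData o s treq)) ∧
      (treq ≤ ((E.conf T).edges s).tc →
        ((E.conf T).edges s).L.val ((E.conf T).edges s).tc = none) ∧
      (∀ m > T, (o, treq) ∈ ((E.conf m).edges s).gamma) ∧
      ∃ i t x, E.act C = .run (.receive (.helperElem i s o t x)) ∧
        ((E.conf C).edges s).readCounter o + 1 = P.n₂ - P.f₂ := by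
  obtain ⟨T, hT, ha⟩ := h.exists_queried hs
  obtain ⟨h1, h2⟩ := E.run_edge ha rfl
  rcases queryData_edgeReact s s ((E.conf T).edges s) o treq with ⟨t, v, h3⟩ | ⟨h3, h4, h5⟩
  · exact absurd (h2 _ (Multiset.mem_add.2 (.inr h3))) (h.value_notMem (by omega) _ _ _)
  rw [← h1] at h3
  obtain ⟨C, hC, i, t, x, haC, hcount⟩ := E.exists_last_helperElem h.reliable h.crash₂ hs ha
    fun i => h2 _ (Multiset.mem_add.2 (.inr (h4 i)))
  refine ⟨T, C, hT, hC, ha, h5, fun m hm => ?_, i, t, x, haC, hcount⟩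
  rcases h.gamma_or_value hs (by omega) h3 (show T + 1 ≤ m from hm) with h6 | ⟨n, hn, t, v, h6⟩
  · exact h6
  · exact absurd h6 (h.value_notMem hn _ _ _)

/-- The committed tag of a server does not pass a tag in its list that is at least the requested one
while the read is registered. -/
theorem tc_lt (h : E.Stuck o treq n₀)
    {s : Fin P.n₁} (hs : ¬ E.Faulty (.edge s)) {m : ℕ} (hm : n₀ ≤ m) {t : Tag W}
    (hle : treq ≤ t) (hγ : ∀ m' ≥ m, (o, treq) ∈ ((E.conf m').edges s).gamma)
    (ht : t ∈ ((E.conf m).edges s).L.tags) (hlt : ((E.conf m).edges s).tc < t) {m' : ℕ}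
    (hm' : m ≤ m') : ((E.conf m').edges s).tc < t := by
  induction m', hm' using Nat.le_induction with
  | base => exact hlt
  | succ m' hm' ih =>
    by_contra hcon
    rcases E.edge_local_step m' hs with h1 | ⟨x, ha, hmem, hd, h1⟩ <;> rw [h1] at hcon
    · exact hcon ih
    obtain ⟨t', v, h2⟩ := serve_edgeReact (E.consistent m' s) (hγ m' hm') hle
      (E.tags_mono hm' s ht) ih (not_lt.1 hcon)
      (by rintro x t' rfl; exact h.putTag_notMem (by omega) _ _ hmem)
    exact h.value_notMem (by omega) _ _ _ ((E.run_edge ha hd).2 _ (Multiset.mem_add.2 (.inr h2)))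

end Stuck

variable (E : Execution P R)

/-- The value of a tag that has not been passed by the committed tag remains in the list until the
write to the layer `L2` is complete. -/
theorem isSome_or_le_writeCounter {s : Fin P.n₁} {t : Tag W} {m : ℕ}
    (hval : (((E.conf m).edges s).L.val t).isSome) {m' : ℕ} (hm : m ≤ m')
    (htc : ((E.conf m').edges s).tc ≤ t) :
    (((E.conf m').edges s).L.val t).isSome ∨
      P.n₂ - P.f₂ ≤ ((E.conf m').edges s).writeCounter t := by
  induction m', hm using Nat.le_induction with
  | base => exact .inl hval
  | succ m' hm ih =>
    have ih := ih (((E.transition m').tc_le s).trans htc)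
    rcases (E.transition m').edge_eq s with h1 | ⟨x, -, -, h1⟩ <;> rw [h1] at htc ⊢
    · exact ih
    rcases ih with ih | ih
    · exact (val_edgeReact x ih (not_lt.2 htc)).imp id fun h => h.ge
    · right
      rw [writeCounter_edgeReact]
      omega

/-- The first commit of a tag is witnessed by `f₁ + k` broadcasts. -/
theorem exists_first_commit {t : Tag W} (ht : P.t₀ < t) {τ : ℕ} {x : Fin P.n₁}
    (hx : ((E.conf τ).edges x).tc = t) (hmax : ∀ s, ((E.conf τ).edges s).tc ≤ t) :
    ∃ u < τ, (∀ s, ((E.conf u).edges s).tc < t) ∧ ∃ y, ∃ S : Finset (Fin P.n₁),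
      P.f₁ + P.k ≤ S.card ∧ ∀ src ∈ S, (src, t) ∈ ((E.conf (u + 1)).edges y).seen := by
  classical
  have hex : ∃ n, ∃ y, t ≤ ((E.conf n).edges y).tc := ⟨τ, x, hx.ge⟩
  obtain ⟨y, hy⟩ := Nat.find_spec hex
  have hle := Nat.find_min' hex ⟨x, hx.ge⟩
  have hpos : Nat.find hex ≠ 0 := by
    intro h0
    rw [h0, E.conf_zero] at hy
    exact absurd ht (not_lt.2 hy)
  obtain ⟨u, hu⟩ := Nat.exists_eq_succ_of_ne_zero hpos
  have hlow : ∀ n ≤ u, ∀ s, ((E.conf n).edges s).tc < t := fun n hn s => by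
    by_contra h
    exact Nat.find_min hex (m := n) (by omega) ⟨s, not_lt.1 h⟩
  -- Before the first commit of `t` all committed tags are below `t`, hence so are the tags in
  -- PUT-TAG messages; this first commit must come from COMMIT-TAG.
  have hD : TagsIn {t' | t' < t} (E.conf u) :=
    E.tagsIn (fun a b hab hb => hab.trans_lt hb) ht hlow le_rfl
  rw [hu, Nat.succ_eq_add_one] at hy hle
  have hyt : ((E.conf (u + 1)).edges y).tc = t :=
    le_antisymm ((E.tc_mono hle y).trans (hmax y)) hy
  have hne := (hlow u le_rfl y).ne
  refine ⟨u, hle, hlow u le_rfl, y,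
    (((E.conf (u + 1)).edges y).seen.filter fun a => a.2 = t).image Prod.fst, ?_, ?_⟩
  · rw [Finset.card_image_of_injOn, ← (E.consistent (u + 1) y).card_seen]
    · rcases (E.transition u).edge_eq y with h1 | ⟨m, hm, hd, h1⟩
      · rw [h1] at hyt; exact absurd hyt hne
      rw [h1] at hyt ⊢
      rcases tc_edgeReact y ((E.conf u).edges y) m with h2 | h2
      · rw [h2] at hyt; exact absurd hyt hne
      cases m <;> simp only at h2
      case putTag o s t' =>
        have := hD.putTag _ _ _ hm
        rw [← h2, hyt] at this
        exact (lt_irrefl t this).elim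
      case commitTag src t' s =>
        obtain ⟨h2, h3⟩ := h2
        rw [h2] at hyt
        subst hyt
        exact h3
    · rintro ⟨a, b⟩ hab ⟨a', b'⟩ hab' heq
      simp only [Finset.coe_filter, Set.mem_ofPred_eq] at hab hab' heq
      rw [heq, hab.2, hab'.2]
  · intro src hsrc
    obtain ⟨⟨a, b⟩, hab, rfl⟩ := Finset.mem_image.1 hsrc
    obtain ⟨h1, rfl⟩ := Finset.mem_filter.1 hab
    exact h1

/-- A non-faulty server whose broadcast has been received has put the tag into its list beforehand,
if the committed tag was lower. -/
theorem exists_put {s : Fin P.n₁} (hs : ¬ E.Faulty (.edge s)) {t : Tag W} {n : ℕ} {y : Fin P.n₁}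
    (hseen : (s, t) ∈ ((E.conf n).edges y).seen) (htc : ∀ m < n, ((E.conf m).edges s).tc < t) :
    ∃ p < n, t ∈ ((E.conf (p + 1)).edges s).L.tags ∧
      (((E.conf (p + 1)).edges s).L.val t).isSome ∧ ((E.conf (p + 1)).edges s).tc < t ∧
      (s, t) ∉ ((E.conf (p + 1)).edges s).seen := by
  classical
  have hex : ∃ p, ∃ w v, E.act p = .run (.receive (.putData w s t v)) := by
    obtain ⟨p, -, w, v, -, h1⟩ := E.putData_of_commitTag n (.inr hseen)
    exact ⟨p, w, v, E.run_of_not_faulty hs h1 rfl⟩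
  -- The first receipt of PUT-DATA with tag `t` is taken, so that no copy of the server's own
  -- broadcast can have been consumed by then.
  obtain ⟨w, v, ha⟩ := Nat.find_spec hex
  have hlt : Nat.find hex < n := by
    obtain ⟨p, hp, w, v, -, h1⟩ := E.putData_of_commitTag n (.inr hseen)
    exact (Nat.find_min' hex ⟨w, v, E.run_of_not_faulty hs h1 rfl⟩).trans_lt hp
  have hnot : (s, t) ∉ ((E.conf (Nat.find hex)).edges s).seen := fun h1 => by
    obtain ⟨p, hp, w, v, -, h1⟩ := E.putData_of_commitTag _ (.inr h1)
    exact Nat.find_min hex hp ⟨w, v, E.run_of_not_faulty hs h1 rfl⟩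
  have h1 := htc _ hlt
  refine ⟨Nat.find hex, hlt, ?_⟩
  rw [(E.run_edge ha rfl).1]
  simp only [edgeReact, onPutData, if_pos h1, TagList.insertVal]
  exact ⟨Finset.mem_insert_self _ _, by simp, h1, hnot⟩

/-- The largest tag committed in `L1` by the time all helper data are complete is the one for which
`k` non-faulty servers regenerate their coded elements. -/
theorem Stuck.false {E : Execution P R} {o : ReadOp R} {treq : Tag W} {n₀ : ℕ}
    (h : E.Stuck o treq n₀) : False := by
  classical
  have hcourse : ∀ s, ∃ T C, ¬ E.Faulty (.edge s) → n₀ ≤ T ∧ T < C ∧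
      E.act T = .run (.receive (.queryData o s treq)) ∧
      (treq ≤ ((E.conf T).edges s).tc →
        ((E.conf T).edges s).L.val ((E.conf T).edges s).tc = none) ∧
      (∀ m > T, (o, treq) ∈ ((E.conf m).edges s).gamma) ∧
      ∃ i t x, E.act C = .run (.receive (.helperElem i s o t x)) ∧
        ((E.conf C).edges s).readCounter o + 1 = P.n₂ - P.f₂ := fun s => by
    by_cases hs : E.Faulty (.edge s)
    · exact ⟨0, 0, fun h => absurd hs h⟩
    · obtain ⟨T, C, h1⟩ := h.exists_course hs
      exact ⟨T, C, fun _ => h1⟩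
  choose T C hcourse using hcourse
  -- By time `τ` every non-faulty server has completed its helper data. The maximum `t` below ranges
  -- over all of `L1`, including faulty servers, so that it bounds every tag in `L2`.
  set τ := Finset.univ.sup C with hτ
  have hCτ : ∀ s, C s ≤ τ := fun s => Finset.le_sup (Finset.mem_univ s)
  have hn₁ : 0 < P.n₁ := by
    have := P.n₁_eq; have := P.code.one_le_k; omega
  obtain ⟨x, -, hmax⟩ := Finset.exists_max_image Finset.univ (fun s => ((E.conf τ).edges s).tc)
    ⟨(⟨0, hn₁⟩ : Fin P.n₁), Finset.mem_univ _⟩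
  obtain ⟨t, hx⟩ : ∃ t, ((E.conf τ).edges x).tc = t := ⟨_, rfl⟩
  rw [hx] at hmax
  replace hmax := fun s => hmax s (Finset.mem_univ s)
  have hD : ∀ n ≤ τ, TagsIn {t' | t' ≤ t} (E.conf n) := fun n hn =>
    E.tagsIn (fun a b hab hb => hab.trans hb) (hx ▸ E.t₀_le_tc τ x)
      (fun n hn s => (E.tc_mono hn s).trans (hmax s)) hn
  -- It remains to find `k` non-faulty servers at whose query time `n₂ - f₂` servers of `L2` have
  -- reached `t`.
  have hcoded : ∀ s, ¬ E.Faulty (.edge s) →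
      P.n₂ - P.f₂ ≤ (Finset.univ.filter fun i => t ≤ ((E.conf (T s)).backs i).tag).card →
      ∃ m ≥ n₀, ∃ c, .dataResp s o (.coded t c) ∈ (E.conf m).net := fun s hs hgood => by
    obtain ⟨h1, h2, h3, -, h4, i, t', y, h5, h6⟩ := hcourse s hs
    obtain ⟨c, hc⟩ := E.exists_regenerateFrom_eq (E.mem_net_of_run h3) hgood h2.le
      (E.mem_net_of_run h5) h6 (hD _ (hCτ s))
    refine ⟨C s + 1, by omega, c, (E.run_edge h5 rfl).2 _ (Multiset.mem_add.2 (.inr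
      ((helperElem_edgeReact (h4 _ h2) h6).2 t c hc fun t'' ht'' => ?_)))⟩
    -- All registrations of the read request `treq`, which is at most `t`, so the regenerated tag
    -- passes the server's test.
    rw [((E.readConsistent o _).gamma s t'' ht'').2 treq (h.getting _ (by omega))]
    exact (hD (T s) (by have := hCτ s; omega)).queryData _ _ _ (E.mem_net_of_run h3)
  rcases (hx ▸ E.t₀_le_tc τ x : P.t₀ ≤ t).eq_or_lt with rfl | hlt
  · refine h.false_of_coded (S := Finset.univ.filter fun s => ¬ E.Faulty (.edge s)) ?_
      fun s hs => hcoded s (Finset.mem_filter.1 hs).2 ?_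
    · have := E.card_le_card_filter_not_faulty h.crash₁ Finset.univ
      have h6 := P.n₁_eq
      rw [Finset.card_univ, Fintype.card_fin] at this
      omega
    · rw [Finset.filter_true_of_mem fun i _ => E.t₀_le_tag _ i, Finset.card_univ, Fintype.card_fin]
      omega
  -- The server `y` may be faulty; only the initiators in `S` matter, and at most `f₁` of these `f₁
  -- + k` are faulty.
  obtain ⟨u, huτ, hu, y, S, hS, hseen⟩ := E.exists_first_commit hlt hx hmax
  refine h.false_of_coded (S := S.filter fun s => ¬ E.Faulty (.edge s)) (t := t) ?_ fun s hs => ?_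
  · have := E.card_le_card_filter_not_faulty h.crash₁ S
    omega
  obtain ⟨hsS, hs⟩ := Finset.mem_filter.1 hs
  obtain ⟨h1, h2, h3, h4, h5, -⟩ := hcourse s hs
  have htreq : treq ≤ t := (hD (T s) (by have := hCτ s; omega)).queryData _ _ _
    (E.mem_net_of_run h3)
  obtain ⟨p, hp, hp1, hp2, hp3, hp4⟩ := E.exists_put hs (hseen s hsS) fun m hm =>
    (E.tc_mono (Nat.le_of_lt_succ hm) s).trans_lt (hu s)
  have hTt : ((E.conf (T s)).edges s).tc ≤ t :=
    (E.tc_mono (by have := hCτ s; omega) s).trans (hmax s)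
  refine hcoded s hs ?_
  rcases hTt.lt_or_eq with hTt | hTt
  -- The committed tag is still below `t` when the read is registered, and the commit that must
  -- follow would serve the read.
  · exfalso
    have hT1 : ((E.conf (T s + 1)).edges s).tc < t := by
      rw [(E.run_edge h3 rfl).1]
      rcases tc_edgeReact s ((E.conf (T s)).edges s) (.queryData o s treq) with h6 | h6
      · rw [h6]; exact hTt
      · exact h6.elim
    -- The broadcasts from `S`, consumed by `y`, reach all non-faulty servers, even those with a
    -- faulty initiator.
    obtain ⟨v, hv, h6, -⟩ := E.exists_commit hs hp1 hp4 hS hsS fun src hsrc =>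
      (E.forwarded_of_seen (hseen src hsrc)).exists_seen h.reliable h.crash₁ hs
    -- From time `m` on the read is registered and `t` is in the list; at `m` itself the committed
    -- tag is still below `t`.
    set m := max (T s + 1) (p + 1) with hm
    have hlt' : ((E.conf m).edges s).tc < t := by
      rcases max_choice (T s + 1) (p + 1) with h7 | h7 <;> rw [hm, h7]
      · exact hT1
      · exact hp3
    exact absurd ((E.tc_mono (le_max_left (v + 1) m) s).trans' h6)
      (not_le.2 (h.tc_lt hs (by omega) htreq (fun m' hm' => h5 m' (by omega))
        (E.tags_mono (le_max_right _ _) s hp1) hlt' (le_max_right _ _)))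
  -- The committed tag is `t` at `T s` but below `t` just after the value was stored, so the value
  -- was stored before the query.
  · have hpT : p + 1 ≤ T s := by
      by_contra hcon
      exact absurd ((E.tc_mono (by omega : T s ≤ p + 1) s).trans_lt hp3)
        (by rw [hTt]; exact lt_irrefl _)
    rcases E.isSome_or_le_writeCounter hp2 hpT hTt.le with h6 | h6
    -- A value still present would have been sent in answer to QUERY-DATA, so only a completed write
    -- to `L2` explains its absence.
    · rw [hTt] at h4
      rw [h4 htreq] at h6
      cases h6
    · exact h6.trans (E.le_card_tag s t (T s))

end Execution

/-! ### Completion of reads -/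

namespace Execution

variable (E : Execution P R)

/-- The get-data phase of a read of a non-faulty reader ends. -/
theorem exists_putTag (hwf : E.WellFormed) (hrel : E.Reliable)
    (hcrash₁ : {s : Fin P.n₁ | E.Faulty (.edge s)}.ncard ≤ P.f₁)
    (hcrash₂ : {i : Fin P.n₂ | E.Faulty (.back i)}.ncard ≤ P.f₂)
    {r : R} (hr : ¬ E.Faulty (.reader r)) {n : ℕ} {treq : Tag W}
    (hn : ((E.conf n).readers r).phase = .getData treq [])
    (hsent : ∀ s, .queryData (r, ((E.conf n).readers r).op) s treq ∈ (E.conf n).net) :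
    ∃ m ≥ n, ∃ t v, ((E.conf (m + 1)).readers r).op = ((E.conf n).readers r).op ∧
      ((E.conf (m + 1)).readers r).phase = .putTag t v ∅ ∧
      ∀ s, .putTag (r, ((E.conf n).readers r).op) s t ∈ (E.conf (m + 1)).net := by
  by_contra hcon
  set j := ((E.conf n).readers r).op with hj
  -- It suffices that the reader stays in the get-data phase with the same requested tag: the only
  -- other effect on this phase is the start of put-tag, which `hcon` excludes.
  refine Stuck.false (E := E) (o := (r, j)) (treq := treq) (n₀ := n)
    ⟨hwf, hrel, hcrash₁, hcrash₂, hr, hsent, fun m hm => ?_⟩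
  unfold GettingData
  induction m, hm using Nat.le_induction with
  | base => exact ⟨rfl, _, hn⟩
  | succ m hm ih =>
    obtain ⟨hop, resp, hp⟩ := ih
    simp only at hop hp ⊢
    rcases E.reader_local_step m hr with h | ⟨e, ha, he, hd, h⟩
    · rw [h]; exact ⟨hop, _, hp⟩
    rcases readerReact_cases r ((E.conf m).readers r) e with h3 | ⟨r', rfl, -⟩ |
      ⟨_, _, _, _, -, h3, -⟩ | ⟨_, _, _, _, _, -, h3, ⟨-, h4⟩ | ⟨t, v, -, h4, h5⟩⟩ |
      ⟨_, _, _, _, _, -, h3, -⟩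
    · rw [h, h3]; exact ⟨hop, _, hp⟩
    · cases hd
      have := hwf.2 m r (.inl ha)
      simp [hp, ReaderPhase.Free] at this
    · simp [hp] at h3
    · rw [hp] at h3
      cases h3
      rw [h, h4]; exact ⟨hop, _, rfl⟩
    · refine absurd ⟨m, hm, t, v, ?_, ?_, fun s => ?_⟩ hcon
      · rw [h, h4]; exact hop
      · rw [h, h4]
      · rw [← hop]
        exact (E.run_reader ha hd).2 _ (Multiset.mem_add.2 (.inr (h5 s)))
    · simp [hp] at h3

theorem readCompletes (hwf : E.WellFormed) (hrel : E.Reliable)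
    (hcrash₁ : {s : Fin P.n₁ | E.Faulty (.edge s)}.ncard ≤ P.f₁)
    (hcrash₂ : {i : Fin P.n₂ | E.Faulty (.back i)}.ncard ≤ P.f₂) {r : R} {n : ℕ}
    (hr : ¬ E.Faulty (.reader r)) (hact : E.act n = .run (.invokeRead r)) :
    E.ReadCompletes r n := by
  obtain ⟨h1, h2⟩ := E.run_reader hact rfl
  obtain ⟨m₁, hm₁, treq, hop₁, hp₁, hs₁⟩ := E.exists_getData hwf hrel hcrash₁ hr (n := n + 1)
    (resp := []) (by rw [h1]; rfl) (fun s => by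
      rw [h1]
      exact h2 _ (Multiset.mem_add.2 (.inr (mem_toEdge.2 ⟨s, rfl⟩))))
  obtain ⟨m₂, hm₂, t, v, hop₂, hp₂, hs₂⟩ := E.exists_putTag hwf hrel hcrash₁ hcrash₂ hr hp₁
    (hop₁.symm ▸ hs₁)
  obtain ⟨m₃, hm₃, hop₃, hv⟩ := E.exists_returned hwf hrel hcrash₁ hr hp₂ (hop₂.symm ▸ hs₂)
  exact ⟨m₃, by omega, hop₃.trans (hop₂.trans hop₁), hv⟩

end Execution

end Liveness

end LDS

theorem theorem1 {F W R : Type*} [Field F] [Fintype F] [DecidableEq F] [LinearOrder W]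
    [DecidableEq R] (P : LDS.Params F W) (hf₁ : 2 * P.f₁ < P.n₁) (hf₂ : 3 * P.f₂ < P.n₂)
    (E : LDS.Execution P R) (hwf : E.WellFormed) (hrel : E.Reliable)
    (hcrash₁ : {s : Fin P.n₁ | E.Faulty (.edge s)}.ncard ≤ P.f₁)
    (hcrash₂ : {i : Fin P.n₂ | E.Faulty (.back i)}.ncard ≤ P.f₂) :
    (∀ (w : W) (v : P.Val) (n : ℕ), ¬ E.Faulty (.writer w) →
      E.act n = .run (.invokeWrite w v) → E.WriteCompletes w n) ∧
    (∀ (r : R) (n : ℕ), ¬ E.Faulty (.reader r) →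
      E.act n = .run (.invokeRead r) → E.ReadCompletes r n) := by
  exact ⟨fun w v n hw hact => E.writeCompletes hwf hrel hcrash₁ hw hact,
    fun r n hr hact => E.readCompletes hwf hrel hcrash₁ hcrash₂ hr hact⟩
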